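/- Let $d\ge 3$, $N=2^{\lfloor (d+1)/2\rfloor}$, $m\ge 0$, and let $\alpha_1,\dots,\alpha_d,\beta\in\mathbb C^{N\times N}$ be Dirac matrices, i.e. Hermitian matrices with $\alpha_j\alpha_k+\alpha_k\alpha_j=2\delta_{jk}\mathbb I$, $\alpha_j\beta+\beta\alpha_j=0$, $\beta^2=\mathbb I$. Write $L^2$ and $H^1$ for $L^2(\mathbb R^d;\mathbb C^N)$ and $H^1(\mathbb R^d;\mathbb C^N)$, $\|\cdot\|$ for the $L^2$ norm, and $|M|$ for the operator norm of a matrix $M$. For $A:\mathbb R^d\to\mathbb R^d$ put $\nabla_{\!A}=\nabla-iA$ and $B_{jk}=\partial_jA_k-\partial_kA_j$ (in the sense of distributions), and for $V:\mathbb R^d\to\mathbb C^{N\times N}$ let $$H_m(A,V)=-i\sum_{j=1}^d\alpha_j(\partial_j-iA_j)+m\beta+V$$ act in $L^2$ on those $\psi\in H^1$ for which the result is in $L^2$; write $H_m(A)=H_m(A,0)$. Let $\sigma_p$ denote the point spectrum (set of eigenvalues). Let $|\nabla V(x)|=\sup_{|\omega|=1}|(\omega\cdot\nabla)V(x)|$.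 Assume that $A\in L^2_{\rm loc}$, that $B\in L^2_{\rm loc}$, and that $H_m(A)$ is self-adjoint in $L^2$ with domain $H^1$. Assume that $V(x)$ is Hermitian for a.e. $x$ and that there are $a\in(0,1]$, $b>0$ with $\|V\psi\|^2\le a\|H_m(A)\psi\|^2+b\|\psi\|^2$ for all $\psi\in H^1$. Assume moreover that $V\in C^\infty(\mathbb R^d\setminus\{0\})$, that $V$ is bounded outside any ball containing the origin, and that there are constants $\varepsilon_1,\varepsilon_2,\varepsilon_3,\varepsilon_4\ge 0$ with $$\frac{4d-6}{d-2}\,\varepsilon_1+\frac{4}{d-2}\,\varepsilon_2\varepsilon_3+2m\varepsilon_4^2+\frac{8d-8}{d-2}\,\varepsilon_3+\frac{4d-4}{d-2}\,\varepsilon_2\le 2$$ such that $\sup_{x\in\mathbb R^d}|x||V(x)|\le\varepsilon_3$ and, for every $\psi\in H^1$, $$\int|x|^2|B|^2|\psi|^2\le\varepsilon_1^2\|\nabla_{\!A}\psi\|^2,\qquad \int|x|^2|\nabla V|^2|\psi|^2\le\varepsilon_2^2\|\nabla_{\!A}\psi\|^2,$$ and, if $m\ne 0$, also $$\int|x||\nabla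 V||\psi|^2\le\varepsilon_4^2\|\nabla_{\!A}\psi\|^2 .$$ Then for every unitary matrix $P\in\mathbb C^{N\times N}$ one has $\sigma_p(H_m(A,PVP^*))=\varnothing$. -/

import Mathlib

open MeasureTheory
open scoped ENNReal ContDiff Matrix Matrix.Norms.L2Operator

/-! With `Matrix.Norms.L2Operator` open, `‖M‖` for a matrix `M` is the operator norm
`sup |M v| / |v|` with respect to Euclidean norms of vectors. -/

namespace MagneticDirac

/-- Physical space `ℝ^d` with the Euclidean norm. -/
abbrev Space (d : ℕ) : Type := EuclideanSpace ℝ (Fin d)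

/-- Spinor values `ℂ^N` with the Hermitian norm. -/
abbrev Spinor (N : ℕ) : Type := EuclideanSpace ℂ (Fin N)

/-- The Hilbert space `L²(ℝ^d; ℂ^N)`. -/
abbrev L2 (d N : ℕ) : Type := Lp (Spinor N) 2 (volume : Measure (Space d))

/-- The `j`-th partial derivative of a real function on `ℝ^d`. -/
noncomputable def partialDeriv {d : ℕ} (j : Fin d) (φ : Space d → ℝ) (x : Space d) : ℝ :=
  fderiv ℝ φ x (EuclideanSpace.single j 1)

/-- Real test functions `φ ∈ C_c^∞(ℝ^d)`. -/
def IsTest {d : ℕ} (φ : Space d → ℝ) : Prop :=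
  ContDiff ℝ ∞ φ ∧ HasCompactSupport φ

/-- `g = ∂_j ψ` in the sense of distributions, for `ψ, g ∈ L²`. -/
def IsWeakPartial {d N : ℕ} (j : Fin d) (ψ g : L2 d N) : Prop :=
  ∀ φ : Space d → ℝ, IsTest φ →
    ∫ x, φ x • g x = - ∫ x, partialDeriv j φ x • ψ x

section Helpers

variable {d N : ℕ}

theorem IsTest.integrable_smul {φ : Space d → ℝ} (hφ : IsTest φ) (g : L2 d N) :
    Integrable (fun x => φ x • g x) := by
  have hg : LocallyIntegrable (g : Space d → Spinor N) volume :=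
    (Lp.memLp g).locallyIntegrable (by norm_num)
  exact hg.integrable_smul_left_of_hasCompactSupport hφ.1.continuous hφ.2

theorem IsTest.integrable_partialDeriv_smul {φ : Space d → ℝ} (hφ : IsTest φ) (j : Fin d)
    (g : L2 d N) : Integrable (fun x => partialDeriv j φ x • g x) := by
  have hg : LocallyIntegrable (g : Space d → Spinor N) volume :=
    (Lp.memLp g).locallyIntegrable (by norm_num)
  refine hg.integrable_smul_left_of_hasCompactSupport ?_ ?_
  · exact (hφ.1.continuous_fderiv (by simp)).clm_apply continuous_const
  · exact hφ.2.fderiv_apply ℝ _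

theorem IsWeakPartial.add {j : Fin d} {ψ₁ ψ₂ g₁ g₂ : L2 d N} (h₁ : IsWeakPartial j ψ₁ g₁)
    (h₂ : IsWeakPartial j ψ₂ g₂) : IsWeakPartial j (ψ₁ + ψ₂) (g₁ + g₂) := by
  intro φ hφ
  have e₁ : (fun x => φ x • (g₁ + g₂ : L2 d N) x) =ᵐ[volume]
      fun x => φ x • g₁ x + φ x • g₂ x := by
    filter_upwards [Lp.coeFn_add g₁ g₂] with x hx
    rw [hx, Pi.add_apply, smul_add]
  have e₂ : (fun x => partialDeriv j φ x • (ψ₁ + ψ₂ : L2 d N) x) =ᵐ[volume]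
      fun x => partialDeriv j φ x • ψ₁ x + partialDeriv j φ x • ψ₂ x := by
    filter_upwards [Lp.coeFn_add ψ₁ ψ₂] with x hx
    rw [hx, Pi.add_apply, smul_add]
  rw [integral_congr_ae e₁, integral_congr_ae e₂,
    integral_add (hφ.integrable_smul g₁) (hφ.integrable_smul g₂),
    integral_add (hφ.integrable_partialDeriv_smul j ψ₁) (hφ.integrable_partialDeriv_smul j ψ₂),
    h₁ φ hφ, h₂ φ hφ, neg_add]

theorem IsWeakPartial.smul {j : Fin d} {ψ g : L2 d N} (c : ℂ) (h : IsWeakPartial j ψ g) :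
    IsWeakPartial j (c • ψ) (c • g) := by
  intro φ hφ
  have e₁ : (fun x => φ x • (c • g : L2 d N) x) =ᵐ[volume] fun x => c • (φ x • g x) := by
    filter_upwards [Lp.coeFn_smul c g] with x hx
    rw [hx, Pi.smul_apply, smul_comm]
  have e₂ : (fun x => partialDeriv j φ x • (c • ψ : L2 d N) x) =ᵐ[volume]
      fun x => c • (partialDeriv j φ x • ψ x) := by
    filter_upwards [Lp.coeFn_smul c ψ] with x hx
    rw [hx, Pi.smul_apply, smul_comm]
  rw [integral_congr_ae e₁, integral_congr_ae e₂, integral_smul, integral_smul, h φ hφ, smul_neg]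

theorem IsWeakPartial.unique {j : Fin d} {ψ g g' : L2 d N} (h : IsWeakPartial j ψ g)
    (h' : IsWeakPartial j ψ g') : g = g' := by
  apply Lp.ext
  refine ae_eq_of_integral_contDiff_smul_eq ((Lp.memLp g).locallyIntegrable (by norm_num))
    ((Lp.memLp g').locallyIntegrable (by norm_num)) ?_
  intro φ h₁ h₂
  rw [h φ ⟨h₁, h₂⟩, h' φ ⟨h₁, h₂⟩]

end Helpers

/-- The Sobolev space `H¹(ℝ^d; ℂ^N)`: all first weak partial derivatives are in `L²`. -/
def H1 (d N : ℕ) : Submodule ℂ (L2 d N) where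
  carrier := {ψ | ∀ j : Fin d, ∃ g : L2 d N, IsWeakPartial j ψ g}
  add_mem' h₁ h₂ j := ⟨_, (h₁ j).choose_spec.add (h₂ j).choose_spec⟩
  zero_mem' j := ⟨0, by
    simpa using IsWeakPartial.smul (N := N) (j := j) (ψ := 0) (g := 0) 0 (fun φ _ => by
      have e : (fun x => φ x • (0 : L2 d N) x) =ᵐ[volume] fun _ => (0 : Spinor N) := by
        filter_upwards [Lp.coeFn_zero (Spinor N) 2 (volume : Measure (Space d))] with x hx
        rw [hx, Pi.zero_apply, smul_zero]
      have e' : (fun x => partialDeriv j φ x • (0 : L2 d N) x) =ᵐ[volume]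
          fun _ => (0 : Spinor N) := by
        filter_upwards [Lp.coeFn_zero (Spinor N) 2 (volume : Measure (Space d))] with x hx
        rw [hx, Pi.zero_apply, smul_zero]
      rw [integral_congr_ae e, integral_congr_ae e']; simp)⟩
  smul_mem' c _ h j := ⟨_, (h j).choose_spec.smul c⟩

/-- The weak partial derivative `∂_j : H¹ → L²`. -/
noncomputable def weakPartial {d N : ℕ} (j : Fin d) : H1 d N →ₗ[ℂ] L2 d N where
  toFun ψ := (ψ.2 j).choose
  map_add' ψ₁ ψ₂ := ((ψ₁ + ψ₂).2 j).choose_spec.unique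
    ((ψ₁.2 j).choose_spec.add (ψ₂.2 j).choose_spec)
  map_smul' c ψ := ((c • ψ).2 j).choose_spec.unique ((ψ.2 j).choose_spec.smul c)

theorem weakPartial_spec {d N : ℕ} (j : Fin d) (ψ : H1 d N) :
    IsWeakPartial j (ψ : L2 d N) (weakPartial j ψ) :=
  (ψ.2 j).choose_spec

/-- The magnetic derivative `∂_j^A ψ = ∂_j ψ - i A_j ψ`. -/
noncomputable def magPartial {d N : ℕ} (A : Space d → Space d) (j : Fin d) (ψ : H1 d N)
    (x : Space d) : Spinor N :=
  weakPartial j ψ x - (Complex.I * (A x j : ℂ)) • (ψ : L2 d N) x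

/-- `‖∇_A ψ‖² = ∫ ∑_j |∂_j^A ψ|²`, as an element of `[0, ∞]`. -/
noncomputable def magGradSq {d N : ℕ} (A : Space d → Space d) (ψ : H1 d N) : ℝ≥0∞ :=
  ∫⁻ x, ∑ j : Fin d, ‖magPartial A j ψ x‖ₑ ^ 2

/-- Hermitian Dirac matrices `α_1, …, α_d, β`. -/
structure IsDiracMatrices {d N : ℕ} (α : Fin d → Matrix (Fin N) (Fin N) ℂ)
    (β : Matrix (Fin N) (Fin N) ℂ) : Prop where
  alpha_hermitian : ∀ j, (α j).IsHermitian
  beta_hermitian : β.IsHermitian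
  alpha_anticomm : ∀ j k, α j * α k + α k * α j = if j = k then 2 else 0
  alpha_beta_anticomm : ∀ j, α j * β + β * α j = 0
  beta_sq : β * β = 1

/-- The differential expression `-i α · ∇_A ψ + m β ψ + V ψ`, for `ψ ∈ H¹`. -/
noncomputable def diracExpr {d N : ℕ} (α : Fin d → Matrix (Fin N) (Fin N) ℂ)
    (β : Matrix (Fin N) (Fin N) ℂ) (m : ℝ) (A : Space d → Space d)
    (V : Space d → Matrix (Fin N) (Fin N) ℂ) (ψ : H1 d N) (x : Space d) : Spinor N :=
  (-Complex.I) • ∑ j : Fin d, Matrix.toEuclideanLin (α j) (magPartial A j ψ x)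
    + (m : ℂ) • Matrix.toEuclideanLin β ((ψ : L2 d N) x)
    + Matrix.toEuclideanLin (V x) ((ψ : L2 d N) x)

section Linearity

variable {d N : ℕ} (α : Fin d → Matrix (Fin N) (Fin N) ℂ) (β : Matrix (Fin N) (Fin N) ℂ) (m : ℝ)
  (A : Space d → Space d) (V : Space d → Matrix (Fin N) (Fin N) ℂ)

theorem magPartial_add (j : Fin d) (ψ₁ ψ₂ : H1 d N) :
    magPartial A j (ψ₁ + ψ₂) =ᵐ[volume] magPartial A j ψ₁ + magPartial A j ψ₂ := by
  filter_upwards [Lp.coeFn_add (weakPartial j ψ₁) (weakPartial j ψ₂),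
    Lp.coeFn_add (ψ₁ : L2 d N) (ψ₂ : L2 d N)] with x h₁ h₂
  simp only [magPartial, map_add, Submodule.coe_add, Pi.add_apply, h₁, h₂, smul_add]
  abel

theorem magPartial_smul (j : Fin d) (c : ℂ) (ψ : H1 d N) :
    magPartial A j (c • ψ) =ᵐ[volume] c • magPartial A j ψ := by
  filter_upwards [Lp.coeFn_smul c (weakPartial j ψ), Lp.coeFn_smul c (ψ : L2 d N)] with x h₁ h₂
  simp only [magPartial, map_smul, Submodule.coe_smul, Pi.smul_apply, h₁, h₂, smul_sub]
  rw [smul_comm]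

theorem diracExpr_add (ψ₁ ψ₂ : H1 d N) :
    diracExpr α β m A V (ψ₁ + ψ₂) =ᵐ[volume]
      diracExpr α β m A V ψ₁ + diracExpr α β m A V ψ₂ := by
  have h := fun j => magPartial_add A j ψ₁ ψ₂
  filter_upwards [ae_all_iff.2 h, Lp.coeFn_add (ψ₁ : L2 d N) (ψ₂ : L2 d N)] with x h₁ h₂
  simp only [diracExpr, h₁, Submodule.coe_add, h₂, Pi.add_apply, map_add, smul_add,
    Finset.sum_add_distrib]
  abel

theorem diracExpr_smul (c : ℂ) (ψ : H1 d N) :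
    diracExpr α β m A V (c • ψ) =ᵐ[volume] c • diracExpr α β m A V ψ := by
  have h := fun j => magPartial_smul A j c ψ
  filter_upwards [ae_all_iff.2 h, Lp.coeFn_smul c (ψ : L2 d N)] with x h₁ h₂
  simp only [diracExpr, h₁, Submodule.coe_smul, h₂, Pi.smul_apply, map_smul, smul_add,
    ← Finset.smul_sum]
  rw [smul_comm c (-Complex.I), smul_comm c (m : ℂ)]

/-- The Dirac operator `H_m(A,V) = -i α · ∇_A + m β + V` as an unbounded operator in `L²`, with
domain the set of all `ψ ∈ H¹` that it maps to `L²`. -/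
noncomputable def diracOp : L2 d N →ₗ.[ℂ] L2 d N where
  domain :=
    { carrier := {ψ | ∃ h : ψ ∈ H1 d N, MemLp (diracExpr α β m A V ⟨ψ, h⟩) 2 volume}
      add_mem' := fun {ψ₁ ψ₂} ⟨h₁, k₁⟩ ⟨h₂, k₂⟩ => ⟨add_mem h₁ h₂,
        (memLp_congr_ae (diracExpr_add α β m A V ⟨ψ₁, h₁⟩ ⟨ψ₂, h₂⟩)).2 (k₁.add k₂)⟩
      zero_mem' := ⟨zero_mem _, by
        have h := diracExpr_smul α β m A V 0 0
        simp only [zero_smul] at h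
        exact (memLp_congr_ae h).2 MemLp.zero⟩
      smul_mem' := fun c ψ ⟨h, k⟩ => ⟨Submodule.smul_mem _ c h,
        (memLp_congr_ae (diracExpr_smul α β m A V c ⟨ψ, h⟩)).2 (k.const_smul c)⟩ }
  toFun :=
    { toFun := fun ψ => MemLp.toLp (diracExpr α β m A V ⟨ψ, ψ.2.1⟩) ψ.2.2
      map_add' := fun ψ₁ ψ₂ =>
        ((MemLp.toLp_eq_toLp_iff _ (ψ₁.2.2.add ψ₂.2.2)).2
          (diracExpr_add α β m A V ⟨ψ₁, ψ₁.2.1⟩ ⟨ψ₂, ψ₂.2.1⟩)).trans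
          (MemLp.toLp_add ψ₁.2.2 ψ₂.2.2)
      map_smul' := fun c ψ =>
        ((MemLp.toLp_eq_toLp_iff _ (ψ.2.2.const_smul c)).2
          (diracExpr_smul α β m A V c ⟨ψ, ψ.2.1⟩)).trans
          (MemLp.toLp_const_smul c ψ.2.2) }

theorem mem_diracOp_domain_iff (ψ : L2 d N) :
    ψ ∈ (diracOp α β m A V).domain ↔
      ∃ h : ψ ∈ H1 d N, MemLp (diracExpr α β m A V ⟨ψ, h⟩) 2 volume := Iff.rfl

theorem diracOp_apply (ψ : (diracOp α β m A V).domain) :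
    diracOp α β m A V ψ =ᵐ[volume] diracExpr α β m A V ⟨ψ, ψ.2.1⟩ :=
  MemLp.coeFn_toLp ψ.2.2

end Linearity

/-- The point spectrum (set of eigenvalues) of an unbounded operator. -/
def pointSpectrum {F : Type*} [AddCommGroup F] [Module ℂ F] (T : F →ₗ.[ℂ] F) : Set ℂ :=
  {z | ∃ ψ : T.domain, (ψ : F) ≠ 0 ∧ T ψ = z • (ψ : F)}

/-- `f ∈ L²_loc(ℝ^d)`. -/
def IsLocL2 {d : ℕ} {F : Type*} [NormedAddCommGroup F] (f : Space d → F) : Prop :=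
  ∀ K : Set (Space d), IsCompact K → MemLp f 2 (volume.restrict K)

/-- `B_{jk} = ∂_j A_k - ∂_k A_j` in the sense of distributions. -/
def IsMagneticField {d : ℕ} (A : Space d → Space d)
    (B : Space d → Matrix (Fin d) (Fin d) ℝ) : Prop :=
  ∀ j k : Fin d, ∀ φ : Space d → ℝ, IsTest φ →
    ∫ x, φ x * B x j k = - ∫ x, (partialDeriv j φ x * A x k - partialDeriv k φ x * A x j)

/-- Standing assumptions on the magnetic potential: `A ∈ L²_loc`, `B ∈ L²_loc` is its magnetic
field, and `H_m(A) = H_m(A,0)` is self-adjoint in `L²` with domain `H¹`. -/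
structure IsAdmissibleMagnetic {d N : ℕ} (α : Fin d → Matrix (Fin N) (Fin N) ℂ)
    (β : Matrix (Fin N) (Fin N) ℂ) (m : ℝ) (A : Space d → Space d)
    (B : Space d → Matrix (Fin d) (Fin d) ℝ) : Prop where
  locL2_potential : IsLocL2 A
  locL2_field : IsLocL2 B
  isMagneticField : IsMagneticField A B
  domain_eq : (diracOp α β m A 0).domain = H1 d N
  selfAdjoint : IsSelfAdjoint (diracOp α β m A 0)

/-- Standing assumptions on the electric potential: `V(x)` is Hermitian for a.e. `x`, and there are
`a ∈ (0, 1]`, `b > 0` with `‖V ψ‖² ≤ a ‖H_m(A) ψ‖² + b ‖ψ‖²` for all `ψ ∈ H¹`. -/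
structure IsAdmissibleElectric {d N : ℕ} (α : Fin d → Matrix (Fin N) (Fin N) ℂ)
    (β : Matrix (Fin N) (Fin N) ℂ) (m : ℝ) (A : Space d → Space d)
    (V : Space d → Matrix (Fin N) (Fin N) ℂ) : Prop where
  hermitian : ∀ᵐ x, (V x).IsHermitian
  relBounded : ∃ a b : ℝ, 0 < a ∧ a ≤ 1 ∧ 0 < b ∧ ∀ ψ : H1 d N,
    ∫⁻ x, ‖Matrix.toEuclideanLin (V x) ((ψ : L2 d N) x)‖ₑ ^ 2 ≤
      ENNReal.ofReal a * (∫⁻ x, ‖diracExpr α β m A 0 ψ x‖ₑ ^ 2)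
        + ENNReal.ofReal b * ∫⁻ x, ‖(ψ : L2 d N) x‖ₑ ^ 2

end MagneticDirac

namespace MagneticDirac

open Matrix (toEuclideanLin)

/-! ### Matrices acting on spinors -/

section MatrixAction

variable {N : ℕ}

/-! Conjugation by `P` keeps the electric potential Hermitian, preserves its norm and does not
increase the norm of its gradient. Since only these data enter the argument, it suffices to treat a
general potential with the stated bounds (`pointSpectrum_diracOp_eq_empty`); call it `V`.

Let ψ ≠ 0 be an eigenfunction with eigenvalue z, which is real, and put D = -iα·∇_A, T = ‖Dψ‖, G =
‖∇_A ψ‖, Y = ‖ψ/|x|‖, b = ‖|x||B|ψ‖, v = ‖|x||∇V|ψ‖, w = ‖Vψ‖. Write c(u) = ∑ u_j α_j for Clifford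
multiplication and n = d - 2. Hardy's inequality (`IsMagneticPair.hardy`) gives nY ≤ 2G, so b, v and
w are all at most a small constant times G.

Two identities are played against each other. Commuting D with dilations gives a virial identity
(`IsMagneticPair.virial`) expressing ⟨ψ, Dψ⟩ through c(Bx) and x·∇V. Multiplying it by z and
replacing zψ by Dψ + mβψ + Vψ turns it into T² ≤ K + R (`IsMagneticPair.virial_estimate`), where K =
Re⟨Dψ, c(Bx)ψ⟩ and R collects the electric terms; β anticommutes with every c(u), so the other mass
contributions vanish. The Lichnerowicz formula (`IsMagneticPair.integral_inner_diracGrad_self`)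
gives T² = G² + S, where S is the spin term of the field. Hence G² ≤ (K - S) + R, and what remains
is to show that the right side is smaller than G².

The delicate quantity is K - S ≤ bL, where L < (2 + 1/n)G is needed once T < G is known. The spin
matrix is a Clifford trace ∑ c(e_j)c(Be_j), which may be computed in any orthonormal basis, so each
basis vector killed by B saves one term. In odd dimension the skew matrix B has a kernel, the trace
is at most (d - 1)|B|, and Hardy gives the bound on L directly. In even dimension B may be
invertible, but its compression to the hyperplane orthogonal to x has odd size and hence a kernel,
so the tangential part of the spin term is at most (d - 2)|B|. The radial part is absorbed into D,
which becomes D - i|x|⁻²c(x) (`shiftedGrad`). The norm of the shifted gradient is controlled by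
splitting ∇_A into radial and tangential parts (`IsMagneticPair.l2norm_shiftedGrad_sq_le`) and by an
optimisation (`add_half_mul_lt`). The inequalities are combined in `virial_contradiction`.

The identities must be justified for ψ merely in H¹ and A, B merely in L²_loc. `IsMagneticPair`
isolates what is needed: integration by parts and the commutation relation in form sense. Both hold
for mollified functions and pass to the limit, because multiplication by A_j or by |x||B| is bounded
from H¹ to L²; for A_j this follows from the domain assumption and the closed graph theorem. Growing
or singular multipliers are reached through cutoffs θ_n with |x||∇θ_n| bounded, whose gradient terms
disappear in the limit by Hardy's inequality or by the linear growth of the multiplier. -/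

theorem norm_toEuclideanLin_le {𝕜 : Type*} [RCLike 𝕜] (M : Matrix (Fin N) (Fin N) 𝕜)
    (v : EuclideanSpace 𝕜 (Fin N)) :
    ‖toEuclideanLin M v‖ ≤ ‖M‖ * ‖v‖ :=
  M.l2_opNorm_mulVec v

theorem toEuclideanLin_mul_apply (M M' : Matrix (Fin N) (Fin N) ℂ) (v : Spinor N) :
    toEuclideanLin (M * M') v = toEuclideanLin M (toEuclideanLin M' v) := by
  ext i
  simp [Matrix.toEuclideanLin, Matrix.mulVec_mulVec]

theorem toEuclideanLin_one_apply (v : Spinor N) :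
    toEuclideanLin (1 : Matrix (Fin N) (Fin N) ℂ) v = v := by
  ext i
  simp [Matrix.toEuclideanLin]

theorem inner_toEuclideanLin_right (M : Matrix (Fin N) (Fin N) ℂ) (u v : Spinor N) :
    inner ℂ u (toEuclideanLin M v) = inner ℂ (toEuclideanLin Mᴴ u) v := by
  rw [Matrix.toEuclideanLin_conjTranspose_eq_adjoint, LinearMap.adjoint_inner_left]

theorem _root_.Matrix.IsHermitian.inner_toEuclideanLin {M : Matrix (Fin N) (Fin N) ℂ}
    (hM : M.IsHermitian) (u v : Spinor N) :
    inner ℂ (toEuclideanLin M u) v = inner ℂ u (toEuclideanLin M v) := by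
  rw [inner_toEuclideanLin_right, hM.eq]

/-- The quadratic form of a Hermitian matrix is real. -/
theorem _root_.Matrix.IsHermitian.inner_toEuclideanLin_self_im {M : Matrix (Fin N) (Fin N) ℂ}
    (hM : M.IsHermitian) (v : Spinor N) : (inner ℂ v (toEuclideanLin M v)).im = 0 := by
  have h := inner_conj_symm (𝕜 := ℂ) v (toEuclideanLin M v)
  rw [hM.inner_toEuclideanLin] at h
  exact Complex.conj_eq_iff_im.1 h

end MatrixAction

/-! ### Clifford multiplication and Clifford traces -/

section Clifford

variable {d N : ℕ}

/-- Clifford multiplication `c(u) = ∑ u_j α_j`. -/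
noncomputable def clifford (α : Fin d → Matrix (Fin N) (Fin N) ℂ) :
    Space d →ₗ[ℝ] Matrix (Fin N) (Fin N) ℂ where
  toFun u := ∑ j, (u j : ℂ) • α j
  map_add' u v := by simp [add_smul, Finset.sum_add_distrib]
  map_smul' c u := by
    simp only [PiLp.smul_apply, smul_eq_mul, Complex.ofReal_mul, mul_smul, RingHom.id_apply,
      Finset.smul_sum]
    rfl

variable {α : Fin d → Matrix (Fin N) (Fin N) ℂ} {β : Matrix (Fin N) (Fin N) ℂ}

theorem clifford_apply (u : Space d) : clifford α u = ∑ j, (u j : ℂ) • α j := rfl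

theorem clifford_single (j : Fin d) : clifford α (EuclideanSpace.single j 1) = α j := by
  rw [clifford_apply, Finset.sum_eq_single j]
  · simp
  · intro k _ hk
    simp [hk]
  · simp

theorem IsDiracMatrices.clifford_hermitian (h : IsDiracMatrices α β) (u : Space d) :
    (clifford α u).IsHermitian := by
  rw [clifford_apply, Matrix.IsHermitian, Matrix.conjTranspose_sum]
  refine Finset.sum_congr rfl fun j _ => ?_
  rw [Matrix.conjTranspose_smul, (h.alpha_hermitian j).eq]
  simp

theorem IsDiracMatrices.clifford_anticomm (h : IsDiracMatrices α β) (u v : Space d) :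
    clifford α u * clifford α v + clifford α v * clifford α u
      = ((2 * inner ℝ u v : ℝ) : ℂ) • (1 : Matrix (Fin N) (Fin N) ℂ) := by
  have e : clifford α u * clifford α v + clifford α v * clifford α u
      = ∑ j, ∑ k, ((u j : ℂ) * (v k : ℂ)) • (α j * α k + α k * α j) := by
    simp only [clifford_apply, Finset.sum_mul_sum, smul_add, Finset.sum_add_distrib]
    congr 1
    · simp only [smul_mul_smul_comm]
    · rw [Finset.sum_comm]
      simp only [smul_mul_smul_comm]
      simp only [mul_comm]
  rw [e]
  simp only [h.alpha_anticomm, smul_ite, smul_zero, Finset.sum_ite_eq, Finset.mem_univ, if_true]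
  have h2 : (2 : Matrix (Fin N) (Fin N) ℂ) = (2 : ℂ) • 1 := by
    ext i j
    simp [Matrix.ofNat_apply, Matrix.one_apply]
  simp only [h2, smul_smul, ← Finset.sum_smul]
  congr 1
  simp [PiLp.inner_apply, Finset.mul_sum]
  refine Finset.sum_congr rfl fun j _ => ?_
  ring

theorem IsDiracMatrices.clifford_beta_anticomm (h : IsDiracMatrices α β) (u : Space d) :
    clifford α u * β = -(β * clifford α u) := by
  rw [eq_neg_iff_add_eq_zero, clifford_apply, Finset.sum_mul, Finset.mul_sum,
    ← Finset.sum_add_distrib]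
  refine Finset.sum_eq_zero fun j _ => ?_
  rw [smul_mul_assoc, mul_smul_comm, ← smul_add, h.alpha_beta_anticomm, smul_zero]

theorem IsDiracMatrices.clifford_sq (h : IsDiracMatrices α β) (u : Space d) :
    clifford α u * clifford α u = ((‖u‖ ^ 2 : ℝ) : ℂ) • (1 : Matrix (Fin N) (Fin N) ℂ) := by
  have e := h.clifford_anticomm u u
  rw [← two_smul ℂ, real_inner_self_eq_norm_sq] at e
  have := congrArg (fun M => (1 / 2 : ℂ) • M) e
  simpa [smul_smul] using this

/-- Follows from c(u)² = |u|² and Hermiticity. The exact equality matters: it later recovers |A||ψ|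
from the single spinor α·Aψ. -/
theorem IsDiracMatrices.norm_clifford_apply (h : IsDiracMatrices α β) (u : Space d)
    (v : Spinor N) : ‖toEuclideanLin (clifford α u) v‖ = ‖u‖ * ‖v‖ := by
  have e : ‖toEuclideanLin (clifford α u) v‖ ^ 2 = (‖u‖ * ‖v‖) ^ 2 := by
    rw [← inner_self_eq_norm_sq (𝕜 := ℂ), (h.clifford_hermitian u).inner_toEuclideanLin,
      ← toEuclideanLin_mul_apply, h.clifford_sq, map_smul, LinearMap.smul_apply,
      toEuclideanLin_one_apply, inner_smul_right, RCLike.re_eq_complex_re,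
      Complex.re_ofReal_mul, ← RCLike.re_eq_complex_re, inner_self_eq_norm_sq, mul_pow]
  exact (sq_eq_sq₀ (norm_nonneg _) (by positivity)).1 e

/-- `∑_j c(e_j) c(L e_j)`. -/
noncomputable def cliffordTrace (α : Fin d → Matrix (Fin N) (Fin N) ℂ)
    (L : Space d →ₗ[ℝ] Space d) : Matrix (Fin N) (Fin N) ℂ :=
  ∑ j, clifford α (EuclideanSpace.single j 1) * clifford α (L (EuclideanSpace.single j 1))

/-- The Clifford trace does not depend on the orthonormal basis. -/
theorem cliffordTrace_eq_sum (L : Space d →ₗ[ℝ] Space d)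
    (f : OrthonormalBasis (Fin d) ℝ (Space d)) :
    cliffordTrace α L = ∑ a, clifford α (f a) * clifford α (L (f a)) := by
  have e₁ : ∀ j, clifford α (EuclideanSpace.single j 1)
      = ∑ a, (f a j) • clifford α (f a) := by
    intro j
    conv_lhs => rw [← f.sum_repr (EuclideanSpace.single j 1)]
    rw [map_sum]
    refine Finset.sum_congr rfl fun a _ => ?_
    rw [map_smul, f.repr_apply_apply, EuclideanSpace.inner_single_right]
    simp
  have e₂ : ∀ a, clifford α (L (f a))
      = ∑ j, (f a j) • clifford α (L (EuclideanSpace.single j 1)) := by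
    intro a
    have : f a = ∑ j, (f a j) • (EuclideanSpace.single j 1 : Space d) := by
      conv_lhs => rw [← (EuclideanSpace.basisFun (Fin d) ℝ).sum_repr (f a)]
      simp
    conv_lhs => rw [this]
    simp only [map_sum, map_smul]
  simp only [cliffordTrace, e₂, Finset.mul_sum]
  rw [Finset.sum_comm]
  refine Finset.sum_congr rfl fun j _ => ?_
  rw [e₁ j, Finset.sum_mul]
  refine Finset.sum_congr rfl fun a _ => ?_
  rw [smul_mul_assoc, mul_smul_comm]

/-- Clifford multiplication scales norms by the length of the vector, so each term c(f_a)c(L f_a)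
has norm at most `b`, and basis vectors in the kernel of `L` contribute nothing. This is where a
kernel of the magnetic field improves the constant. -/
theorem IsDiracMatrices.norm_cliffordTrace_apply_le (h : IsDiracMatrices α β)
    (L : Space d →ₗ[ℝ] Space d) {b : ℝ} (hL : ∀ u, ‖L u‖ ≤ b * ‖u‖)
    (f : OrthonormalBasis (Fin d) ℝ (Space d)) (s : Finset (Fin d)) (hs : ∀ a ∈ s, L (f a) = 0)
    (v : Spinor N) :
    ‖toEuclideanLin (cliffordTrace α L) v‖ ≤ ((d : ℝ) - s.card) * b * ‖v‖ := by
  rw [cliffordTrace_eq_sum L f, ← Finset.sum_subset (Finset.subset_univ sᶜ), map_sum,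
    LinearMap.sum_apply]
  · have hc : ((sᶜ.card : ℕ) : ℝ) = (d : ℝ) - s.card := by
      rw [Finset.card_compl, Fintype.card_fin, Nat.cast_sub]
      simpa using s.card_le_univ
    rw [← hc, mul_assoc, ← nsmul_eq_mul]
    refine (norm_sum_le _ _).trans (Finset.sum_le_card_nsmul _ _ _ fun a _ => ?_)
    rw [toEuclideanLin_mul_apply, h.norm_clifford_apply, h.norm_clifford_apply,
      f.orthonormal.1, one_mul]
    have := hL (f a)
    rw [f.orthonormal.1, mul_one] at this
    gcongr
  · intro a _ ha
    rw [hs a (by simpa using ha), map_zero, mul_zero]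

end Clifford

/-! ### Kernels of skew matrices and sharp bounds for the spin term -/

section Skew

/-- In odd size, det M = det Mᵀ = -det M. -/
theorem exists_mulVec_eq_zero_of_skew_odd {n : Type*} [Fintype n] [DecidableEq n]
    (M : Matrix n n ℝ) (hM : Mᵀ = -M) (hn : Odd (Fintype.card n)) :
    ∃ v : n → ℝ, v ≠ 0 ∧ M.mulVec v = 0 := by
  rw [Matrix.exists_mulVec_eq_zero_iff]
  have h := M.det_transpose
  rw [hM, Matrix.det_neg, hn.neg_one_pow] at h
  linarith

variable {d N : ℕ}

theorem exists_unit_kernel_of_skew_odd (M : Matrix (Fin d) (Fin d) ℝ) (hM : Mᵀ = -M)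
    (hd : Odd d) : ∃ v : Space d, ‖v‖ = 1 ∧ toEuclideanLin M v = 0 := by
  obtain ⟨v, hv, h⟩ := exists_mulVec_eq_zero_of_skew_odd M hM (by simpa using hd)
  have hv' : (WithLp.toLp 2 v : Space d) ≠ 0 := by
    simpa using hv
  refine ⟨‖(WithLp.toLp 2 v : Space d)‖⁻¹ • WithLp.toLp 2 v, ?_, ?_⟩
  · rw [norm_smul, norm_inv, norm_norm, inv_mul_cancel₀ (norm_ne_zero_iff.2 hv')]
  · rw [map_smul, Matrix.toLpLin_toLp, Matrix.toLin'_apply, h]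
    simp

/-- In even dimension, the compression of a skew matrix to the hyperplane `r^⊥` has a kernel. -/
theorem exists_unit_kernel_of_skew_even (M : Matrix (Fin d) (Fin d) ℝ) (hM : Mᵀ = -M)
    (hd : Even d) {r : Space d} (hr : r ≠ 0) :
    ∃ (v : Space d) (t : ℝ), ‖v‖ = 1 ∧ inner ℝ r v = 0 ∧ toEuclideanLin M v = t • r := by
  -- Bordering `M` by `r` gives a skew matrix of odd size `d + 1`. A kernel vector (w, t) of it says
  -- exactly that Mw + t r = 0 and ⟨r, w⟩ = 0.
  let R : Matrix (Fin d) Unit ℝ := Matrix.of fun i _ => r i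
  let M' : Matrix (Fin d ⊕ Unit) (Fin d ⊕ Unit) ℝ := Matrix.fromBlocks M R (-Rᵀ) 0
  have hM' : M'ᵀ = -M' := by
    simp only [M', Matrix.fromBlocks_transpose, Matrix.fromBlocks_neg, hM]
    simp
  obtain ⟨v, hv, h⟩ := exists_mulVec_eq_zero_of_skew_odd M' hM' (by simpa using hd.add_one)
  have h₁ : ∀ i, ∑ j, M i j * v (Sum.inl j) + r i * v (Sum.inr ()) = 0 := by
    intro i
    have := congrFun h (Sum.inl i)
    simpa [M', Matrix.mulVec, dotProduct, R] using this
  have h₂ : ∑ j, r j * v (Sum.inl j) = 0 := by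
    have := congrFun h (Sum.inr ())
    simpa [M', Matrix.mulVec, dotProduct, R] using this
  set w : Space d := WithLp.toLp 2 fun j => v (Sum.inl j) with hw
  -- If the first block vanished, then t r = 0 with r ≠ 0 would force t = 0 as well.
  have hw0 : w ≠ 0 := by
    intro h0
    have hz : ∀ j, v (Sum.inl j) = 0 := fun j => by
      have := congrArg (fun u : Space d => u j) h0
      simpa [hw] using this
    refine hv (funext fun i => ?_)
    rcases i with i | i
    · exact hz i
    · have : ∃ i, r i ≠ 0 := by
        by_contra! hc
        exact hr (by ext i; simpa using hc i)
      obtain ⟨j, hj⟩ := this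
      have := h₁ j
      simp only [hz, mul_zero, Finset.sum_const_zero, zero_add, mul_eq_zero, hj, false_or] at this
      simpa using this
  have hMw : toEuclideanLin M w = (-v (Sum.inr ())) • r := by
    ext i
    have := h₁ i
    simp only [Matrix.toLpLin_apply, hw, PiLp.smul_apply, smul_eq_mul, Matrix.mulVec, dotProduct]
    linarith
  have hrw : inner ℝ r w = 0 := by
    simp only [PiLp.inner_apply, hw]
    rw [← h₂]
    exact Finset.sum_congr rfl fun j _ => by simp [mul_comm]
  refine ⟨‖w‖⁻¹ • w, ‖w‖⁻¹ * -v (Sum.inr ()), ?_, ?_, ?_⟩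
  · rw [norm_smul, norm_inv, norm_norm, inv_mul_cancel₀ (norm_ne_zero_iff.2 hw0)]
  · rw [inner_smul_right, hrw, mul_zero]
  · rw [map_smul, hMw, smul_smul]

variable {α : Fin d → Matrix (Fin N) (Fin N) ℂ} {β : Matrix (Fin N) (Fin N) ℂ}

theorem cliffordTrace_toEuclideanLin {M : Matrix (Fin d) (Fin d) ℝ} (hM : Mᵀ = -M) :
    cliffordTrace α (toEuclideanLin M) = -∑ j, ∑ k, (M j k : ℂ) • (α j * α k) := by
  rw [cliffordTrace, ← Finset.sum_neg_distrib]
  refine Finset.sum_congr rfl fun j _ => ?_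
  rw [clifford_single, clifford_apply, Finset.mul_sum, ← Finset.sum_neg_distrib]
  refine Finset.sum_congr rfl fun k _ => ?_
  have : M k j = -M j k := by simpa using congrFun (congrFun hM j) k
  rw [mul_smul_comm, Matrix.toLpLin_apply]
  simp [this]

/-- In odd dimension the spin term of a magnetic field `M` is bounded by `(d - 1) |M|`. -/
theorem IsDiracMatrices.norm_sum_le_of_odd (h : IsDiracMatrices α β)
    {M : Matrix (Fin d) (Fin d) ℝ} (hM : Mᵀ = -M) (hd : Odd d) (v : Spinor N) :
    ‖toEuclideanLin (∑ j, ∑ k, (M j k : ℂ) • (α j * α k)) v‖ ≤ ((d : ℝ) - 1) * ‖M‖ * ‖v‖ := by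
  obtain ⟨n, hn, hMn⟩ := exists_unit_kernel_of_skew_odd M hM hd
  let j₀ : Fin d := ⟨0, hd.pos⟩
  -- A basis containing the unit kernel vector makes one of the `d` terms of the Clifford trace
  -- vanish.
  obtain ⟨f, hf⟩ := Orthonormal.exists_orthonormalBasis_extension_of_card_eq (𝕜 := ℝ)
    (ι := Fin d) (E := Space d) (by simp) (v := fun _ => n) (s := {j₀})
    ⟨fun _ => hn, fun a b hab => absurd (Subsingleton.elim a b) hab⟩
  have key := h.norm_cliffordTrace_apply_le (toEuclideanLin M) (b := ‖M‖)
    (norm_toEuclideanLin_le M) f {j₀} (by simp [hf j₀, hMn]) v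
  rw [cliffordTrace_toEuclideanLin hM] at key
  simpa using key

theorem inner_toEuclideanLin_of_skew {M : Matrix (Fin d) (Fin d) ℝ} (hM : Mᵀ = -M)
    (u w : Space d) : inner ℝ (toEuclideanLin M u) w = -inner ℝ u (toEuclideanLin M w) := by
  have : toEuclideanLin M = -LinearMap.adjoint (toEuclideanLin M) := by
    rw [← Matrix.toEuclideanLin_conjTranspose_eq_adjoint,
      Matrix.conjTranspose_eq_transpose_of_trivial, hM]
    simp
  conv_lhs => rw [this]
  rw [LinearMap.neg_apply, inner_neg_left, LinearMap.adjoint_inner_left]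

theorem inner_toEuclideanLin_self_of_skew {M : Matrix (Fin d) (Fin d) ℝ} (hM : Mᵀ = -M)
    (u : Space d) : inner ℝ u (toEuclideanLin M u) = (0 : ℝ) := by
  have := inner_toEuclideanLin_of_skew hM u u
  rw [real_inner_comm] at this
  linarith

/-- The projection along the unit vector `r` onto its orthogonal complement. -/
noncomputable def tangentProj (r : Space d) : Space d →ₗ[ℝ] Space d :=
  LinearMap.id - (innerₛₗ ℝ r).smulRight r

theorem tangentProj_apply (r u : Space d) : tangentProj r u = u - (inner ℝ r u : ℝ) • r := by
  simp [tangentProj]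

theorem norm_tangentProj_le {r : Space d} (hr : ‖r‖ = 1) (u : Space d) :
    ‖tangentProj r u‖ ≤ ‖u‖ := by
  have : ‖tangentProj r u‖ ^ 2 = ‖u‖ ^ 2 - (inner ℝ r u : ℝ) ^ 2 := by
    rw [tangentProj_apply, norm_sub_sq_real, norm_smul, hr, inner_smul_right, real_inner_comm r u]
    simp
    ring
  refine (sq_le_sq₀ (norm_nonneg _) (norm_nonneg _)).1 ?_
  nlinarith [sq_nonneg (inner ℝ r u : ℝ)]

theorem sum_inner_single_smul_clifford (a : Space d) :
    ∑ j, (inner ℝ a (EuclideanSpace.single j (1 : ℝ)) : ℝ) •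
      clifford α (EuclideanSpace.single j 1) = clifford α a := by
  rw [clifford_apply]
  refine Finset.sum_congr rfl fun j _ => ?_
  rw [clifford_single, EuclideanSpace.inner_single_right]
  simp

theorem IsDiracMatrices.clifford_mul_toEuclideanLin (h : IsDiracMatrices α β)
    {M : Matrix (Fin d) (Fin d) ℝ} (hM : Mᵀ = -M) (r : Space d) :
    clifford α (toEuclideanLin M r) * clifford α r
      = -(clifford α r * clifford α (toEuclideanLin M r)) := by
  have hanti := h.clifford_anticomm r (toEuclideanLin M r)
  rwa [inner_toEuclideanLin_self_of_skew hM, mul_zero, Complex.ofReal_zero, zero_smul, add_comm,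
    add_eq_zero_iff_eq_neg] at hanti

/-- Since ⟨r, Mr⟩ = 0, the compression sends u to Mu - ⟨r,u⟩Mr + ⟨Mr,u⟩r. The two rank-one
corrections contribute -c(r)c(Mr) and c(Mr)c(r) to the trace, and these are equal because r ⊥ Mr
makes the factors anticommute. -/
theorem IsDiracMatrices.cliffordTrace_compression (h : IsDiracMatrices α β)
    {M : Matrix (Fin d) (Fin d) ℝ} (hM : Mᵀ = -M) {r : Space d} :
    cliffordTrace α (tangentProj r ∘ₗ toEuclideanLin M ∘ₗ tangentProj r)
      = -((∑ j, ∑ k, (M j k : ℂ) • (α j * α k))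
        + (2 : ℂ) • (clifford α r * clifford α (toEuclideanLin M r))) := by
  have hLj : ∀ u, (tangentProj r ∘ₗ toEuclideanLin M ∘ₗ tangentProj r) u = toEuclideanLin M u
      - (inner ℝ r u : ℝ) • toEuclideanLin M r + (inner ℝ (toEuclideanLin M r) u : ℝ) • r := by
    intro u
    simp only [LinearMap.comp_apply]
    rw [tangentProj_apply r (toEuclideanLin M (tangentProj r u)), tangentProj_apply r u, map_sub,
      map_smul, inner_sub_right, inner_smul_right, inner_toEuclideanLin_self_of_skew hM, mul_zero,
      sub_zero, inner_toEuclideanLin_of_skew hM r u, neg_smul]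
    abel
  have e : cliffordTrace α (tangentProj r ∘ₗ toEuclideanLin M ∘ₗ tangentProj r)
      = cliffordTrace α (toEuclideanLin M) - clifford α r * clifford α (toEuclideanLin M r)
        + clifford α (toEuclideanLin M r) * clifford α r := by
    conv_rhs =>
      rw [← sum_inner_single_smul_clifford (α := α) r]
      rw [Finset.sum_mul]
      rw [sum_inner_single_smul_clifford (α := α) r]
      rw [← sum_inner_single_smul_clifford (α := α) (toEuclideanLin M r)]
      rw [Finset.sum_mul]
      rw [sum_inner_single_smul_clifford (α := α) (toEuclideanLin M r)]
    rw [cliffordTrace, cliffordTrace, ← Finset.sum_sub_distrib, ← Finset.sum_add_distrib]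
    refine Finset.sum_congr rfl fun j _ => ?_
    rw [hLj, map_add, map_sub, map_smul, map_smul, mul_add, mul_sub, mul_smul_comm, mul_smul_comm,
      smul_mul_assoc, smul_mul_assoc]
  rw [e, h.clifford_mul_toEuclideanLin hM, cliffordTrace_toEuclideanLin hM, two_smul]
  abel

theorem exists_orthonormalBasis_pair (h2 : 2 ≤ d) {r n : Space d} (hr : ‖r‖ = 1) (hn : ‖n‖ = 1)
    (hrn : inner ℝ r n = (0 : ℝ)) : ∃ (f : OrthonormalBasis (Fin d) ℝ (Space d)) (j₀ j₁ : Fin d),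
      j₀ ≠ j₁ ∧ f j₀ = r ∧ f j₁ = n := by
  have hnr : inner ℝ n r = (0 : ℝ) := by rw [real_inner_comm, hrn]
  have hrr : inner ℝ r r = (1 : ℝ) := by simp [hr]
  have hnn : inner ℝ n n = (1 : ℝ) := by simp [hn]
  obtain ⟨j₀, j₁, h01⟩ : ∃ j₀ j₁ : Fin d, j₀ ≠ j₁ :=
    ⟨⟨0, by omega⟩, ⟨1, by omega⟩, by simp⟩
  have h10 : j₁ ≠ j₀ := h01.symm
  have ho : Orthonormal ℝ (Set.domRestrict ({j₀, j₁} : Set (Fin d))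
      (fun j => if j = j₀ then r else n)) := by
    refine ⟨?_, ?_⟩
    · rintro ⟨a, rfl | rfl⟩
      · simp [hr]
      · simp [h10, hn]
    · rintro ⟨a, rfl | rfl⟩ ⟨b, rfl | rfl⟩ hab
      · exact absurd rfl hab
      · simp [h10, hrn]
      · simp [h10, hnr]
      · exact absurd rfl hab
  obtain ⟨f, hf⟩ := ho.exists_orthonormalBasis_extension_of_card_eq (by simp)
  exact ⟨f, j₀, j₁, h01, by simpa using hf j₀ (by simp), by simpa [h10] using hf j₁ (by simp)⟩

/-- In even dimension the part of the spin term of a magnetic field `M` that is tangential to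
the sphere is bounded by `(d - 2) |M|`. -/
theorem IsDiracMatrices.norm_sum_add_le_of_even (h : IsDiracMatrices α β)
    {M : Matrix (Fin d) (Fin d) ℝ} (hM : Mᵀ = -M) (hd : Even d) (h2 : 2 ≤ d) {r : Space d}
    (hr : ‖r‖ = 1) (v : Spinor N) :
    ‖toEuclideanLin ((∑ j, ∑ k, (M j k : ℂ) • (α j * α k))
        + (2 : ℂ) • (clifford α r * clifford α (toEuclideanLin M r))) v‖
      ≤ ((d : ℝ) - 2) * ‖M‖ * ‖v‖ := by
  have hr0 : r ≠ 0 := by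
    rintro rfl
    simp at hr
  obtain ⟨n, t, hn, hrn, hMn⟩ := exists_unit_kernel_of_skew_even M hM hd hr0
  have hnr : inner ℝ n r = (0 : ℝ) := by rw [real_inner_comm, hrn]
  have hrr : inner ℝ r r = (1 : ℝ) := by simp [hr]
  have hnn : inner ℝ n n = (1 : ℝ) := by simp [hn]
  obtain ⟨f, j₀, j₁, h01, hf₀, hf₁⟩ := exists_orthonormalBasis_pair h2 hr hn hrn
  obtain ⟨L, hL⟩ : ∃ L, L = tangentProj r ∘ₗ toEuclideanLin M ∘ₗ tangentProj r := ⟨_, rfl⟩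
  have hLu : ∀ u, L u = tangentProj r (toEuclideanLin M (tangentProj r u)) := fun u => by
    rw [hL, LinearMap.comp_apply, LinearMap.comp_apply]
  have hbd : ∀ u, ‖L u‖ ≤ ‖M‖ * ‖u‖ := fun u => by
    rw [hLu]
    exact (norm_tangentProj_le hr _).trans ((norm_toEuclideanLin_le M _).trans
      (mul_le_mul_of_nonneg_left (norm_tangentProj_le hr u) (norm_nonneg _)))
  -- The compression kills two orthonormal vectors: `r`, by the inner projection, and `n`, because
  -- `M n` is parallel to `r` and the outer projection removes it.
  have h₀ : L (f j₀) = 0 := by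
    rw [hf₀, hLu, tangentProj_apply r r, hrr, one_smul, sub_self, map_zero, map_zero]
  have h₁ : L (f j₁) = 0 := by
    rw [hf₁, hLu, tangentProj_apply r n, hrn, zero_smul, sub_zero, hMn, tangentProj_apply,
      inner_smul_right, hrr, mul_one, sub_self]
  have hzero : ∀ a ∈ ({j₀, j₁} : Finset (Fin d)), L (f a) = 0 := by
    intro a ha
    simp only [Finset.mem_insert, Finset.mem_singleton] at ha
    rcases ha with ha | ha
    · rw [ha, h₀]
    · rw [ha, h₁]
  have key := h.norm_cliffordTrace_apply_le L hbd f _ hzero v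
  have e : toEuclideanLin (cliffordTrace α L) v
      = -toEuclideanLin ((∑ j, ∑ k, (M j k : ℂ) • (α j * α k))
        + (2 : ℂ) • (clifford α r * clifford α (toEuclideanLin M r))) v := by
    rw [hL, h.cliffordTrace_compression hM, map_neg, LinearMap.neg_apply]
  rw [e, norm_neg, Finset.card_pair h01] at key
  rwa [Nat.cast_ofNat] at key

end Skew

end MagneticDirac

namespace MagneticDirac

open Filter Topology Convolution

/-! ### Continuity of translations and approximate identities in L² -/

section Translation

variable {d N : ℕ}

/-- Continuity at 0 of the action of the translation group on `Lp`. -/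
theorem exists_eLpNorm_translate_sub_le (f : L2 d N) {ε : ℝ≥0∞} (hε : 0 < ε) :
    ∃ δ > 0, ∀ t : Space d, ‖t‖ < δ → eLpNorm (fun x => f (x - t) - f x) 2 volume ≤ ε := by
  have : Fact ((2 : ℝ≥0∞) ≠ ⊤) := ⟨by simp⟩
  have hc : Continuous fun t : Space d => (DomAddAct.mk (-t)) +ᵥ f := by
    have : Continuous fun t : Space d => (DomAddAct.mk (-t)) :=
      DomAddAct.continuous_mk.comp continuous_neg
    exact this.vadd continuous_const
  have h0 : (DomAddAct.mk (-(0 : Space d))) +ᵥ f = f := by simp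
  have ht : Tendsto (fun t : Space d => (DomAddAct.mk (-t)) +ᵥ f) (𝓝 0) (𝓝 f) := by
    have := hc.tendsto 0
    rwa [h0] at this
  have hev := ht (Metric.eball_mem_nhds f hε)
  obtain ⟨δ, hδ, hb⟩ := Metric.mem_nhds_iff.1 hev
  refine ⟨δ, hδ, fun t htδ => ?_⟩
  have hm : edist ((DomAddAct.mk (-t)) +ᵥ f) f < ε := hb (by simpa using htδ)
  rw [Lp.edist_def] at hm
  refine (le_of_eq ?_).trans hm.le
  refine eLpNorm_congr_ae ?_
  filter_upwards [DomAddAct.vadd_Lp_ae_eq (DomAddAct.mk (-t)) f] with x hx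
  rw [Pi.sub_apply, hx]
  simp [sub_eq_neg_add]

theorem eLpNorm_two_sq {F X : Type*} [NormedAddCommGroup F] [MeasurableSpace X] (μ : Measure X)
    (f : X → F) : eLpNorm f 2 μ ^ 2 = ∫⁻ x, ‖f x‖ₑ ^ 2 ∂μ := by
  have := eLpNorm_nnreal_pow_eq_lintegral (f := f) (μ := μ) (p := 2) (by norm_num)
  simpa using this

theorem sq_lintegral_le_of_isProbabilityMeasure {F X : Type*} [NormedAddCommGroup F]
    [MeasurableSpace X] (μ : Measure X) [IsProbabilityMeasure μ] {f : X → F}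
    (hf : AEStronglyMeasurable f μ) : (∫⁻ x, ‖f x‖ₑ ∂μ) ^ 2 ≤ ∫⁻ x, ‖f x‖ₑ ^ 2 ∂μ := by
  rw [← eLpNorm_two_sq, ← eLpNorm_one_eq_lintegral_enorm]
  gcongr
  exact eLpNorm_le_eLpNorm_of_exponent_le (by norm_num) hf

/-- The convolution minus `f` is an average of the differences f(x - t) - f(x) over the probability
measure with density the bump. Jensen's inequality for the square and Tonelli reduce the claim to
the translates with |t| below the outer radius. -/
theorem eLpNorm_convolution_sub_le (φ : ContDiffBump (0 : Space d)) (f : L2 d N) {ε : ℝ≥0∞}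
    (h : ∀ t : Space d, ‖t‖ < φ.rOut → eLpNorm (fun x => f (x - t) - f x) 2 volume ≤ ε) :
    eLpNorm (fun x => (φ.normed volume ⋆[ContinuousLinearMap.lsmul ℝ ℝ, volume] f) x - f x) 2
      volume ≤ ε := by
  set w : Space d → ℝ := φ.normed volume with hw
  have hw0 : ∀ t, 0 ≤ w t := fun t => φ.nonneg_normed t
  have hwc : Continuous w := φ.continuous_normed
  have hwi : Integrable w := φ.integrable_normed
  have hf : StronglyMeasurable f := Lp.stronglyMeasurable f
  have hloc : LocallyIntegrable f volume := (Lp.memLp f).locallyIntegrable (by norm_num)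
  have hex : ConvolutionExists w f (ContinuousLinearMap.lsmul ℝ ℝ) volume :=
    φ.hasCompactSupport_normed.convolutionExists_left _ hwc hloc
  let ν : Measure (Space d) := volume.withDensity fun t => ENNReal.ofReal (w t)
  have hν : IsProbabilityMeasure ν := by
    constructor
    rw [withDensity_apply _ MeasurableSet.univ, Measure.restrict_univ,
      ← ofReal_integral_eq_lintegral_ofReal hwi (ae_of_all _ hw0), φ.integral_normed]
    simp
  have hlν : ∀ g : Space d → ℝ≥0∞, Measurable g →
      ∫⁻ t, g t ∂ν = ∫⁻ t, ENNReal.ofReal (w t) * g t := fun g hg =>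
    lintegral_withDensity_eq_lintegral_mul _ (by fun_prop) hg
  have hdiff : ∀ x, StronglyMeasurable fun t => f (x - t) - f x := fun x =>
    (hf.comp_measurable (by fun_prop)).sub stronglyMeasurable_const
  have hpt : ∀ x, ‖(w ⋆[ContinuousLinearMap.lsmul ℝ ℝ, volume] f) x - f x‖ₑ ^ 2
      ≤ ∫⁻ t, ‖f (x - t) - f x‖ₑ ^ 2 ∂ν := by
    intro x
    have e : (w ⋆[ContinuousLinearMap.lsmul ℝ ℝ, volume] f) x - f x
        = ∫ t, w t • (f (x - t) - f x) := by
      simp only [smul_sub]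
      rw [integral_sub, integral_smul_const, hw, φ.integral_normed, one_smul]
      · rfl
      · exact hex x
      · exact hwi.smul_const _
    have e₂ : ‖(w ⋆[ContinuousLinearMap.lsmul ℝ ℝ, volume] f) x - f x‖ₑ
        ≤ ∫⁻ t, ‖f (x - t) - f x‖ₑ ∂ν := by
      rw [e, hlν _ (hdiff x).enorm]
      refine (enorm_integral_le_lintegral_enorm _).trans (le_of_eq ?_)
      refine lintegral_congr fun t => ?_
      rw [enorm_smul, Real.enorm_of_nonneg (hw0 t)]
    refine (pow_le_pow_left₀ (zero_le) e₂ 2).trans ?_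
    exact sq_lintegral_le_of_isProbabilityMeasure ν (hdiff x).aestronglyMeasurable
  have key : eLpNorm (fun x => (w ⋆[ContinuousLinearMap.lsmul ℝ ℝ, volume] f) x - f x) 2 volume ^ 2
      ≤ ε ^ 2 := by
    rw [eLpNorm_two_sq]
    calc ∫⁻ x, ‖(w ⋆[ContinuousLinearMap.lsmul ℝ ℝ, volume] f) x - f x‖ₑ ^ 2
        ≤ ∫⁻ x, ∫⁻ t, ‖f (x - t) - f x‖ₑ ^ 2 ∂ν := lintegral_mono hpt
      _ = ∫⁻ t, (∫⁻ x, ‖f (x - t) - f x‖ₑ ^ 2) ∂ν := by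
          refine lintegral_lintegral_swap ?_
          refine Measurable.aemeasurable ?_
          have h₁ : StronglyMeasurable fun p : Space d × Space d => f (p.1 - p.2) - f p.1 :=
            (hf.comp_measurable (by fun_prop)).sub (hf.comp_measurable measurable_fst)
          exact h₁.enorm.pow_const 2
      _ ≤ ∫⁻ _, ε ^ 2 ∂ν := by
          refine lintegral_mono_ae ?_
          have hsupp : ∀ᵐ t ∂ν, ‖t‖ < φ.rOut := by
            rw [ae_withDensity_iff (by fun_prop)]
            refine ae_of_all _ fun t ht => ?_
            by_contra hc
            refine ht ?_
            have : t ∉ Function.support w := by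
              rw [hw, φ.support_normed_eq]
              simpa using hc
            rw [Function.notMem_support.1 this, ENNReal.ofReal_zero]
          filter_upwards [hsupp] with t ht
          rw [← eLpNorm_two_sq]
          exact pow_le_pow_left₀ zero_le (h t ht) 2
      _ = ε ^ 2 := by simp
  exact (ENNReal.pow_right_strictMono two_ne_zero).le_iff_le.1 key

end Translation

/-! ### Mollification of L² functions -/

section Mollification

variable {d N : ℕ}

/-- A bump function supported in the ball of radius `1 / (n + 1)`. -/
noncomputable def mollifierBump (d n : ℕ) : ContDiffBump (0 : Space d) :=
  ⟨1 / (2 * (n + 1)), 1 / (n + 1), by positivity, by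
    have : (0 : ℝ) ≤ n := by positivity
    exact one_div_lt_one_div_of_lt (by positivity) (by linarith)⟩

/-- The mollification of an `L²` function at scale `1 / (n + 1)`. -/
noncomputable def mollify (n : ℕ) (f : L2 d N) : Space d → Spinor N :=
  (mollifierBump d n).normed volume ⋆[ContinuousLinearMap.lsmul ℝ ℝ, volume] f

theorem contDiff_mollify (n : ℕ) (f : L2 d N) : ContDiff ℝ ∞ (mollify n f) :=
  (mollifierBump d n).hasCompactSupport_normed.contDiff_convolution_left _
    (mollifierBump d n).contDiff_normed ((Lp.memLp f).locallyIntegrable (by norm_num))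

/-- Convergence in `L²` of a sequence of functions. -/
def TendstoL2 {F : Type*} [NormedAddCommGroup F] (u : ℕ → Space d → F) (v : Space d → F) : Prop :=
  Tendsto (fun n => eLpNorm (fun x => u n x - v x) 2 volume) atTop (𝓝 0)

theorem tendstoL2_mollify (f : L2 d N) : TendstoL2 (fun n => mollify n f) f := by
  rw [TendstoL2, ENNReal.tendsto_atTop_zero]
  intro ε hε
  obtain ⟨δ, hδ, h⟩ := exists_eLpNorm_translate_sub_le f hε
  obtain ⟨n₀, hn₀⟩ := exists_nat_one_div_lt hδ
  refine ⟨n₀, fun n hn => eLpNorm_convolution_sub_le _ f fun t ht => h t (ht.trans ?_)⟩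
  refine lt_of_le_of_lt ?_ hn₀
  change (1 : ℝ) / (n + 1) ≤ _
  gcongr

theorem memLp_mollify (n : ℕ) (f : L2 d N) : MemLp (mollify n f) 2 volume := by
  have h : MemLp (fun x => mollify n f x - f x) 2 volume := by
    refine ⟨((contDiff_mollify n f).continuous.aestronglyMeasurable).sub
      (Lp.aestronglyMeasurable f), ?_⟩
    -- Here the trivial translation bound 2‖f‖ suffices, since only finiteness is claimed.
    refine (eLpNorm_convolution_sub_le _ f (ε := 2 * eLpNorm f 2 volume) fun t _ => ?_).trans_lt
      (ENNReal.mul_lt_top (by simp) (Lp.memLp f).2)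
    have hf : StronglyMeasurable f := Lp.stronglyMeasurable f
    refine (eLpNorm_sub_le (hf.comp_measurable (by fun_prop)).aestronglyMeasurable
      hf.aestronglyMeasurable (by norm_num)).trans (le_of_eq ?_)
    rw [two_mul]
    congr 1
    exact eLpNorm_comp_measurePreserving (g := f) hf.aestronglyMeasurable
      (measurePreserving_sub_right volume t)
  refine (memLp_congr_ae (ae_of_all _ fun x => ?_)).1 (h.add (Lp.memLp f))
  simp

/-- The derivative falls on the bump, and the reflected translate y ↦ φ(x - y) is itself a test
function for the weak derivative; the reflection sign cancels the sign of the integration by parts.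
-/
theorem fderiv_mollify (n : ℕ) {j : Fin d} {f g : L2 d N} (h : IsWeakPartial j f g)
    (x : Space d) : fderiv ℝ (mollify n f) x (EuclideanSpace.single j 1) = mollify n g x := by
  set φ := mollifierBump d n
  have hloc : LocallyIntegrable f volume := (Lp.memLp f).locallyIntegrable (by norm_num)
  have hd := (φ.hasCompactSupport_normed (μ := volume)).hasFDerivAt_convolution_left
    (ContinuousLinearMap.lsmul ℝ ℝ) (φ.contDiff_normed (n := 1)) hloc x
  have htest : IsTest fun y => φ.normed volume (x - y) := by
    refine ⟨φ.contDiff_normed.comp (by fun_prop), ?_⟩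
    exact (φ.hasCompactSupport_normed (μ := volume)).comp_homeomorph (Homeomorph.subLeft x)
  have hder : ∀ y, partialDeriv j (fun y => φ.normed volume (x - y)) y
      = -fderiv ℝ (φ.normed volume) (x - y) (EuclideanSpace.single j 1) := by
    intro y
    have h₁ : HasFDerivAt (φ.normed volume) (fderiv ℝ (φ.normed volume) (x - y)) (x - y) :=
      ((φ.contDiff_normed (n := 1)).differentiable (by norm_num) _).hasFDerivAt
    have h₂ : HasFDerivAt (fun y : Space d => x - y) (-(ContinuousLinearMap.id ℝ (Space d))) y :=
      (hasFDerivAt_id y).const_sub x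
    have h₃ : HasFDerivAt (fun y => φ.normed volume (x - y)) _ y := h₁.comp y h₂
    rw [partialDeriv, h₃.fderiv]
    simp
  have hw := h _ htest
  have e₁ : mollify n g x = ∫ y, φ.normed volume (x - y) • g y := by
    rw [mollify, convolution_lsmul_swap]
  rw [e₁, hw]
  have hconv : ConvolutionExistsAt (fderiv ℝ (φ.normed volume)) f x
      ((ContinuousLinearMap.lsmul ℝ ℝ : ℝ →L[ℝ] Spinor N →L[ℝ] Spinor N).precompL (Space d))
        volume := by
    exact ((φ.hasCompactSupport_normed (μ := volume)).fderiv ℝ).convolutionExists_left _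
      ((φ.contDiff_normed (n := 1)).continuous_fderiv (by norm_num)) hloc x
  have hfd : fderiv ℝ (mollify n f) x = _ := hd.fderiv
  rw [hfd, convolution_eq_swap, ContinuousLinearMap.integral_apply hconv.integrable_swap,
    ← integral_neg]
  refine integral_congr_ae (ae_of_all _ fun y => ?_)
  simp only [hder, neg_smul, neg_neg]
  rfl

end Mollification

end MagneticDirac

namespace MagneticDirac

open Filter Topology
open Matrix (toEuclideanLin)

/-! ### Convergence in L² and in H¹ -/

section TendstoL2

variable {d N : ℕ} {F G : Type*} [NormedAddCommGroup F] [NormedAddCommGroup G]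

theorem TendstoL2.congr {u u' : ℕ → Space d → F} {v v' : Space d → F} (h : TendstoL2 u v)
    (hu : ∀ n, u n =ᵐ[volume] u' n) (hv : v =ᵐ[volume] v') : TendstoL2 u' v' := by
  refine Tendsto.congr (fun n => ?_) h
  refine eLpNorm_congr_ae ?_
  filter_upwards [hu n, hv] with x h₁ h₂
  rw [h₁, h₂]

theorem TendstoL2.of_norm_le {u : ℕ → Space d → F} {v : Space d → F} (h : TendstoL2 u v)
    {u' : ℕ → Space d → G} {v' : Space d → G} {C : ℝ}
    (hC : ∀ n, ∀ᵐ x, ‖u' n x - v' x‖ ≤ C * ‖u n x - v x‖) : TendstoL2 u' v' := by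
  have h₁ : Tendsto (fun n => ENNReal.ofReal C * eLpNorm (fun x => u n x - v x) 2 volume) atTop
      (𝓝 0) := by
    simpa using ENNReal.Tendsto.const_mul h (Or.inr ENNReal.ofReal_ne_top)
  refine tendsto_of_tendsto_of_tendsto_of_le_of_le tendsto_const_nhds h₁ (fun _ => zero_le)
    fun n => ?_
  exact eLpNorm_le_mul_eLpNorm_of_ae_le_mul (hC n) 2

theorem TendstoL2.sub {u w : ℕ → Space d → F} {v z : Space d → F} (hu : TendstoL2 u v)
    (hw : TendstoL2 w z) (hum : ∀ n, AEStronglyMeasurable (u n) volume)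
    (hwm : ∀ n, AEStronglyMeasurable (w n) volume) (hv : AEStronglyMeasurable v volume)
    (hz : AEStronglyMeasurable z volume) :
    TendstoL2 (fun n x => u n x - w n x) (fun x => v x - z x) := by
  have h : Tendsto (fun n => eLpNorm (fun x => u n x - v x) 2 volume
      + eLpNorm (fun x => w n x - z x) 2 volume) atTop (𝓝 0) := by
    simpa using Tendsto.add hu hw
  refine tendsto_of_tendsto_of_tendsto_of_le_of_le tendsto_const_nhds h (fun _ => zero_le)
    fun n => ?_
  refine le_trans (le_of_eq ?_) (eLpNorm_sub_le ((hum n).sub hv) ((hwm n).sub hz) (by norm_num))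
  congr 1
  ext x
  simp only [Pi.sub_apply]
  abel

theorem tendsto_iff_tendstoL2 {u : ℕ → L2 d N} {v : L2 d N} :
    Tendsto u atTop (𝓝 v) ↔ TendstoL2 (fun n => u n) v := by
  rw [Lp.tendsto_Lp_iff_tendsto_eLpNorm']
  rfl

theorem tendsto_integral_inner {u w : ℕ → Space d → Spinor N} {v z : Space d → Spinor N}
    (hu : TendstoL2 u v) (hw : TendstoL2 w z) (hum : ∀ n, MemLp (u n) 2 volume)
    (hwm : ∀ n, MemLp (w n) 2 volume) (hv : MemLp v 2 volume) (hz : MemLp z 2 volume) :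
    Tendsto (fun n => ∫ x, inner ℂ (u n x) (w n x)) atTop (𝓝 (∫ x, inner ℂ (v x) (z x))) := by
  have h₁ : Tendsto (fun n => (hum n).toLp) atTop (𝓝 hv.toLp) :=
    tendsto_iff_tendstoL2.2 (hu.congr (fun n => (hum n).coeFn_toLp.symm) hv.coeFn_toLp.symm)
  have h₂ : Tendsto (fun n => (hwm n).toLp) atTop (𝓝 hz.toLp) :=
    tendsto_iff_tendstoL2.2 (hw.congr (fun n => (hwm n).coeFn_toLp.symm) hz.coeFn_toLp.symm)
  have e : ∀ {f g : Space d → Spinor N} (hf : MemLp f 2 volume) (hg : MemLp g 2 volume),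
      inner ℂ hf.toLp hg.toLp = ∫ x, inner ℂ (f x) (g x) := by
    intro f g hf hg
    rw [L2.inner_def]
    refine integral_congr_ae ?_
    filter_upwards [hf.coeFn_toLp, hg.coeFn_toLp] with x hx hy
    rw [hx, hy]
  have := h₁.inner (𝕜 := ℂ) h₂
  simpa only [e] using this

theorem IsTest.memLp_two {φ : Space d → ℝ} (hφ : IsTest φ) : MemLp φ 2 volume :=
  hφ.1.continuous.memLp_of_hasCompactSupport hφ.2

theorem IsTest.memLp_partialDeriv {φ : Space d → ℝ} (hφ : IsTest φ) (j : Fin d) :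
    MemLp (partialDeriv j φ) 2 volume := by
  refine Continuous.memLp_of_hasCompactSupport ?_ ?_
  · exact (hφ.1.continuous_fderiv (by simp)).clm_apply continuous_const
  · exact hφ.2.fderiv_apply ℝ _

theorem tendsto_integral_smul {φ : Space d → ℝ} (hφ : MemLp φ 2 volume) {u : ℕ → L2 d N}
    {v : L2 d N} (h : Tendsto u atTop (𝓝 v)) :
    Tendsto (fun n => ∫ x, φ x • u n x) atTop (𝓝 (∫ x, φ x • v x)) := by
  have hint : ∀ f : L2 d N, Integrable (fun x => φ x • f x) := fun f =>
    memLp_one_iff_integrable.1 ((Lp.memLp f).smul (r := 1) hφ)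
  refine tendsto_integral_of_L1 _ (hint v).1 (Eventually.of_forall fun n => hint (u n)) ?_
  have hz : Tendsto (fun n => eLpNorm φ 2 volume * eLpNorm (fun x => u n x - v x) 2 volume) atTop
      (𝓝 0) := by
    simpa using ENNReal.Tendsto.const_mul (tendsto_iff_tendstoL2.1 h) (Or.inr hφ.2.ne)
  refine tendsto_of_tendsto_of_tendsto_of_le_of_le tendsto_const_nhds hz (fun _ => zero_le)
    fun n => ?_
  have := eLpNorm_smul_le_mul_eLpNorm (p := 2) (q := 2) (r := 1)
    ((Lp.aestronglyMeasurable (u n)).sub (Lp.aestronglyMeasurable v)) hφ.1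
  rw [eLpNorm_one_eq_lintegral_enorm] at this
  refine le_trans (le_of_eq ?_) this
  refine lintegral_congr fun x => ?_
  simp [smul_sub]

end TendstoL2

section Mollification

variable {d N : ℕ}

theorem IsWeakPartial.mollify (n : ℕ) {j : Fin d} {f g : L2 d N} (h : IsWeakPartial j f g) :
    IsWeakPartial j (memLp_mollify n f).toLp (memLp_mollify n g).toLp := by
  intro φ hφ
  have e₁ : (fun x => φ x • ((memLp_mollify n g).toLp : L2 d N) x) =ᵐ[volume]
      fun x => φ x • fderiv ℝ (MagneticDirac.mollify n f) x (EuclideanSpace.single j 1) := by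
    filter_upwards [(memLp_mollify n g).coeFn_toLp] with x hx
    rw [hx, fderiv_mollify n h]
  have e₂ : (fun x => partialDeriv j φ x • ((memLp_mollify n f).toLp : L2 d N) x) =ᵐ[volume]
      fun x => fderiv ℝ φ x (EuclideanSpace.single j 1) • MagneticDirac.mollify n f x := by
    filter_upwards [(memLp_mollify n f).coeFn_toLp] with x hx
    rw [hx]
    rfl
  have e₃ : (fun x => φ x • ((memLp_mollify n f).toLp : L2 d N) x) =ᵐ[volume]
      fun x => φ x • MagneticDirac.mollify n f x := by
    filter_upwards [(memLp_mollify n f).coeFn_toLp] with x hx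
    rw [hx]
  rw [integral_congr_ae e₁, integral_congr_ae e₂]
  refine integral_smul_fderiv_eq_neg_fderiv_smul_of_integrable ?_ ?_ ?_ ?_ ?_
  · exact (hφ.integrable_partialDeriv_smul j _).congr e₂
  · exact (hφ.integrable_smul _).congr e₁
  · exact (hφ.integrable_smul _).congr e₃
  · exact fun x _ => hφ.1.differentiable (by simp) x
  · exact fun x _ => (contDiff_mollify n f).differentiable (by simp) x

/-- The mollification of an `H¹` function, as an element of `H¹`. -/
noncomputable def mollifyH1 (n : ℕ) (ψ : H1 d N) : H1 d N :=
  ⟨(memLp_mollify n (ψ : L2 d N)).toLp, fun j => ⟨_, (weakPartial_spec j ψ).mollify n⟩⟩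

theorem mollifyH1_ae (n : ℕ) (ψ : H1 d N) :
    (mollifyH1 n ψ : L2 d N) =ᵐ[volume] mollify n (ψ : L2 d N) :=
  (memLp_mollify n (ψ : L2 d N)).coeFn_toLp

theorem weakPartial_mollifyH1 (n : ℕ) (ψ : H1 d N) (j : Fin d) :
    weakPartial j (mollifyH1 n ψ) = (memLp_mollify n (weakPartial j ψ)).toLp :=
  (weakPartial_spec j (mollifyH1 n ψ)).unique ((weakPartial_spec j ψ).mollify n)

theorem weakPartial_mollifyH1_ae (n : ℕ) (ψ : H1 d N) (j : Fin d) :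
    weakPartial j (mollifyH1 n ψ) =ᵐ[volume] fun x =>
      fderiv ℝ (mollify n (ψ : L2 d N)) x (EuclideanSpace.single j 1) := by
  rw [weakPartial_mollifyH1]
  filter_upwards [(memLp_mollify n (weakPartial j ψ)).coeFn_toLp] with x hx
  rw [hx, fderiv_mollify n (weakPartial_spec j ψ)]

/-- Convergence in `H¹`. -/
def TendstoH1 (u : ℕ → H1 d N) (ψ : H1 d N) : Prop :=
  Tendsto (fun n => (u n : L2 d N)) atTop (𝓝 (ψ : L2 d N)) ∧
    ∀ j, Tendsto (fun n => weakPartial j (u n)) atTop (𝓝 (weakPartial j ψ))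

theorem tendstoH1_mollifyH1 (ψ : H1 d N) : TendstoH1 (fun n => mollifyH1 n ψ) ψ := by
  have h : ∀ f : L2 d N, Tendsto (fun n => (memLp_mollify n f).toLp) atTop (𝓝 f) := fun f =>
    tendsto_iff_tendstoL2.2 ((tendstoL2_mollify f).congr
      (fun n => (memLp_mollify n f).coeFn_toLp.symm) EventuallyEq.rfl)
  exact ⟨h _, fun j => by simpa only [weakPartial_mollifyH1] using h (weakPartial j ψ)⟩

end Mollification

/-! ### H¹ as a closed graph, and automatic boundedness of multipliers -/

section SobolevGraph

variable {d N : ℕ}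

theorem IsWeakPartial.of_tendsto {j : Fin d} {u g : ℕ → L2 d N} {ψ γ : L2 d N}
    (h : ∀ n, IsWeakPartial j (u n) (g n)) (hu : Tendsto u atTop (𝓝 ψ))
    (hg : Tendsto g atTop (𝓝 γ)) : IsWeakPartial j ψ γ := by
  intro φ hφ
  refine tendsto_nhds_unique (tendsto_integral_smul hφ.memLp_two hg) ?_
  simp only [fun n => h n φ hφ]
  exact (tendsto_integral_smul (hφ.memLp_partialDeriv j) hu).neg

/-- Pairs of an `H¹` function and its gradient. -/
def sobolevGraph (d N : ℕ) : Submodule ℂ (L2 d N × (Fin d → L2 d N)) where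
  carrier := {p | ∀ j, IsWeakPartial j p.1 (p.2 j)}
  add_mem' h₁ h₂ j := (h₁ j).add (h₂ j)
  zero_mem' j := by
    have := weakPartial_spec (N := N) j 0
    rwa [map_zero] at this
  smul_mem' c _ h j := (h j).smul c

/-- Weak derivatives are stable under L² limits, so the graph is closed. Completeness is what the
closed graph theorem below requires. -/
instance : CompleteSpace (sobolevGraph d N) := by
  refine IsClosed.completeSpace_coe (hs := ?_)
  refine IsSeqClosed.isClosed fun u p hu hp j => ?_
  exact IsWeakPartial.of_tendsto (fun n => hu n j) ((continuous_fst.tendsto p).comp hp)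
    (((continuous_apply j).comp continuous_snd).tendsto p |>.comp hp)

/-- A multiplication operator that maps `H¹` into `L²` is bounded. -/
theorem tendstoL2_smul_of_tendstoH1 {a : Space d → ℂ}
    (ha : ∀ ψ : H1 d N, MemLp (fun x => a x • (ψ : L2 d N) x) 2 volume) {u : ℕ → H1 d N}
    {ψ : H1 d N} (h : TendstoH1 u ψ) :
    TendstoL2 (fun n x => a x • (u n : L2 d N) x) (fun x => a x • (ψ : L2 d N) x) := by
  have ha' : ∀ p : sobolevGraph d N, MemLp (fun x => a x • (p.1.1 : L2 d N) x) 2 volume :=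
    fun p => ha ⟨p.1.1, fun j => ⟨_, p.2 j⟩⟩
  let T : sobolevGraph d N →ₗ[ℂ] L2 d N :=
    { toFun := fun p => (ha' p).toLp
      map_add' := fun p q => by
        refine ((MemLp.toLp_eq_toLp_iff _ ((ha' p).add (ha' q))).2 ?_).trans (MemLp.toLp_add _ _)
        filter_upwards [Lp.coeFn_add (p.1.1 : L2 d N) q.1.1] with x hx
        change a x • ((p.1.1 + q.1.1 : L2 d N)) x = _
        rw [hx]
        simp
      map_smul' := fun c p => by
        refine ((MemLp.toLp_eq_toLp_iff _ ((ha' p).const_smul c)).2 ?_).trans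
          (MemLp.toLp_const_smul _ _)
        filter_upwards [Lp.coeFn_smul c (p.1.1 : L2 d N)] with x hx
        change a x • ((c • p.1.1 : L2 d N)) x = _
        rw [hx]
        simp [smul_comm c] }
  -- The graph of `T` is closed: along a common subsequence both the functions and their images
  -- converge almost everywhere, and multiplication by `a x` respects pointwise limits.
  have hT : Continuous T := by
    refine T.continuous_of_seq_closed_graph fun p q y hp hy => ?_
    have h₁ : Tendsto (fun n => (p n).1.1) atTop (𝓝 q.1.1) :=
      ((continuous_fst.comp continuous_subtype_val).tendsto q).comp hp
    obtain ⟨ns, hns, h₂⟩ := (tendstoInMeasure_of_tendsto_Lp h₁).exists_seq_tendsto_ae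
    have hy' : Tendsto (fun n => T (p (ns n))) atTop (𝓝 y) := hy.comp hns.tendsto_atTop
    obtain ⟨ms, hms, h₃⟩ := (tendstoInMeasure_of_tendsto_Lp hy').exists_seq_tendsto_ae
    refine Lp.ext ?_
    have h₄ : ∀ᵐ x, ∀ n, T (p n) x = a x • ((p n).1.1 : L2 d N) x :=
      ae_all_iff.2 fun n => (ha' (p n)).coeFn_toLp
    filter_upwards [h₂, h₃, h₄, (ha' q).coeFn_toLp] with x x₂ x₃ x₄ x₅
    change _ = ((ha' q).toLp : L2 d N) x
    rw [x₅]
    simp only [x₄] at x₃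
    exact tendsto_nhds_unique x₃ ((x₂.comp hms.tendsto_atTop).const_smul (a x))
  let p : H1 d N → sobolevGraph d N := fun ψ =>
    ⟨((ψ : L2 d N), fun j => weakPartial j ψ), fun j => weakPartial_spec j ψ⟩
  have hp : Tendsto (fun n => p (u n)) atTop (𝓝 (p ψ)) := by
    rw [tendsto_subtype_rng]
    exact h.1.prodMk_nhds (tendsto_pi_nhds.2 h.2)
  have := tendsto_iff_tendstoL2.1 ((hT.tendsto _).comp hp)
  exact this.congr (fun n => (ha' _).coeFn_toLp) (ha' _).coeFn_toLp

end SobolevGraph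

end MagneticDirac

namespace MagneticDirac

open Filter Topology
open Matrix (toEuclideanLin)

/-! ### Locally square integrable fields -/

section LocalL2

variable {d N : ℕ} {F : Type*} [NormedAddCommGroup F]

theorem IsLocL2.locallyIntegrable {f : Space d → F} (hf : IsLocL2 f) :
    LocallyIntegrable f volume := by
  rw [locallyIntegrable_iff]
  intro K hK
  have : IsFiniteMeasure (volume.restrict K) := ⟨by simpa using hK.measure_lt_top⟩
  exact memLp_one_iff_integrable.1 ((hf K hK).mono_exponent (by norm_num))

theorem IsLocL2.aestronglyMeasurable {f : Space d → F} (hf : IsLocL2 f) :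
    AEStronglyMeasurable f volume :=
  hf.locallyIntegrable.aestronglyMeasurable

theorem abs_entry_le_norm (M : Matrix (Fin d) (Fin d) ℝ) (j k : Fin d) : |M j k| ≤ ‖M‖ := by
  have h := norm_toEuclideanLin_le M (EuclideanSpace.single k 1)
  have h₂ := PiLp.norm_apply_le (toEuclideanLin M (EuclideanSpace.single k 1)) j
  have e : toEuclideanLin M (EuclideanSpace.single k 1) j = M j k := by
    simp [Matrix.toLpLin_apply]
  rw [e, Real.norm_eq_abs] at h₂
  simpa using h₂.trans h

end LocalL2

/-! ### The magnetic potential and ∇_A-bounded weights -/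

section Potential

variable {d N : ℕ} {α : Fin d → Matrix (Fin N) (Fin N) ℂ} {β : Matrix (Fin N) (Fin N) ℂ} {m : ℝ}
  {A : Space d → Space d} {B : Space d → Matrix (Fin d) (Fin d) ℝ}

theorem memLp_toEuclideanLin (M : Matrix (Fin N) (Fin N) ℂ) {f : Space d → Spinor N}
    (hf : MemLp f 2 volume) : MemLp (fun x => toEuclideanLin M (f x)) 2 volume := by
  refine hf.of_le_mul (c := ‖M‖) ?_ (ae_of_all _ fun x => norm_toEuclideanLin_le M _)
  exact (LinearMap.continuous_of_finiteDimensional _).comp_aestronglyMeasurable hf.1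

theorem IsAdmissibleMagnetic.memLp_diracExpr (hA : IsAdmissibleMagnetic α β m A B)
    (ψ : H1 d N) : MemLp (diracExpr α β m A 0 ψ) 2 volume := by
  have h : (ψ : L2 d N) ∈ (diracOp α β m A 0).domain := by
    rw [hA.domain_eq]
    exact ψ.2
  exact h.2

theorem clifford_toEuclideanLin (u : Space d) (v : Spinor N) :
    toEuclideanLin (clifford α u) v = ∑ j, (u j : ℂ) • toEuclideanLin (α j) v := by
  simp only [clifford_apply, map_sum, map_smul, LinearMap.sum_apply, LinearMap.smul_apply]

/-- `α · A ψ ∈ L²` for `ψ ∈ H¹`, and `|α · A ψ| = |A| |ψ|`. -/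
theorem IsAdmissibleMagnetic.memLp_potential (hαβ : IsDiracMatrices α β)
    (hA : IsAdmissibleMagnetic α β m A B) (j : Fin d) (ψ : H1 d N) :
    MemLp (fun x => (A x j : ℂ) • (ψ : L2 d N) x) 2 volume := by
  have h₁ : MemLp (fun x => toEuclideanLin (clifford α (A x)) ((ψ : L2 d N) x)) 2 volume := by
    -- The spinor α·Aψ is the magnetic expression with its derivative and mass terms removed. Those
    -- terms are in L² for ψ in H¹, and the whole expression is in L² because the operator domain is
    -- all of H¹.
    have h₂ : MemLp (fun x => (-Complex.I) • (∑ k, toEuclideanLin (α k) (weakPartial k ψ x))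
        + (m : ℂ) • toEuclideanLin β ((ψ : L2 d N) x) - diracExpr α β m A 0 ψ x) 2 volume := by
      have h₃ : MemLp (fun x => ∑ k, toEuclideanLin (α k) (weakPartial k ψ x)) 2 volume :=
        memLp_finsetSum _ fun k _ => memLp_toEuclideanLin _ (Lp.memLp _)
      have h₄ : MemLp (fun x => toEuclideanLin β ((ψ : L2 d N) x)) 2 volume :=
        memLp_toEuclideanLin _ (Lp.memLp _)
      exact ((h₃.const_smul (-Complex.I)).add (h₄.const_smul (m : ℂ))).sub (hA.memLp_diracExpr ψ)
    refine (memLp_congr_ae (ae_of_all _ fun x => ?_)).1 h₂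
    simp only [diracExpr, magPartial, clifford_toEuclideanLin, map_sub, map_smul,
      Finset.sum_sub_distrib, smul_sub, Pi.zero_apply, map_zero, LinearMap.zero_apply, add_zero,
      mul_smul, ← Finset.smul_sum]
    rw [smul_smul (-Complex.I) Complex.I]
    simp
  refine h₁.of_le ?_ ?_
  · have hc : Continuous fun y : Space d => (y j : ℂ) := by fun_prop
    exact (hc.comp_aestronglyMeasurable hA.locL2_potential.aestronglyMeasurable).smul
      (Lp.aestronglyMeasurable (ψ : L2 d N))
  · refine ae_of_all _ fun x => ?_
    rw [hαβ.norm_clifford_apply, norm_smul, Complex.norm_real]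
    gcongr
    exact PiLp.norm_apply_le (A x) j

theorem IsAdmissibleMagnetic.memLp_magPartial (hαβ : IsDiracMatrices α β)
    (hA : IsAdmissibleMagnetic α β m A B) (j : Fin d) (ψ : H1 d N) :
    MemLp (magPartial A j ψ) 2 volume := by
  refine (Lp.memLp (weakPartial j ψ)).sub ?_
  simpa only [mul_smul, Pi.smul_def] using (hA.memLp_potential hαβ j ψ).const_smul Complex.I

/-- No quantitative bound on `A` is available; convergence of A_j u_n comes from the closed graph
argument alone. -/
theorem IsAdmissibleMagnetic.tendstoL2_magPartial (hαβ : IsDiracMatrices α β)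
    (hA : IsAdmissibleMagnetic α β m A B) (j : Fin d) {u : ℕ → H1 d N} {ψ : H1 d N}
    (h : TendstoH1 u ψ) :
    TendstoL2 (fun n => magPartial A j (u n)) (magPartial A j ψ) := by
  have h₁ := tendstoL2_smul_of_tendstoH1 (hA.memLp_potential hαβ j) h
  have hm : ∀ ψ : H1 d N, AEStronglyMeasurable
      (fun x => (Complex.I * (A x j : ℂ)) • (ψ : L2 d N) x) volume := fun ψ => by
    simpa only [mul_smul, Pi.smul_def] using
      ((hA.memLp_potential hαβ j ψ).const_smul Complex.I).1
  refine TendstoL2.sub (tendsto_iff_tendstoL2.1 (h.2 j)) ?_ (fun n => Lp.aestronglyMeasurable _)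
    (fun n => hm _) (Lp.aestronglyMeasurable _) (hm ψ)
  refine h₁.of_norm_le (C := 1) fun n => ae_of_all _ fun x => ?_
  rw [mul_smul, mul_smul, ← smul_sub, norm_smul, Complex.norm_I]

theorem magGradSq_eq_sum (hαβ : IsDiracMatrices α β) (hA : IsAdmissibleMagnetic α β m A B)
    (ψ : H1 d N) : magGradSq A ψ = ∑ j, eLpNorm (magPartial A j ψ) 2 volume ^ 2 := by
  rw [magGradSq, lintegral_finsetSum']
  · simp only [eLpNorm_two_sq]
  · exact fun j _ => (hA.memLp_magPartial hαβ j ψ).1.enorm.pow_const 2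

theorem magGradSq_ne_top (hαβ : IsDiracMatrices α β) (hA : IsAdmissibleMagnetic α β m A B)
    (ψ : H1 d N) : magGradSq A ψ ≠ ⊤ := by
  rw [magGradSq_eq_sum hαβ hA]
  exact ENNReal.sum_ne_top.2 fun j _ => ENNReal.pow_ne_top (hA.memLp_magPartial hαβ j ψ).2.ne

/-- A weight `w` is `∇_A`-bounded. -/
def IsMagBounded (N : ℕ) (A : Space d → Space d) (w : Space d → ℝ) (ε : ℝ) : Prop :=
  AEStronglyMeasurable w volume ∧ ∀ ψ : H1 d N,
    ∫⁻ x, ‖w x‖ₑ ^ 2 * ‖(ψ : L2 d N) x‖ₑ ^ 2 ≤ ENNReal.ofReal (ε ^ 2) * magGradSq A ψ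

variable {w : Space d → ℝ} {ε : ℝ}

theorem IsMagBounded.eLpNorm_sq_le (hw : IsMagBounded N A w ε) (ψ : H1 d N) :
    eLpNorm (fun x => w x • (ψ : L2 d N) x) 2 volume ^ 2
      ≤ ENNReal.ofReal (ε ^ 2) * magGradSq A ψ := by
  rw [eLpNorm_two_sq]
  refine le_trans (le_of_eq ?_) (hw.2 ψ)
  refine lintegral_congr fun x => ?_
  rw [enorm_smul, mul_pow]

theorem IsMagBounded.memLp (hw : IsMagBounded N A w ε) (hαβ : IsDiracMatrices α β)
    (hA : IsAdmissibleMagnetic α β m A B) (ψ : H1 d N) :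
    MemLp (fun x => w x • (ψ : L2 d N) x) 2 volume := by
  refine ⟨hw.1.smul (Lp.aestronglyMeasurable _), ?_⟩
  have h := (hw.eLpNorm_sq_le ψ).trans_lt
    (ENNReal.mul_lt_top ENNReal.ofReal_lt_top (magGradSq_ne_top hαβ hA ψ).lt_top)
  exact (ENNReal.pow_lt_top_iff.1 h).resolve_right (by norm_num)

theorem IsMagBounded.tendstoL2 (hw : IsMagBounded N A w ε) (hαβ : IsDiracMatrices α β)
    (hA : IsAdmissibleMagnetic α β m A B) {u : ℕ → H1 d N} {ψ : H1 d N} (h : TendstoH1 u ψ) :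
    TendstoL2 (fun n x => w x • (u n : L2 d N) x) (fun x => w x • (ψ : L2 d N) x) := by
  simpa using tendstoL2_smul_of_tendstoH1 (a := fun x => (w x : ℂ))
    (by simpa using hw.memLp hαβ hA) h

/-- The distributional definition of B is antisymmetric in its indices, and a locally integrable
function is determined almost everywhere by its integrals against test functions. -/
theorem IsMagneticField.skew (hA : IsAdmissibleMagnetic α β m A B) :
    ∀ᵐ x, (B x)ᵀ = -(B x) := by
  have hloc : ∀ j k, LocallyIntegrable (fun x => B x j k) volume := fun j k => by
    refine (hA.locL2_field.locallyIntegrable).mono ?_ (ae_of_all _ fun x => ?_)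
    · have hc : Continuous fun M : Matrix (Fin d) (Fin d) ℝ => M j k :=
        (LinearMap.continuous_of_finiteDimensional (Matrix.entryLinearMap ℝ ℝ j k))
      exact hc.comp_aestronglyMeasurable hA.locL2_field.aestronglyMeasurable
    · exact abs_entry_le_norm (B x) j k
  have h : ∀ j k, ∀ᵐ x, B x k j = -B x j k := by
    intro j k
    refine ae_eq_of_integral_contDiff_smul_eq (hloc k j) (hloc j k).neg fun φ h₁ h₂ => ?_
    simp only [smul_eq_mul, mul_neg]
    rw [integral_neg, hA.isMagneticField k j φ ⟨h₁, h₂⟩, hA.isMagneticField j k φ ⟨h₁, h₂⟩,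
      ← integral_neg, neg_neg]
    refine integral_congr_ae (ae_of_all _ fun x => ?_)
    ring
  filter_upwards [ae_all_iff.2 fun j => ae_all_iff.2 fun k => h j k] with x hx
  ext j k
  simpa using hx j k

end Potential

end MagneticDirac

namespace MagneticDirac

open Filter Topology
open Matrix (toEuclideanLin)

/-! ### Partial derivatives of vector-valued functions -/

section Calculus

variable {d N : ℕ} {F : Type*} [NormedAddCommGroup F] [NormedSpace ℝ F]

/-- The `j`-th partial derivative of a vector-valued function. -/
noncomputable def pderiv (j : Fin d) (f : Space d → F) (x : Space d) : F :=
  fderiv ℝ f x (EuclideanSpace.single j 1)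

theorem contDiff_pderiv (j : Fin d) {f : Space d → F} (hf : ContDiff ℝ ∞ f) :
    ContDiff ℝ ∞ (pderiv j f) :=
  (hf.fderiv_right (by simp)).clm_apply contDiff_const

theorem hasCompactSupport_pderiv (j : Fin d) {f : Space d → F} (hf : HasCompactSupport f) :
    HasCompactSupport (pderiv j f) :=
  hf.fderiv_apply ℝ _

theorem pderiv_comm (j k : Fin d) {f : Space d → F} (hf : ContDiff ℝ ∞ f) (x : Space d) :
    pderiv j (pderiv k f) x = pderiv k (pderiv j f) x := by
  have hd : DifferentiableAt ℝ (fderiv ℝ f) x :=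
    (hf.fderiv_right (m := ∞) (by simp)).differentiable (by simp) x
  have e : ∀ j k : Fin d, pderiv j (pderiv k f) x
      = fderiv ℝ (fderiv ℝ f) x (EuclideanSpace.single j 1) (EuclideanSpace.single k 1) := by
    intro j k
    rw [pderiv]
    change fderiv ℝ (fun y => fderiv ℝ f y (EuclideanSpace.single k 1)) x _ = _
    rw [fderiv_clm_apply hd (differentiableAt_const _)]
    simp
  rw [e, e]
  exact (hf.contDiffAt.isSymmSndFDerivAt
    (by simpa using WithTop.coe_le_coe.2 (le_top : (2 : ℕ∞) ≤ ⊤))).eq _ _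

theorem integral_pderiv_eq_zero (j : Fin d) {f : Space d → F} (hf : ContDiff ℝ ∞ f)
    (hc : HasCompactSupport f) : ∫ x, pderiv j f x = 0 := by
  have hi : Integrable (pderiv j f) :=
    (contDiff_pderiv j hf).continuous.integrable_of_hasCompactSupport
      (hasCompactSupport_pderiv j hc)
  have h := integral_smul_fderiv_eq_neg_fderiv_smul_of_integrable (μ := volume)
    (f := fun _ : Space d => (1 : ℝ)) (g := f) (v := EuclideanSpace.single j 1)
    (by simp) (by simpa using! hi) (by simpa using hf.continuous.integrable_of_hasCompactSupport hc)
    (fun x _ => differentiableAt_const _) (fun x _ => hf.differentiable (by simp) x)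
  simpa [pderiv] using h

/-- The action of matrices on spinors as a continuous bilinear map. -/
noncomputable def matrixAction (N : ℕ) :
    Matrix (Fin N) (Fin N) ℂ →L[ℝ] Spinor N →L[ℝ] Spinor N :=
  LinearMap.mkContinuous₂ (LinearMap.mk₂ ℝ (fun M v => toEuclideanLin M v)
    (by simp) (fun c M v => by
      rw [show c • M = (c : ℂ) • M from rfl, map_smul]
      rfl) (by simp) (fun c M v => by
      rw [show c • v = (c : ℂ) • v from rfl, map_smul]
      rfl)) 1 (fun M v => by simpa using norm_toEuclideanLin_le M v)

theorem matrixAction_apply (M : Matrix (Fin N) (Fin N) ℂ) (v : Spinor N) :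
    matrixAction N M v = toEuclideanLin M v := rfl

theorem _root_.ContDiff.toEuclideanLin {n : WithTop ℕ∞} {Q : Space d → Matrix (Fin N) (Fin N) ℂ}
    {u : Space d → Spinor N} (hQ : ContDiff ℝ n Q) (hu : ContDiff ℝ n u) :
    ContDiff ℝ n fun x => Matrix.toEuclideanLin (Q x) (u x) :=
  ((matrixAction N).contDiff.comp hQ).clm_apply hu

theorem pderiv_toEuclideanLin (j : Fin d) {Q : Space d → Matrix (Fin N) (Fin N) ℂ}
    {u : Space d → Spinor N} {x : Space d} (hQ : DifferentiableAt ℝ Q x)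
    (hu : DifferentiableAt ℝ u x) :
    pderiv j (fun x => toEuclideanLin (Q x) (u x)) x
      = toEuclideanLin (Q x) (pderiv j u x) + toEuclideanLin (pderiv j Q x) (u x) := by
  rw [pderiv]
  change fderiv ℝ (fun y => matrixAction N (Q y) (u y)) x _ = _
  have hc : HasFDerivAt (fun y => matrixAction N (Q y)) _ x :=
    (matrixAction N).hasFDerivAt.comp x hQ.hasFDerivAt
  rw [(hc.clm_apply hu.hasFDerivAt).fderiv]
  simp [matrixAction_apply, pderiv]

theorem pderiv_inner (j : Fin d) {u v : Space d → Spinor N} {x : Space d}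
    (hu : DifferentiableAt ℝ u x) (hv : DifferentiableAt ℝ v x) :
    pderiv j (fun x => inner ℂ (u x) (v x)) x
      = inner ℂ (u x) (pderiv j v x) + inner ℂ (pderiv j u x) (v x) :=
  fderiv_inner_apply ℂ hu hv _

theorem pderiv_ofReal_mul (j : Fin d) {X : Space d → ℝ} {f : Space d → ℂ} {x : Space d}
    (hX : DifferentiableAt ℝ X x) (hf : DifferentiableAt ℝ f x) :
    pderiv j (fun x => (X x : ℂ) * f x) x = (X x : ℂ) * pderiv j f x + ((pderiv j X x : ℝ) : ℂ) * f x := by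
  simp only [pderiv, ← Complex.real_smul]
  have h : HasFDerivAt (fun x => X x • f x) _ x := hX.hasFDerivAt.smul hf.hasFDerivAt
  rw [h.fderiv]
  simp

end Calculus

/-! ### Magnetic identities for smooth spinors -/

section Smooth

variable {d N : ℕ}

/-- Multiplication by i times a real number is skew-adjoint and commutes with Q, so the potential
drops out. Magnetic integration by parts is therefore the ordinary one. -/
theorem inner_magnetic_cancel (Q : Matrix (Fin N) (Fin N) ℂ) (u v : Spinor N) (a : ℝ) :
    inner ℂ u (toEuclideanLin Q (v - (Complex.I * a) • u))
        + inner ℂ (v - (Complex.I * a) • u) (toEuclideanLin Q u)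
      = inner ℂ u (toEuclideanLin Q v) + inner ℂ v (toEuclideanLin Q u) := by
  simp only [map_sub, map_smul, inner_sub_left, inner_sub_right, inner_smul_left, inner_smul_right,
    map_mul, Complex.conj_I, Complex.conj_ofReal]
  ring

theorem integral_form_of_smooth {u : Space d → Spinor N} (hu : ContDiff ℝ ∞ u) (a : Space d → ℝ)
    (k : Fin d) {Q : Space d → Matrix (Fin N) (Fin N) ℂ} (hQ : ContDiff ℝ ∞ Q)
    (hQc : HasCompactSupport Q) :
    ∫ x, (inner ℂ (u x) (toEuclideanLin (Q x) (pderiv k u x - (Complex.I * a x) • u x))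
        + inner ℂ (pderiv k u x - (Complex.I * a x) • u x) (toEuclideanLin (Q x) (u x)))
      = -∫ x, inner ℂ (u x) (toEuclideanLin (pderiv k Q x) (u x)) := by
  simp only [inner_magnetic_cancel]
  rw [eq_neg_iff_add_eq_zero]
  have hcs : ∀ {f : Space d → Spinor N} {R : Space d → Matrix (Fin N) (Fin N) ℂ}
      {g : Space d → Spinor N}, HasCompactSupport R →
      HasCompactSupport fun x => inner ℂ (f x) (toEuclideanLin (R x) (g x)) := by
    intro f R g hR
    refine hR.mono fun x hx => ?_
    contrapose! hx
    simp [Function.notMem_support.1 hx]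
  have hu' := contDiff_pderiv k hu
  have hQ' := contDiff_pderiv k hQ
  have i₁ : Integrable fun x => inner ℂ (u x) (toEuclideanLin (Q x) (pderiv k u x))
      + inner ℂ (pderiv k u x) (toEuclideanLin (Q x) (u x)) := by
    refine Integrable.add ?_ ?_
    · exact (hu.inner ℂ (hQ.toEuclideanLin hu')).continuous.integrable_of_hasCompactSupport
        (hcs hQc)
    · exact (hu'.inner ℂ (hQ.toEuclideanLin hu)).continuous.integrable_of_hasCompactSupport
        (hcs hQc)
  have i₂ : Integrable fun x => inner ℂ (u x) (toEuclideanLin (pderiv k Q x) (u x)) :=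
    (hu.inner ℂ (hQ'.toEuclideanLin hu)).continuous.integrable_of_hasCompactSupport
      (hcs (hasCompactSupport_pderiv k hQc))
  rw [← integral_add i₁ i₂, ← integral_pderiv_eq_zero k (hu.inner ℂ (hQ.toEuclideanLin hu))
    (hcs hQc)]
  refine integral_congr_ae (ae_of_all _ fun x => ?_)
  have du := hu.differentiable (by simp) x
  have dQ := hQ.differentiable (by simp) x
  have dQu := (hQ.toEuclideanLin hu).differentiable (by simp) x
  simp only [pderiv_inner k du dQu, pderiv_toEuclideanLin k dQ du, inner_add_right]
  ring

/-- The magnetic field equation, tested with complex functions. -/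
theorem IsMagneticField.integral_complex {A : Space d → Space d}
    {B : Space d → Matrix (Fin d) (Fin d) ℝ} (h : IsMagneticField A B) (hA : IsLocL2 A)
    (hB : IsLocL2 B) (j k : Fin d) {φ : Space d → ℂ} (hφ : ContDiff ℝ ∞ φ)
    (hc : HasCompactSupport φ) :
    ∫ x, (pderiv j φ x * A x k - pderiv k φ x * A x j + φ x * B x j k) = 0 ∧
      Integrable fun x => pderiv j φ x * A x k - pderiv k φ x * A x j + φ x * B x j k := by
  have hAl : ∀ k, LocallyIntegrable (fun x => (A x k : ℝ)) volume := fun k => by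
    refine hA.locallyIntegrable.mono ?_ (ae_of_all _ fun x => PiLp.norm_apply_le (A x) k)
    have hcont : Continuous fun y : Space d => y k := by fun_prop
    exact hcont.comp_aestronglyMeasurable hA.aestronglyMeasurable
  have hBl : LocallyIntegrable (fun x => B x j k) volume := by
    refine hB.locallyIntegrable.mono ?_ (ae_of_all _ fun x => abs_entry_le_norm (B x) j k)
    exact (LinearMap.continuous_of_finiteDimensional
      (Matrix.entryLinearMap ℝ ℝ j k)).comp_aestronglyMeasurable hB.aestronglyMeasurable
  have hint : ∀ {f : Space d → ℝ} {g : Space d → ℂ}, LocallyIntegrable f volume →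
      Continuous g → HasCompactSupport g → Integrable fun x => g x * f x := by
    intro f g hf hg hgc
    have := hf.integrable_smul_right_of_hasCompactSupport hg hgc
    simpa only [Complex.real_smul, mul_comm] using this
  have hreal : ∀ {φ : Space d → ℝ}, IsTest φ →
      ∫ x, (pderiv j φ x * A x k - pderiv k φ x * A x j + φ x * B x j k) = 0 := by
    intro φ hφ
    have hr : ∀ {f g : Space d → ℝ}, LocallyIntegrable f volume →
        Continuous g → HasCompactSupport g → Integrable fun x => g x * f x :=
      fun hf hg hgc => hf.integrable_smul_left_of_hasCompactSupport hg hgc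
    rw [integral_add, h j k φ hφ]
    · exact add_neg_cancel _
    · exact (hr (hAl k) (contDiff_pderiv j hφ.1).continuous (hasCompactSupport_pderiv j hφ.2)).sub
        (hr (hAl j) (contDiff_pderiv k hφ.1).continuous (hasCompactSupport_pderiv k hφ.2))
    · exact hr hBl hφ.1.continuous hφ.2
  have hI : Integrable fun x => pderiv j φ x * A x k - pderiv k φ x * A x j + φ x * B x j k :=
    ((hint (hAl k) (contDiff_pderiv j hφ).continuous (hasCompactSupport_pderiv j hc)).sub
      (hint (hAl j) (contDiff_pderiv k hφ).continuous (hasCompactSupport_pderiv k hc))).add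
      (hint hBl hφ.continuous hc)
  refine ⟨?_, hI⟩
  -- The field equation is only given for real test functions; composing with real-linear
  -- functionals, in particular with real and imaginary parts, extends it to complex ones.
  have hL : ∀ (L : ℂ →L[ℝ] ℝ), L (∫ x, (pderiv j φ x * A x k - pderiv k φ x * A x j
      + φ x * B x j k)) = 0 := by
    intro L
    have hLφ : IsTest fun x => L (φ x) := ⟨L.contDiff.comp hφ, hc.comp_left (map_zero L)⟩
    have hp : ∀ i x, pderiv i (fun x => L (φ x)) x = L (pderiv i φ x) := fun i x => by
      have : HasFDerivAt (fun x => L (φ x)) _ x :=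
        L.hasFDerivAt.comp x (hφ.differentiable (by simp) x).hasFDerivAt
      rw [pderiv, this.fderiv]
      rfl
    rw [← L.integral_comp_comm hI, ← hreal hLφ]
    refine integral_congr_ae (ae_of_all _ fun x => ?_)
    have hm : ∀ (z : ℂ) (r : ℝ), L (z * r) = L z * r := fun z r => by
      rw [mul_comm, ← Complex.real_smul, map_smul, smul_eq_mul, mul_comm]
    simp only [map_add, map_sub, hm, hp]
  exact Complex.ext (hL Complex.reCLM) (hL Complex.imCLM)

theorem integrable_inner_of_memLp {u v : Space d → Spinor N} (hu : MemLp u 2 volume)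
    (hv : MemLp v 2 volume) : Integrable fun x => inner ℂ (u x) (v x) := by
  have := L2.integrable_inner (𝕜 := ℂ) hu.toLp hv.toLp
  refine this.congr ?_
  filter_upwards [hu.coeFn_toLp, hv.coeFn_toLp] with x h₁ h₂
  rw [h₁, h₂]

/-- Here `p`, `q` stand for the two derivatives of `u`, and `s` for the pairing of `u` with its
mixed second derivative under `M`. The right side is arranged as a difference of two total
derivatives plus -i times the field equation tested with X⟨u, Mu⟩. The same `s` can serve in both
places because second derivatives commute. -/
theorem commutator_algebra (M : Matrix (Fin N) (Fin N) ℂ) (u p q : Spinor N) (a b X Xj Xk B : ℝ)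
    (s : ℂ) :
    (X : ℂ) * (inner ℂ (p - (Complex.I * a) • u) (toEuclideanLin M (q - (Complex.I * b) • u))
        - inner ℂ (q - (Complex.I * b) • u) (toEuclideanLin M (p - (Complex.I * a) • u)))
      - (-((Xj : ℂ) * inner ℂ u (toEuclideanLin M (q - (Complex.I * b) • u)))
        + (Xk : ℂ) * inner ℂ u (toEuclideanLin M (p - (Complex.I * a) • u))
        + Complex.I * ((X * B : ℝ) * inner ℂ u (toEuclideanLin M u)))
      = (((X : ℂ) * (s + inner ℂ p (toEuclideanLin M q)) + (Xj : ℂ) * inner ℂ u (toEuclideanLin M q))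
          - ((X : ℂ) * (s + inner ℂ q (toEuclideanLin M p))
              + (Xk : ℂ) * inner ℂ u (toEuclideanLin M p)))
        + (-Complex.I) * (((X : ℂ) * (inner ℂ u (toEuclideanLin M p) + inner ℂ p (toEuclideanLin M u))
              + (Xj : ℂ) * inner ℂ u (toEuclideanLin M u)) * b
            - ((X : ℂ) * (inner ℂ u (toEuclideanLin M q) + inner ℂ q (toEuclideanLin M u))
              + (Xk : ℂ) * inner ℂ u (toEuclideanLin M u)) * a
            + ((X : ℂ) * inner ℂ u (toEuclideanLin M u)) * B) := by
  simp only [map_sub, map_smul, inner_sub_left, inner_sub_right, inner_smul_left, inner_smul_right,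
    map_mul, Complex.conj_I, Complex.conj_ofReal, Complex.ofReal_mul]
  ring

theorem commutator_of_smooth {A : Space d → Space d}
    {B : Space d → Matrix (Fin d) (Fin d) ℝ} (h : IsMagneticField A B) (hA : IsLocL2 A)
    (hB : IsLocL2 B) {u : Space d → Spinor N} (hu : ContDiff ℝ ∞ u) (j k : Fin d)
    (M : Matrix (Fin N) (Fin N) ℂ) {X : Space d → ℝ} (hX : ContDiff ℝ ∞ X)
    (hXc : HasCompactSupport X) {g : Fin d → Space d → Spinor N}
    (hg : ∀ j x, g j x = pderiv j u x - (Complex.I * A x j) • u x) :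
    ∫ x, ((X x : ℂ) * (inner ℂ (g j x) (toEuclideanLin M (g k x))
        - inner ℂ (g k x) (toEuclideanLin M (g j x)))
      - (-(((pderiv j X x : ℝ) : ℂ) * inner ℂ (u x) (toEuclideanLin M (g k x)))
        + ((pderiv k X x : ℝ) : ℂ) * inner ℂ (u x) (toEuclideanLin M (g j x))
        + Complex.I * ((X x * B x j k : ℝ) * inner ℂ (u x) (toEuclideanLin M (u x))))) = 0 := by
  have hMu : ∀ {v : Space d → Spinor N}, ContDiff ℝ ∞ v →
      ContDiff ℝ ∞ fun x => toEuclideanLin M (v x) := fun hv =>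
    (contDiff_const (c := M)).toEuclideanLin hv
  have hρ : ∀ {v w : Space d → Spinor N}, ContDiff ℝ ∞ v → ContDiff ℝ ∞ w →
      ContDiff ℝ ∞ fun x => (X x : ℂ) * inner ℂ (v x) (toEuclideanLin M (w x)) :=
    fun hv hw => (Complex.ofRealCLM.contDiff.comp hX).mul (hv.inner ℂ (hMu hw))
  have hρc : ∀ {f : Space d → ℂ}, HasCompactSupport fun x => (X x : ℂ) * f x := by
    intro f
    refine hXc.mono fun x hx => ?_
    contrapose! hx
    simp [Function.notMem_support.1 hx]
  have hu' : ∀ i, ContDiff ℝ ∞ (pderiv i u) := fun i => contDiff_pderiv i hu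
  have hpd : ∀ {v : Space d → Spinor N}, ContDiff ℝ ∞ v → ∀ i x,
      pderiv i (fun x => (X x : ℂ) * inner ℂ (u x) (toEuclideanLin M (v x))) x
        = (X x : ℂ) * (inner ℂ (u x) (toEuclideanLin M (pderiv i v x))
            + inner ℂ (pderiv i u x) (toEuclideanLin M (v x)))
          + ((pderiv i X x : ℝ) : ℂ) * inner ℂ (u x) (toEuclideanLin M (v x)) := by
    intro v hv i x
    have du := hu.differentiable (by simp) x
    have dv := hv.differentiable (by simp) x
    have dMv := (hMu hv).differentiable (by simp) x
    rw [pderiv_ofReal_mul i (hX.differentiable (by simp) x)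
      ((hu.inner ℂ (hMu hv)).differentiable (by simp) x), pderiv_inner i du dMv,
      pderiv_toEuclideanLin i (differentiableAt_const M) dv]
    simp [pderiv]
  have hF : ∀ i l, Integrable (pderiv l fun x => (X x : ℂ)
      * inner ℂ (u x) (toEuclideanLin M (pderiv i u x))) := fun i l =>
    (contDiff_pderiv l (hρ hu (hu' i))).continuous.integrable_of_hasCompactSupport
      (hasCompactSupport_pderiv l hρc)
  obtain ⟨hmag, hmagi⟩ := h.integral_complex hA hB j k (hρ hu hu) hρc
  have e : ∫ x, ((pderiv j (fun x => (X x : ℂ)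
        * inner ℂ (u x) (toEuclideanLin M (pderiv k u x))) x
      - pderiv k (fun x => (X x : ℂ) * inner ℂ (u x) (toEuclideanLin M (pderiv j u x))) x)
      + (-Complex.I) * (pderiv j (fun x => (X x : ℂ) * inner ℂ (u x) (toEuclideanLin M (u x))) x
          * A x k
        - pderiv k (fun x => (X x : ℂ) * inner ℂ (u x) (toEuclideanLin M (u x))) x * A x j
        + (X x : ℂ) * inner ℂ (u x) (toEuclideanLin M (u x)) * B x j k)) = 0 := by
    have i₁ := hF k j
    have i₂ := hF j k
    have i₃ := hmagi.const_mul (-Complex.I)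
    rw [integral_add (i₁.sub' i₂) i₃, integral_sub i₁ i₂, integral_pderiv_eq_zero j (hρ hu (hu' k)) hρc,
      integral_pderiv_eq_zero k (hρ hu (hu' j)) hρc, integral_const_mul, hmag]
    simp
  rw [← e]
  refine integral_congr_ae (ae_of_all _ fun x => ?_)
  simp only [hpd (hu' k), hpd (hu' j), hpd hu, hg, pderiv_comm k j hu x]
  exact commutator_algebra M (u x) _ _ _ _ _ _ _ _ _

end Smooth

end MagneticDirac

namespace MagneticDirac

open Filter Topology
open Matrix (toEuclideanLin)

/-! ### Weighted pairings and their limits -/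

section Limits

variable {d N : ℕ}

theorem memLp_weight_smul {w : Space d → ℝ} (hw : Continuous w) (hc : HasCompactSupport w)
    {v : Space d → Spinor N} (hv : MemLp v 2 volume) : MemLp (fun x => w x • v x) 2 volume := by
  obtain ⟨C, hC⟩ := hw.bounded_above_of_compact_support hc
  refine hv.of_le_mul (c := C) (hw.aestronglyMeasurable.smul hv.1) (ae_of_all _ fun x => ?_)
  rw [norm_smul]
  gcongr
  exact hC x

theorem TendstoL2.weight_smul {w : Space d → ℝ} (hw : Continuous w) (hc : HasCompactSupport w)
    {u : ℕ → Space d → Spinor N} {v : Space d → Spinor N} (h : TendstoL2 u v) :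
    TendstoL2 (fun n x => w x • u n x) (fun x => w x • v x) := by
  obtain ⟨C, hC⟩ := hw.bounded_above_of_compact_support hc
  refine h.of_norm_le (C := C) fun n => ae_of_all _ fun x => ?_
  rw [← smul_sub, norm_smul]
  gcongr
  exact hC x

theorem TendstoL2.toEuclideanLin (M : Matrix (Fin N) (Fin N) ℂ)
    {u : ℕ → Space d → Spinor N} {v : Space d → Spinor N} (h : TendstoL2 u v) :
    TendstoL2 (fun n x => Matrix.toEuclideanLin M (u n x))
      (fun x => Matrix.toEuclideanLin M (v x)) := by
  refine h.of_norm_le (C := ‖M‖) fun n => ae_of_all _ fun x => ?_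
  rw [← map_sub]
  exact norm_toEuclideanLin_le _ _

theorem inner_weight_smul (M : Matrix (Fin N) (Fin N) ℂ) (u v : Spinor N) (w : ℝ) :
    inner ℂ u (toEuclideanLin M (w • v)) = (w : ℂ) * inner ℂ u (toEuclideanLin M v) := by
  rw [show w • v = (w : ℂ) • v from rfl, map_smul, inner_smul_right]

theorem integrable_weight_inner {w : Space d → ℝ} (M : Matrix (Fin N) (Fin N) ℂ)
    {u v : Space d → Spinor N} (hu : MemLp u 2 volume)
    (hv : MemLp (fun x => w x • v x) 2 volume) :
    Integrable fun x => (w x : ℂ) * inner ℂ (u x) (toEuclideanLin M (v x)) := by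
  have := integrable_inner_of_memLp hu (memLp_toEuclideanLin M hv)
  simpa only [inner_weight_smul] using this

theorem tendsto_integral_weight_inner {w : Space d → ℝ} (M : Matrix (Fin N) (Fin N) ℂ)
    {u z : ℕ → Space d → Spinor N} {v y : Space d → Spinor N} (hu : TendstoL2 u v)
    (hz : TendstoL2 (fun n x => w x • z n x) (fun x => w x • y x))
    (hum : ∀ n, MemLp (u n) 2 volume) (hzm : ∀ n, MemLp (fun x => w x • z n x) 2 volume)
    (hv : MemLp v 2 volume) (hy : MemLp (fun x => w x • y x) 2 volume) :
    Tendsto (fun n => ∫ x, (w x : ℂ) * inner ℂ (u n x) (toEuclideanLin M (z n x))) atTop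
      (𝓝 (∫ x, (w x : ℂ) * inner ℂ (v x) (toEuclideanLin M (y x)))) := by
  have := tendsto_integral_inner hu (hz.toEuclideanLin M) hum
    (fun n => memLp_toEuclideanLin M (hzm n)) hv (memLp_toEuclideanLin M hy)
  simpa only [inner_weight_smul] using this

/-- A continuous function supported away from the origin is dominated by `|x|`. -/
theorem exists_abs_le_mul_norm {X : Space d → ℝ} (hX : Continuous X) (hc : HasCompactSupport X)
    (h0 : (0 : Space d) ∉ tsupport X) : ∃ C : ℝ, 0 ≤ C ∧ ∀ x, |X x| ≤ C * ‖x‖ := by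
  obtain ⟨C, hC⟩ := hX.bounded_above_of_compact_support hc
  obtain ⟨r, hr, hb⟩ := Metric.isOpen_iff.1 (isClosed_tsupport X).isOpen_compl 0 h0
  have hC0 : 0 ≤ C := (norm_nonneg _).trans (hC 0)
  refine ⟨C / r, by positivity, fun x => ?_⟩
  by_cases hx : ‖x‖ < r
  · rw [image_eq_zero_of_notMem_tsupport (hb (by simpa using hx)), abs_zero]
    positivity
  · rw [div_mul_eq_mul_div, le_div_iff₀ hr]
    exact mul_le_mul (hC x) (not_lt.1 hx) hr.le hC0

variable {A : Space d → Space d} {w w' : Space d → ℝ} {ε : ℝ}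

theorem IsMagBounded.mono (hw : IsMagBounded N A w ε) (hm : AEStronglyMeasurable w' volume) {C : ℝ}
    (hC : 0 ≤ C) (h : ∀ᵐ x, |w' x| ≤ C * |w x|) : IsMagBounded N A w' (C * ε) := by
  refine ⟨hm, fun ψ => ?_⟩
  have e : ∀ᵐ x, ‖w' x‖ₑ ^ 2 * ‖(ψ : L2 d N) x‖ₑ ^ 2
      ≤ ENNReal.ofReal (C ^ 2) * (‖w x‖ₑ ^ 2 * ‖(ψ : L2 d N) x‖ₑ ^ 2) := by
    filter_upwards [h] with x hx
    have h₁ : ‖w' x‖ₑ ≤ ENNReal.ofReal C * ‖w x‖ₑ := by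
      rw [← ofReal_norm, ← ofReal_norm (w x), ← ENNReal.ofReal_mul hC]
      exact ENNReal.ofReal_le_ofReal hx
    calc ‖w' x‖ₑ ^ 2 * ‖(ψ : L2 d N) x‖ₑ ^ 2
        ≤ (ENNReal.ofReal C * ‖w x‖ₑ) ^ 2 * ‖(ψ : L2 d N) x‖ₑ ^ 2 := by gcongr
      _ = _ := by rw [mul_pow, ENNReal.ofReal_pow hC, mul_assoc]
  refine (lintegral_mono_ae e).trans ?_
  rw [lintegral_const_mul' _ _ ENNReal.ofReal_ne_top, mul_pow, ENNReal.ofReal_mul (sq_nonneg C),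
    mul_assoc]
  exact mul_le_mul_right (hw.2 ψ) _

end Limits

/-! ### Magnetic pairs: integration by parts and commutators on H¹ -/

section MagneticPair

variable {d N : ℕ}

/-- A function `ψ ∈ L²` together with its magnetic gradient `g = ∇_A ψ ∈ L²`, for a potential with
magnetic field `B`: integration by parts and the commutation relation
`[∂_j^A, ∂_k^A] = -i B_jk` hold in the form sense. -/
structure IsMagneticPair (B : Space d → Matrix (Fin d) (Fin d) ℝ) (ψ : Space d → Spinor N)
    (g : Fin d → Space d → Spinor N) : Prop where
  memLp : MemLp ψ 2 volume
  memLp_grad : ∀ j, MemLp (g j) 2 volume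
  integral_form : ∀ (k : Fin d) (Q : Space d → Matrix (Fin N) (Fin N) ℂ), ContDiff ℝ ∞ Q →
    HasCompactSupport Q →
    ∫ x, (inner ℂ (ψ x) (toEuclideanLin (Q x) (g k x))
        + inner ℂ (g k x) (toEuclideanLin (Q x) (ψ x)))
      = -∫ x, inner ℂ (ψ x) (toEuclideanLin (pderiv k Q x) (ψ x))
  commutator : ∀ (j k : Fin d) (M : Matrix (Fin N) (Fin N) ℂ) (X : Space d → ℝ),
    ContDiff ℝ ∞ X → HasCompactSupport X → (0 : Space d) ∉ tsupport X →
    ∫ x, ((X x : ℂ) * (inner ℂ (g j x) (toEuclideanLin M (g k x))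
        - inner ℂ (g k x) (toEuclideanLin M (g j x)))
      - (-(((pderiv j X x : ℝ) : ℂ) * inner ℂ (ψ x) (toEuclideanLin M (g k x)))
        + ((pderiv k X x : ℝ) : ℂ) * inner ℂ (ψ x) (toEuclideanLin M (g j x))
        + Complex.I * ((X x * B x j k : ℝ) * inner ℂ (ψ x) (toEuclideanLin M (ψ x))))) = 0

variable {α : Fin d → Matrix (Fin N) (Fin N) ℂ} {β : Matrix (Fin N) (Fin N) ℂ} {m : ℝ}
  {A : Space d → Space d} {B : Space d → Matrix (Fin d) (Fin d) ℝ}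

theorem magPartial_mollifyH1_ae (n : ℕ) (ψ : H1 d N) (j : Fin d) :
    magPartial A j (mollifyH1 n ψ) =ᵐ[volume] fun x =>
      pderiv j (mollify n (ψ : L2 d N)) x
        - (Complex.I * A x j) • mollify n (ψ : L2 d N) x := by
  filter_upwards [mollifyH1_ae n ψ, weakPartial_mollifyH1_ae n ψ j] with x h₁ h₂
  rw [magPartial, h₁, h₂]
  rfl

theorem memLp_matrix_apply {Q : Space d → Matrix (Fin N) (Fin N) ℂ} (hQ : Continuous Q)
    (hc : HasCompactSupport Q) {v : Space d → Spinor N} (hv : MemLp v 2 volume) :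
    MemLp (fun x => toEuclideanLin (Q x) (v x)) 2 volume := by
  obtain ⟨C, hC⟩ := hQ.bounded_above_of_compact_support hc
  refine hv.of_le_mul (c := C) ?_ (ae_of_all _ fun x => ?_)
  · exact (matrixAction N).aestronglyMeasurable_comp₂ hQ.aestronglyMeasurable hv.1
  · refine (norm_toEuclideanLin_le _ _).trans ?_
    gcongr
    exact hC x

theorem TendstoL2.matrix_apply {Q : Space d → Matrix (Fin N) (Fin N) ℂ} (hQ : Continuous Q)
    (hc : HasCompactSupport Q) {u : ℕ → Space d → Spinor N} {v : Space d → Spinor N}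
    (h : TendstoL2 u v) : TendstoL2 (fun n x => Matrix.toEuclideanLin (Q x) (u n x))
      (fun x => Matrix.toEuclideanLin (Q x) (v x)) := by
  obtain ⟨C, hC⟩ := hQ.bounded_above_of_compact_support hc
  refine h.of_norm_le (C := C) fun n => ae_of_all _ fun x => ?_
  rw [← map_sub]
  refine (norm_toEuclideanLin_le _ _).trans ?_
  gcongr
  exact hC x

/-- Holds for mollifications by the smooth case; every term is a pairing of L²-convergent sequences
against a bounded matrix field. -/
theorem magPartial_integral_form (hαβ : IsDiracMatrices α β) (hA : IsAdmissibleMagnetic α β m A B)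
    (ψ : H1 d N) (k : Fin d) (Q : Space d → Matrix (Fin N) (Fin N) ℂ) (hQ : ContDiff ℝ ∞ Q)
    (hQc : HasCompactSupport Q) :
    ∫ x, (inner ℂ ((ψ : L2 d N) x) (toEuclideanLin (Q x) (magPartial A k ψ x))
        + inner ℂ (magPartial A k ψ x) (toEuclideanLin (Q x) ((ψ : L2 d N) x)))
      = -∫ x, inner ℂ ((ψ : L2 d N) x) (toEuclideanLin (pderiv k Q x) ((ψ : L2 d N) x)) := by
  have hQ' := (contDiff_pderiv k hQ).continuous
  have hQc' := hasCompactSupport_pderiv k hQc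
  have hu : TendstoH1 (fun n => mollifyH1 n ψ) ψ := tendstoH1_mollifyH1 ψ
  have h₀ := tendsto_iff_tendstoL2.1 hu.1
  have h₁ := hA.tendstoL2_magPartial hαβ k hu
  have m₀ : ∀ ψ : H1 d N, MemLp (ψ : L2 d N) 2 volume := fun ψ => Lp.memLp _
  have m₁ := hA.memLp_magPartial hαβ k
  have split : ∀ ψ : H1 d N,
      ∫ x, (inner ℂ ((ψ : L2 d N) x) (toEuclideanLin (Q x) (magPartial A k ψ x))
        + inner ℂ (magPartial A k ψ x) (toEuclideanLin (Q x) ((ψ : L2 d N) x)))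
      = (∫ x, inner ℂ ((ψ : L2 d N) x) (toEuclideanLin (Q x) (magPartial A k ψ x)))
        + ∫ x, inner ℂ (magPartial A k ψ x) (toEuclideanLin (Q x) ((ψ : L2 d N) x)) := fun ψ =>
    integral_add (integrable_inner_of_memLp (m₀ ψ) (memLp_matrix_apply hQ.continuous hQc (m₁ ψ)))
      (integrable_inner_of_memLp (m₁ ψ) (memLp_matrix_apply hQ.continuous hQc (m₀ ψ)))
  have t₁ := (tendsto_integral_inner h₀ (h₁.matrix_apply hQ.continuous hQc) (fun n => m₀ _)
    (fun n => memLp_matrix_apply hQ.continuous hQc (m₁ _)) (m₀ ψ)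
    (memLp_matrix_apply hQ.continuous hQc (m₁ ψ))).add
    (tendsto_integral_inner h₁ (h₀.matrix_apply hQ.continuous hQc) (fun n => m₁ _)
    (fun n => memLp_matrix_apply hQ.continuous hQc (m₀ _)) (m₁ ψ)
    (memLp_matrix_apply hQ.continuous hQc (m₀ ψ)))
  have t₂ := (tendsto_integral_inner h₀ (h₀.matrix_apply hQ' hQc') (fun n => m₀ _)
    (fun n => memLp_matrix_apply hQ' hQc' (m₀ _)) (m₀ ψ) (memLp_matrix_apply hQ' hQc' (m₀ ψ))).neg
  rw [split]
  refine tendsto_nhds_unique t₁ (t₂.congr fun n => ?_)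
  rw [← split]
  have key := integral_form_of_smooth (contDiff_mollify n (ψ : L2 d N)) (fun x => A x k) k hQ hQc
  have e₁ := mollifyH1_ae n ψ
  have e₂ := magPartial_mollifyH1_ae (A := A) n ψ k
  refine Eq.trans ?_ (key.symm.trans ?_)
  · congr 1
    refine integral_congr_ae ?_
    filter_upwards [e₁] with x h₁
    rw [h₁]
  · refine integral_congr_ae ?_
    filter_upwards [e₁, e₂] with x h₁ h₂
    rw [h₁, h₂]

/-- The smooth identity for mollifications passes to the limit. The field term is the critical one:
it converges because a weight supported away from the origin is dominated by |x|, so X B_jk inherits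
the ∇_A-bound of |x||B|. -/
theorem magPartial_commutator (hαβ : IsDiracMatrices α β) (hA : IsAdmissibleMagnetic α β m A B)
    {ε : ℝ} (hB : IsMagBounded N A (fun x => ‖x‖ * ‖B x‖) ε) (ψ : H1 d N) (j k : Fin d)
    (M : Matrix (Fin N) (Fin N) ℂ) (X : Space d → ℝ) (hX : ContDiff ℝ ∞ X)
    (hXc : HasCompactSupport X) (h0 : (0 : Space d) ∉ tsupport X) :
    ∫ x, ((X x : ℂ) * (inner ℂ (magPartial A j ψ x) (toEuclideanLin M (magPartial A k ψ x))
        - inner ℂ (magPartial A k ψ x) (toEuclideanLin M (magPartial A j ψ x)))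
      - (-(((pderiv j X x : ℝ) : ℂ)
            * inner ℂ ((ψ : L2 d N) x) (toEuclideanLin M (magPartial A k ψ x)))
        + ((pderiv k X x : ℝ) : ℂ)
            * inner ℂ ((ψ : L2 d N) x) (toEuclideanLin M (magPartial A j ψ x))
        + Complex.I * ((X x * B x j k : ℝ)
            * inner ℂ ((ψ : L2 d N) x) (toEuclideanLin M ((ψ : L2 d N) x))))) = 0 := by
  have cX := hX.continuous
  have cX' := fun i : Fin d => (contDiff_pderiv i hX).continuous
  have sX' := fun i : Fin d => hasCompactSupport_pderiv i hXc
  obtain ⟨C, hC0, hC⟩ := exists_abs_le_mul_norm cX hXc h0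
  have hw : IsMagBounded N A (fun x => X x * B x j k) (C * ε) := by
    refine hB.mono ?_ hC0 (ae_of_all _ fun x => ?_)
    · refine cX.aestronglyMeasurable.mul ?_
      exact (LinearMap.continuous_of_finiteDimensional
        (Matrix.entryLinearMap ℝ ℝ j k)).comp_aestronglyMeasurable
        hA.locL2_field.aestronglyMeasurable
    · rw [abs_mul, abs_mul, abs_norm, abs_norm, ← mul_assoc]
      exact mul_le_mul (hC x) (abs_entry_le_norm _ _ _) (abs_nonneg _) (by positivity)
  have hu : TendstoH1 (fun n => mollifyH1 n ψ) ψ := tendstoH1_mollifyH1 ψ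
  have h₀ := tendsto_iff_tendstoL2.1 hu.1
  have h₁ := fun i => hA.tendstoL2_magPartial hαβ i hu
  have h₂ := hw.tendstoL2 hαβ hA hu
  have m₀ : ∀ ψ : H1 d N, MemLp (ψ : L2 d N) 2 volume := fun ψ => Lp.memLp _
  have m₁ := fun i => hA.memLp_magPartial (N := N) hαβ i
  have m₂ := hw.memLp hαβ hA
  have split : ∀ ψ : H1 d N,
      ∫ x, ((X x : ℂ) * (inner ℂ (magPartial A j ψ x) (toEuclideanLin M (magPartial A k ψ x))
        - inner ℂ (magPartial A k ψ x) (toEuclideanLin M (magPartial A j ψ x)))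
      - (-(((pderiv j X x : ℝ) : ℂ)
            * inner ℂ ((ψ : L2 d N) x) (toEuclideanLin M (magPartial A k ψ x)))
        + ((pderiv k X x : ℝ) : ℂ)
            * inner ℂ ((ψ : L2 d N) x) (toEuclideanLin M (magPartial A j ψ x))
        + Complex.I * ((X x * B x j k : ℝ)
            * inner ℂ ((ψ : L2 d N) x) (toEuclideanLin M ((ψ : L2 d N) x)))))
      = (∫ x, (X x : ℂ)
            * inner ℂ (magPartial A j ψ x) (toEuclideanLin M (magPartial A k ψ x)))
        - (∫ x, (X x : ℂ)
            * inner ℂ (magPartial A k ψ x) (toEuclideanLin M (magPartial A j ψ x)))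
        - (-(∫ x, ((pderiv j X x : ℝ) : ℂ)
            * inner ℂ ((ψ : L2 d N) x) (toEuclideanLin M (magPartial A k ψ x)))
          + (∫ x, ((pderiv k X x : ℝ) : ℂ)
            * inner ℂ ((ψ : L2 d N) x) (toEuclideanLin M (magPartial A j ψ x)))
          + Complex.I * ∫ x, ((X x * B x j k : ℝ) : ℂ)
            * inner ℂ ((ψ : L2 d N) x) (toEuclideanLin M ((ψ : L2 d N) x))) := by
    intro ψ
    have i₁ := integrable_weight_inner M (m₁ j ψ) (memLp_weight_smul cX hXc (m₁ k ψ))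
    have i₂ := integrable_weight_inner M (m₁ k ψ) (memLp_weight_smul cX hXc (m₁ j ψ))
    have i₃ := integrable_weight_inner M (m₀ ψ) (memLp_weight_smul (cX' j) (sX' j) (m₁ k ψ))
    have i₄ := integrable_weight_inner M (m₀ ψ) (memLp_weight_smul (cX' k) (sX' k) (m₁ j ψ))
    have i₅ := (integrable_weight_inner M (m₀ ψ) (m₂ ψ)).const_mul Complex.I
    simp only [mul_sub]
    rw [integral_sub (i₁.sub' i₂) ((i₃.fun_neg.fun_add i₄).fun_add i₅), integral_sub i₁ i₂,
      integral_add (i₃.fun_neg.fun_add i₄) i₅, integral_add i₃.fun_neg i₄, integral_neg,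
      integral_const_mul]
  have t₁ := tendsto_integral_weight_inner M (h₁ j) ((h₁ k).weight_smul cX hXc) (fun n => m₁ j _)
    (fun n => memLp_weight_smul cX hXc (m₁ k _)) (m₁ j ψ) (memLp_weight_smul cX hXc (m₁ k ψ))
  have t₂ := tendsto_integral_weight_inner M (h₁ k) ((h₁ j).weight_smul cX hXc) (fun n => m₁ k _)
    (fun n => memLp_weight_smul cX hXc (m₁ j _)) (m₁ k ψ) (memLp_weight_smul cX hXc (m₁ j ψ))
  have t₃ := tendsto_integral_weight_inner M h₀ ((h₁ k).weight_smul (cX' j) (sX' j))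
    (fun n => m₀ _) (fun n => memLp_weight_smul (cX' j) (sX' j) (m₁ k _)) (m₀ ψ)
    (memLp_weight_smul (cX' j) (sX' j) (m₁ k ψ))
  have t₄ := tendsto_integral_weight_inner M h₀ ((h₁ j).weight_smul (cX' k) (sX' k))
    (fun n => m₀ _) (fun n => memLp_weight_smul (cX' k) (sX' k) (m₁ j _)) (m₀ ψ)
    (memLp_weight_smul (cX' k) (sX' k) (m₁ j ψ))
  have t₅ := tendsto_integral_weight_inner M h₀ h₂ (fun n => m₀ _) (fun n => m₂ _) (m₀ ψ) (m₂ ψ)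
  have t := (t₁.sub t₂).sub ((t₃.neg.add t₄).add (t₅.const_mul Complex.I))
  rw [split]
  refine tendsto_nhds_unique t (tendsto_const_nhds.congr fun n => ?_)
  rw [← split]
  rw [← commutator_of_smooth hA.isMagneticField hA.locL2_potential hA.locL2_field
    (contDiff_mollify n (ψ : L2 d N)) j k M hX hXc
    (g := fun i x => pderiv i (mollify n (ψ : L2 d N)) x
        - (Complex.I * A x i) • mollify n (ψ : L2 d N) x) (fun _ _ => rfl)]
  refine integral_congr_ae ?_
  filter_upwards [mollifyH1_ae n ψ, magPartial_mollifyH1_ae (A := A) n ψ j,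
    magPartial_mollifyH1_ae (A := A) n ψ k] with x e₁ e₂ e₃
  rw [e₁, e₂, e₃]

theorem isMagneticPair_magPartial (hαβ : IsDiracMatrices α β)
    (hA : IsAdmissibleMagnetic α β m A B) {ε : ℝ}
    (hB : IsMagBounded N A (fun x => ‖x‖ * ‖B x‖) ε) (ψ : H1 d N) :
    IsMagneticPair B (ψ : L2 d N) (fun j => magPartial A j ψ) where
  memLp := Lp.memLp _
  memLp_grad j := hA.memLp_magPartial hαβ j ψ
  integral_form := magPartial_integral_form hαβ hA ψ
  commutator := magPartial_commutator hαβ hA hB ψ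

end MagneticPair

end MagneticDirac

namespace MagneticDirac

open Filter Topology
open Matrix (toEuclideanLin)

/-! ### Scale-invariant cutoffs away from the origin and infinity -/

section Cutoff

variable {d N : ℕ}

/-- Smooth cutoffs away from the origin and infinity, with `|x| |∇θ_n|` bounded. -/
structure IsCutoffSeq (θ : ℕ → Space d → ℝ) (C : ℝ) : Prop where
  contDiff : ∀ n, ContDiff ℝ ∞ (θ n)
  hasCompactSupport : ∀ n, HasCompactSupport (θ n)
  zero_notMem : ∀ n, (0 : Space d) ∉ tsupport (θ n)
  abs_le_one : ∀ n x, |θ n x| ≤ 1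
  norm_mul_fderiv_le : ∀ n x, ‖x‖ * ‖fderiv ℝ (θ n) x‖ ≤ C
  eventually : ∀ x, x ≠ 0 → ∀ᶠ n in atTop, θ n x = 1 ∧ fderiv ℝ (θ n) x = 0

/-- The expression t s'(t) is continuous and lives on [1, 2]. It is invariant under dilations, so
one constant serves every cutoff s(c|x|²). -/
theorem exists_abs_mul_deriv_smoothTransition_le :
    ∃ C : ℝ, ∀ t : ℝ, |t * deriv (fun t => Real.smoothTransition (t - 1)) t| ≤ C := by
  set s : ℝ → ℝ := fun t => Real.smoothTransition (t - 1) with hs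
  have hsm : ContDiff ℝ ∞ s := Real.smoothTransition.contDiff.comp (contDiff_id.sub contDiff_const)
  have hcont : Continuous fun t => t * deriv s t :=
    continuous_id.mul (hsm.continuous_deriv (by simp))
  have hsupp : HasCompactSupport fun t => t * deriv s t := by
    refine HasCompactSupport.intro (isCompact_Icc (a := (1 : ℝ)) (b := 2)) fun t ht => ?_
    have h0 : deriv s t = 0 := by
      rcases lt_or_ge t 1 with h | h
      · have : s =ᶠ[𝓝 t] fun _ => 0 := by
          filter_upwards [Iio_mem_nhds h] with y hy
          exact Real.smoothTransition.zero_of_nonpos (by simpa using (Set.mem_Iio.1 hy).le)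
        rw [this.deriv_eq, deriv_const]
      · have h2 : 2 < t := by
          by_contra hc
          exact ht ⟨h, not_lt.1 hc⟩
        have : s =ᶠ[𝓝 t] fun _ => 1 := by
          filter_upwards [Ioi_mem_nhds h2] with y hy
          exact Real.smoothTransition.one_of_one_le (by have := Set.mem_Ioi.1 hy; linarith)
        rw [this.deriv_eq, deriv_const]
    rw [h0, mul_zero]
  obtain ⟨C, hC⟩ := hcont.bounded_above_of_compact_support hsupp
  exact ⟨C, fun t => hC t⟩

theorem exists_isCutoffSeq (d : ℕ) : ∃ (θ : ℕ → Space d → ℝ) (C : ℝ), IsCutoffSeq θ C := by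
  obtain ⟨C, hC⟩ := exists_abs_mul_deriv_smoothTransition_le
  set s : ℝ → ℝ := fun t => Real.smoothTransition (t - 1) with hs
  have hsm : ContDiff ℝ ∞ s := Real.smoothTransition.contDiff.comp (contDiff_id.sub contDiff_const)
  have s0 : ∀ t ≤ 1, s t = 0 := fun t ht =>
    Real.smoothTransition.zero_of_nonpos (by linarith)
  have s1 : ∀ t, 2 ≤ t → s t = 1 := fun t ht =>
    Real.smoothTransition.one_of_one_le (by linarith)
  have snn : ∀ t, 0 ≤ s t := fun t => Real.smoothTransition.nonneg _
  have sle : ∀ t, s t ≤ 1 := fun t => Real.smoothTransition.le_one _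
  have hcd : ∀ c : ℝ, ContDiff ℝ ∞ fun x : Space d => s (c * ‖x‖ ^ 2) := fun c =>
    hsm.comp (contDiff_const.mul (contDiff_norm_sq ℝ))
  have hfd : ∀ (c : ℝ) (x : Space d), ‖x‖ * ‖fderiv ℝ (fun x : Space d => s (c * ‖x‖ ^ 2)) x‖
      ≤ 2 * C := by
    intro c x
    have h₁ : HasFDerivAt (fun x : Space d => ‖x‖ ^ 2) (2 • (innerSL ℝ x)) x :=
      (hasStrictFDerivAt_norm_sq x).hasFDerivAt
    have h₂ := (h₁.const_mul c)
    have h₃ : HasDerivAt s (deriv s (c * ‖x‖ ^ 2)) (c * ‖x‖ ^ 2) :=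
      (hsm.differentiable (by simp) _).hasDerivAt
    have h₄ : HasFDerivAt (fun x : Space d => s (c * ‖x‖ ^ 2))
        (deriv s (c * ‖x‖ ^ 2) • c • 2 • (innerSL ℝ x)) x :=
      HasDerivAt.comp_hasFDerivAt (h₂ := s) x h₃ h₂
    rw [h₄.fderiv, norm_smul, norm_smul, Real.norm_eq_abs, Real.norm_eq_abs, two_smul, ← two_smul ℝ,
      norm_smul, innerSL_apply_norm, Real.norm_two]
    have := hC (c * ‖x‖ ^ 2)
    rw [abs_mul, abs_mul, abs_pow, abs_norm] at this
    calc ‖x‖ * (|deriv s (c * ‖x‖ ^ 2)| * (|c| * (2 * ‖x‖)))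
        = 2 * (|c| * ‖x‖ ^ 2 * |deriv s (c * ‖x‖ ^ 2)|) := by ring
      _ ≤ 2 * C := by gcongr
  -- The first factor vanishes near the origin, where (n+1)|x|² ≤ 1; the second vanishes far out,
  -- where |x|² ≥ 2(n+1). Each contributes at most 2C to |x||∇θ_n|.
  let θ : ℕ → Space d → ℝ := fun n x =>
    s ((n + 1 : ℝ) * ‖x‖ ^ 2) * (1 - s ((n + 1 : ℝ)⁻¹ * ‖x‖ ^ 2))
  have hpos : ∀ n : ℕ, (0 : ℝ) < n + 1 := fun n => by positivity
  have h1s : ∀ c, ContDiff ℝ ∞ fun x : Space d => 1 - s (c * ‖x‖ ^ 2) := fun c =>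
    contDiff_const.sub (hcd c)
  refine ⟨θ, 2 * C + 2 * C, fun n => (hcd _).mul (h1s _), fun n => ?_, fun n => ?_, fun n x => ?_,
    fun n x => ?_, fun x hx => ?_⟩
  · refine HasCompactSupport.intro (isCompact_closedBall (0 : Space d) (2 * (n + 1))) fun x hx => ?_
    have hx' : 2 * (n + 1 : ℝ) < ‖x‖ := by simpa using hx
    have : 2 ≤ (n + 1 : ℝ)⁻¹ * ‖x‖ ^ 2 := by
      rw [inv_mul_eq_div, le_div_iff₀ (hpos n)]
      nlinarith [hpos n]
    simp only [θ]
    rw [s1 _ this, sub_self, mul_zero]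
  · rw [notMem_tsupport_iff_eventuallyEq]
    have hc : Continuous fun x : Space d => (n + 1 : ℝ) * ‖x‖ ^ 2 := by fun_prop
    have : ∀ᶠ x : Space d in 𝓝 0, (n + 1 : ℝ) * ‖x‖ ^ 2 < 1 :=
      hc.tendsto 0 |>.eventually_lt_const (by simp)
    filter_upwards [this] with x hx
    simp only [θ]
    rw [s0 _ hx.le, zero_mul, Pi.zero_apply]
  · rw [abs_le]
    constructor
    · refine le_trans (by norm_num) (mul_nonneg (snn _) (by linarith [sle ((n + 1 : ℝ)⁻¹ * ‖x‖ ^ 2)]))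
    · exact mul_le_one₀ (sle _) (by linarith [sle ((n + 1 : ℝ)⁻¹ * ‖x‖ ^ 2)])
        (by linarith [snn ((n + 1 : ℝ)⁻¹ * ‖x‖ ^ 2)])
  · have e : fderiv ℝ (θ n) x = s ((n + 1 : ℝ) * ‖x‖ ^ 2) •
        -fderiv ℝ (fun x : Space d => s ((n + 1 : ℝ)⁻¹ * ‖x‖ ^ 2)) x
        + (1 - s ((n + 1 : ℝ)⁻¹ * ‖x‖ ^ 2)) •
          fderiv ℝ (fun x : Space d => s ((n + 1 : ℝ) * ‖x‖ ^ 2)) x := by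
      have h₁ := ((hcd (n + 1)).differentiable (by simp) x).hasFDerivAt
      have h₂ := ((hcd (n + 1 : ℝ)⁻¹).differentiable (by simp) x).hasFDerivAt.const_sub 1
      have h₃ : HasFDerivAt (θ n) _ x := h₁.mul h₂
      exact h₃.fderiv
    have b₁ := hfd (n + 1) x
    have b₂ := hfd (n + 1 : ℝ)⁻¹ x
    rw [e]
    calc _ ≤ ‖x‖ * (1 * ‖fderiv ℝ (fun x : Space d => s ((n + 1 : ℝ)⁻¹ * ‖x‖ ^ 2)) x‖
          + 1 * ‖fderiv ℝ (fun x : Space d => s ((n + 1 : ℝ) * ‖x‖ ^ 2)) x‖) := by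
          gcongr
          refine (norm_add_le _ _).trans ?_
          rw [norm_smul, norm_smul, norm_neg]
          gcongr
          · rw [Real.norm_eq_abs, abs_of_nonneg (snn _)]
            exact sle _
          · rw [Real.norm_eq_abs, abs_of_nonneg (by linarith [sle ((n + 1 : ℝ)⁻¹ * ‖x‖ ^ 2)])]
            linarith [snn ((n + 1 : ℝ)⁻¹ * ‖x‖ ^ 2)]
      _ ≤ _ := by
          rw [one_mul, one_mul, mul_add]
          exact add_le_add b₂ b₁
  · have hx0 : 0 < ‖x‖ := norm_pos_iff.2 hx
    have t₁ : Tendsto (fun n : ℕ => (n + 1 : ℝ) * ‖x‖ ^ 2) atTop atTop :=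
      (tendsto_natCast_atTop_atTop.atTop_add tendsto_const_nhds).atTop_mul_const (by positivity)
    have t₂ : Tendsto (fun n : ℕ => (n + 1 : ℝ)⁻¹ * ‖x‖ ^ 2) atTop (𝓝 0) := by
      have : Tendsto (fun n : ℕ => (n + 1 : ℝ)⁻¹) atTop (𝓝 0) := by
        simpa using tendsto_one_div_add_atTop_nhds_zero_nat (𝕜 := ℝ)
      simpa using this.mul_const (‖x‖ ^ 2)
    filter_upwards [t₁.eventually_gt_atTop 2, t₂.eventually_lt_const one_pos] with n h₁ h₂
    have hev : θ n =ᶠ[𝓝 x] fun _ => 1 := by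
      have c₁ : Continuous fun x : Space d => (n + 1 : ℝ) * ‖x‖ ^ 2 := by fun_prop
      have c₂ : Continuous fun x : Space d => (n + 1 : ℝ)⁻¹ * ‖x‖ ^ 2 := by fun_prop
      filter_upwards [c₁.tendsto x |>.eventually_const_lt h₁,
        c₂.tendsto x |>.eventually_lt_const h₂] with y y₁ y₂
      simp only [θ]
      rw [s1 _ y₁.le, s0 _ y₂.le, sub_zero, one_mul]
    exact ⟨hev.eq_of_nhds, by rw [hev.fderiv_eq, fderiv_fun_const]; rfl⟩

theorem ae_ne_zero (hd : 0 < d) : ∀ᵐ x : Space d, x ≠ 0 := by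
  have : Nonempty (Fin d) := ⟨⟨0, hd⟩⟩
  exact compl_mem_ae_iff.2 (measure_singleton 0)

theorem aestronglyMeasurable_of_continuousOn_compl (hd : 0 < d) {F : Type*} [TopologicalSpace F]
    [TopologicalSpace.PseudoMetrizableSpace F] [SecondCountableTopology F]
    {f : Space d → F} (hf : ContinuousOn f {0}ᶜ) : AEStronglyMeasurable f volume := by
  have h := hf.aestronglyMeasurable (μ := volume) (measurableSet_singleton (0 : Space d)).compl
  have h0 : ∀ᵐ x, x ∈ ({0}ᶜ : Set (Space d)) := ae_ne_zero hd
  rwa [Measure.restrict_eq_self_of_ae_mem h0] at h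

variable {θ : ℕ → Space d → ℝ} {C : ℝ}

theorem IsCutoffSeq.abs_pderiv_le (h : IsCutoffSeq θ C) (n : ℕ) (j : Fin d) {x : Space d}
    (hx : x ≠ 0) : |pderiv j (θ n) x| ≤ C * ‖x‖⁻¹ := by
  have h₁ : |pderiv j (θ n) x| ≤ ‖fderiv ℝ (θ n) x‖ := by
    have := (fderiv ℝ (θ n) x).le_opNorm (EuclideanSpace.single j 1)
    simpa using! this
  refine h₁.trans ?_
  rw [← div_eq_mul_inv, le_div_iff₀ (norm_pos_iff.2 hx), mul_comm]
  exact h.norm_mul_fderiv_le n x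

theorem IsCutoffSeq.tendsto_integral (h : IsCutoffSeq θ C) (hd : 0 < d) {f : Space d → ℂ}
    (hf : Integrable f) : Tendsto (fun n => ∫ x, (θ n x : ℂ) * f x) atTop (𝓝 (∫ x, f x)) := by
  refine tendsto_integral_of_dominated_convergence (fun x => ‖f x‖) (fun n => ?_) hf.norm
    (fun n => ae_of_all _ fun x => ?_) ?_
  · exact (Complex.continuous_ofReal.comp (h.contDiff n).continuous).aestronglyMeasurable.mul hf.1
  · rw [norm_mul, Complex.norm_real]
    exact mul_le_of_le_one_left (norm_nonneg _) (h.abs_le_one n x)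
  · filter_upwards [ae_ne_zero hd] with x hx
    refine tendsto_const_nhds.congr' ?_
    filter_upwards [h.eventually x hx] with n hn
    rw [hn.1, Complex.ofReal_one, one_mul]

theorem IsCutoffSeq.integrable (h : IsCutoffSeq θ C) {f : Space d → ℂ}
    (hf : Integrable f) (n : ℕ) : Integrable fun x => (θ n x : ℂ) * f x := by
  refine hf.bdd_mul (c := 1) ?_ (ae_of_all _ fun x => by simpa using h.abs_le_one n x)
  exact (Complex.continuous_ofReal.comp (h.contDiff n).continuous).aestronglyMeasurable

theorem IsCutoffSeq.aestronglyMeasurable_pderiv (h : IsCutoffSeq θ C) (j : Fin d) (n : ℕ) :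
    AEStronglyMeasurable (fun x => ((pderiv j (θ n) x : ℝ) : ℂ)) volume :=
  (Complex.continuous_ofReal.comp
    (contDiff_pderiv j (h.contDiff n)).continuous).aestronglyMeasurable

theorem IsCutoffSeq.norm_pderiv_mul_le (h : IsCutoffSeq θ C) (n : ℕ) (j : Fin d) {x : Space d}
    (hx : x ≠ 0) (z : ℂ) : ‖((pderiv j (θ n) x : ℝ) : ℂ) * z‖ ≤ C * (‖x‖⁻¹ * ‖z‖) := by
  rw [norm_mul, Complex.norm_real, ← mul_assoc]
  gcongr
  exact h.abs_pderiv_le n j hx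

theorem IsCutoffSeq.integrable_pderiv (h : IsCutoffSeq θ C) (hd : 0 < d) {f : Space d → ℂ}
    (hm : AEStronglyMeasurable f volume) (hf : Integrable fun x => ‖x‖⁻¹ * ‖f x‖) (j : Fin d)
    (n : ℕ) : Integrable fun x => ((pderiv j (θ n) x : ℝ) : ℂ) * f x := by
  refine (hf.const_mul C).mono' ((h.aestronglyMeasurable_pderiv j n).mul hm) ?_
  filter_upwards [ae_ne_zero hd] with x hx
  exact h.norm_pderiv_mul_le n j hx _

/-- Dominated convergence with majorant C|x|⁻¹|f|: at each nonzero point the gradient of the cutoff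
is eventually zero. -/
theorem IsCutoffSeq.tendsto_integral_pderiv (h : IsCutoffSeq θ C) (hd : 0 < d) {f : Space d → ℂ}
    (hm : AEStronglyMeasurable f volume) (hf : Integrable fun x => ‖x‖⁻¹ * ‖f x‖) (j : Fin d) :
    Tendsto (fun n => ∫ x, ((pderiv j (θ n) x : ℝ) : ℂ) * f x) atTop (𝓝 0) := by
  rw [show (0 : ℂ) = ∫ _ : Space d, (0 : ℂ) by simp]
  refine tendsto_integral_of_dominated_convergence (fun x => C * (‖x‖⁻¹ * ‖f x‖)) (fun n => ?_)
    (hf.const_mul C) (fun n => ?_) ?_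
  · exact (h.aestronglyMeasurable_pderiv j n).mul hm
  · filter_upwards [ae_ne_zero hd] with x hx
    exact h.norm_pderiv_mul_le n j hx _
  · filter_upwards [ae_ne_zero hd] with x hx
    refine tendsto_const_nhds.congr' ?_
    filter_upwards [h.eventually x hx] with n hn
    rw [pderiv, hn.2]
    simp

theorem IsCutoffSeq.contDiff_smul (h : IsCutoffSeq θ C) (n : ℕ) {F : Type*}
    [NormedAddCommGroup F] [NormedSpace ℝ F] {Q : Space d → F} (hQ : ContDiffOn ℝ ∞ Q {0}ᶜ) :
    ContDiff ℝ ∞ fun x => θ n x • Q x := by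
  rw [contDiff_iff_contDiffAt]
  intro x
  by_cases hx : x = 0
  · have : (fun x => θ n x • Q x) =ᶠ[𝓝 x] fun _ => 0 := by
      have := notMem_tsupport_iff_eventuallyEq.1 (h.zero_notMem n)
      rw [← hx] at this
      filter_upwards [this] with y hy
      rw [hy, Pi.zero_apply, zero_smul]
    exact contDiffAt_const.congr_of_eventuallyEq this
  · exact (h.contDiff n).contDiffAt.smul
      ((hQ x hx).contDiffAt (isOpen_compl_singleton.mem_nhds hx))

theorem IsCutoffSeq.hasCompactSupport_smul (h : IsCutoffSeq θ C) (n : ℕ) {F : Type*}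
    [NormedAddCommGroup F] [NormedSpace ℝ F] (Q : Space d → F) :
    HasCompactSupport fun x => θ n x • Q x :=
  (h.hasCompactSupport n).smul_right

end Cutoff

/-! ### Form identities with singular or growing multipliers -/

section Limit

variable {d N : ℕ} {θ : ℕ → Space d → ℝ} {C : ℝ} {B : Space d → Matrix (Fin d) (Fin d) ℝ}
  {ψ : Space d → Spinor N} {g : Fin d → Space d → Spinor N}

theorem toEuclideanLin_real_smul (c : ℝ) (M : Matrix (Fin N) (Fin N) ℂ) (v : Spinor N) :
    toEuclideanLin (c • M) v = (c : ℂ) • toEuclideanLin M v := by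
  rw [show c • M = (c : ℂ) • M from rfl, map_smul]
  rfl

/-- Integration by parts against a matrix field that is singular at the origin. -/
theorem IsMagneticPair.tendsto_integral_form (hp : IsMagneticPair B ψ g) (hθ : IsCutoffSeq θ C)
    (hd : 0 < d) (k : Fin d) {Q : Space d → Matrix (Fin N) (Fin N) ℂ}
    (hQ : ContDiffOn ℝ ∞ Q {0}ᶜ)
    (h₁ : Integrable fun x => ‖x‖⁻¹ * ‖(inner ℂ (ψ x) (toEuclideanLin (Q x) (ψ x)) : ℂ)‖)
    (h₂ : Integrable fun x => inner ℂ (ψ x) (toEuclideanLin (pderiv k Q x) (ψ x))) :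
    Tendsto (fun n => ∫ x, (θ n x : ℂ) * (inner ℂ (ψ x) (toEuclideanLin (Q x) (g k x))
      + inner ℂ (g k x) (toEuclideanLin (Q x) (ψ x)))) atTop
      (𝓝 (-∫ x, inner ℂ (ψ x) (toEuclideanLin (pderiv k Q x) (ψ x)))) := by
  have hQm : AEStronglyMeasurable Q volume :=
    aestronglyMeasurable_of_continuousOn_compl hd hQ.continuousOn
  have hm : AEStronglyMeasurable (fun x => inner ℂ (ψ x) (toEuclideanLin (Q x) (ψ x))) volume :=
    hp.memLp.1.inner ((matrixAction N).aestronglyMeasurable_comp₂ hQm hp.memLp.1)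
  -- Testing with θ_n Q produces (∂_kθ_n)Q and θ_n ∂_kQ by the product rule; the first contribution
  -- tends to 0 and the second to the claimed limit.
  have t := ((hθ.tendsto_integral_pderiv hd hm h₁ k).add (hθ.tendsto_integral hd h₂)).neg
  rw [zero_add] at t
  refine t.congr fun n => ?_
  have key := hp.integral_form k _ (hθ.contDiff_smul n hQ) (hθ.hasCompactSupport_smul n Q)
  rw [← integral_add (hθ.integrable_pderiv hd hm h₁ k n) (hθ.integrable h₂ n)]
  refine Eq.trans ?_ (key.symm.trans ?_)
  · congr 1
    refine integral_congr_ae ?_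
    filter_upwards [ae_ne_zero hd] with x hx
    have hQx : DifferentiableAt ℝ Q x :=
      ((hQ x hx).contDiffAt (isOpen_compl_singleton.mem_nhds hx)).differentiableAt (by simp)
    have e : pderiv k (fun x => θ n x • Q x) x
        = θ n x • pderiv k Q x + pderiv k (θ n) x • Q x := by
      have h : HasFDerivAt (fun x => θ n x • Q x) _ x :=
        ((hθ.contDiff n).differentiable (by simp) x).hasFDerivAt.smul hQx.hasFDerivAt
      rw [pderiv, h.fderiv]
      rfl
    rw [e, map_add, LinearMap.add_apply, inner_add_right, toEuclideanLin_real_smul,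
      toEuclideanLin_real_smul, inner_smul_right, inner_smul_right, add_comm]
  · refine integral_congr_ae (ae_of_all _ fun x => ?_)
    simp only [toEuclideanLin_real_smul, inner_smul_right]
    ring

/-- The commutation relation against a field with linear growth. -/
theorem IsMagneticPair.tendsto_commutator (hp : IsMagneticPair B ψ g) (hθ : IsCutoffSeq θ C)
    (hd : 0 < d) (j k : Fin d) (M : Matrix (Fin N) (Fin N) ℂ) {X : Space d → ℝ}
    (hX : ContDiff ℝ ∞ X)
    (h₁ : ∀ i, Integrable fun x =>
      ‖x‖⁻¹ * ‖((X x : ℂ) * inner ℂ (ψ x) (toEuclideanLin M (g i x)) : ℂ)‖)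
    (h₂ : Integrable fun x =>
      -(((pderiv j X x : ℝ) : ℂ) * inner ℂ (ψ x) (toEuclideanLin M (g k x)))
        + ((pderiv k X x : ℝ) : ℂ) * inner ℂ (ψ x) (toEuclideanLin M (g j x))
        + Complex.I * ((X x * B x j k : ℝ) * inner ℂ (ψ x) (toEuclideanLin M (ψ x)))) :
    Tendsto (fun n => ∫ x, (θ n x : ℂ) * ((X x : ℂ) *
      (inner ℂ (g j x) (toEuclideanLin M (g k x))
        - inner ℂ (g k x) (toEuclideanLin M (g j x))))) atTop
      (𝓝 (∫ x, (-(((pderiv j X x : ℝ) : ℂ) * inner ℂ (ψ x) (toEuclideanLin M (g k x)))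
        + ((pderiv k X x : ℝ) : ℂ) * inner ℂ (ψ x) (toEuclideanLin M (g j x))
        + Complex.I * ((X x * B x j k : ℝ) * inner ℂ (ψ x) (toEuclideanLin M (ψ x)))))) := by
  have hXm : AEStronglyMeasurable (fun x => (X x : ℂ)) volume :=
    (Complex.continuous_ofReal.comp hX.continuous).aestronglyMeasurable
  have hm : ∀ i, AEStronglyMeasurable
      (fun x => (X x : ℂ) * inner ℂ (ψ x) (toEuclideanLin M (g i x))) volume := fun i =>
    hXm.mul (hp.memLp.1.inner (memLp_toEuclideanLin M (hp.memLp_grad i)).1)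
  have t := ((hθ.tendsto_integral_pderiv hd (hm k) (h₁ k) j).neg.add
    (hθ.tendsto_integral_pderiv hd (hm j) (h₁ j) k)).add (hθ.tendsto_integral hd h₂)
  rw [neg_zero, zero_add, zero_add] at t
  refine t.congr fun n => ?_
  -- The product θ_n X is an admissible weight because the cutoff keeps its support compact and away
  -- from the origin, whatever `X` does there.
  have key := hp.commutator j k M (fun x => θ n x * X x) ((hθ.contDiff n).mul hX)
    (hθ.hasCompactSupport n).mul_right fun h => hθ.zero_notMem n (tsupport_mul_subset_left h)
  have cw : Continuous fun x => θ n x * X x := (hθ.contDiff n).continuous.mul hX.continuous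
  have sw : HasCompactSupport fun x => θ n x * X x := (hθ.hasCompactSupport n).mul_right
  have i₁ := integrable_weight_inner M (hp.memLp_grad j) (memLp_weight_smul cw sw (hp.memLp_grad k))
  have i₂ := integrable_weight_inner M (hp.memLp_grad k) (memLp_weight_smul cw sw (hp.memLp_grad j))
  have i₃ := hθ.integrable_pderiv hd (hm k) (h₁ k) j n
  have i₄ := hθ.integrable_pderiv hd (hm j) (h₁ j) k n
  have i₅ := hθ.integrable h₂ n
  rw [← integral_neg, ← integral_add i₃.fun_neg i₄, ← integral_add (i₃.fun_neg.fun_add i₄) i₅,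
    eq_comm, ← sub_eq_zero, ← integral_sub, ← key]
  · refine integral_congr_ae (ae_of_all _ fun x => ?_)
    have e : ∀ i, pderiv i (fun x => θ n x * X x) x
        = θ n x * pderiv i X x + X x * pderiv i (θ n) x := by
      intro i
      have h : HasFDerivAt (fun x => θ n x * X x) _ x :=
        ((hθ.contDiff n).differentiable (by simp) x).hasFDerivAt.mul
          (hX.differentiable (by simp) x).hasFDerivAt
      rw [pderiv, h.fderiv]
      rfl
    simp only [e]
    push_cast
    ring
  · refine (i₁.sub' i₂).congr (ae_of_all _ fun x => ?_)
    simp only []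
    push_cast
    ring
  · exact (i₃.fun_neg.fun_add i₄).fun_add i₅

end Limit

end MagneticDirac

namespace MagneticDirac

open Filter Topology
open Matrix (toEuclideanLin)

/-! ### Real-valued L² norms -/

section L2Norm

variable {X F F' : Type*} [MeasurableSpace X] [NormedAddCommGroup F] [NormedAddCommGroup F']
  {μ : Measure X}

/-- The `L²` norm of a square integrable function. -/
noncomputable def l2norm (μ : Measure X) (f : X → F) : ℝ := √(∫ x, ‖f x‖ ^ 2 ∂μ)

theorem l2norm_nonneg (f : X → F) : 0 ≤ l2norm μ f := Real.sqrt_nonneg _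

theorem sq_l2norm (f : X → F) : l2norm μ f ^ 2 = ∫ x, ‖f x‖ ^ 2 ∂μ :=
  Real.sq_sqrt (integral_nonneg fun _ => sq_nonneg _)

theorem integral_norm_mul_norm_le {u : X → F} {v : X → F'} (hu : MemLp u 2 μ) (hv : MemLp v 2 μ) :
    ∫ x, ‖u x‖ * ‖v x‖ ∂μ ≤ l2norm μ u * l2norm μ v := by
  have := integral_mul_norm_le_Lp_mul_Lq (μ := μ) (f := fun x => ‖u x‖) (g := fun x => ‖v x‖)
    (p := 2) (q := 2) Real.HolderConjugate.two_two (by simpa using hu.norm) (by simpa using hv.norm)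
  simpa [l2norm, Real.sqrt_eq_rpow] using this

theorem integrable_norm_mul_norm {u : X → F} {v : X → F'} (hu : MemLp u 2 μ) (hv : MemLp v 2 μ) :
    Integrable (fun x => ‖u x‖ * ‖v x‖) μ :=
  hu.norm.integrable_mul hv.norm

theorem integrable_of_norm_le_mul {u : X → F} {v : X → F'} (hu : MemLp u 2 μ) (hv : MemLp v 2 μ)
    {G : Type*} [NormedAddCommGroup G] {f : X → G} (hf : AEStronglyMeasurable f μ)
    (h : ∀ᵐ x ∂μ, ‖f x‖ ≤ ‖u x‖ * ‖v x‖) : Integrable f μ :=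
  (integrable_norm_mul_norm hu hv).mono' hf h

theorem norm_integral_le_l2norm_mul {u : X → F} {v : X → F'} (hu : MemLp u 2 μ) (hv : MemLp v 2 μ)
    {G : Type*} [NormedAddCommGroup G] [NormedSpace ℝ G] {f : X → G}
    (h : ∀ᵐ x ∂μ, ‖f x‖ ≤ ‖u x‖ * ‖v x‖) : ‖∫ x, f x ∂μ‖ ≤ l2norm μ u * l2norm μ v :=
  (norm_integral_le_of_norm_le (integrable_norm_mul_norm hu hv) h).trans
    (integral_norm_mul_norm_le hu hv)

theorem l2norm_le_mul {u : X → F} {v : X → F'} (hu : MemLp u 2 μ) {c : ℝ} (hc : 0 ≤ c)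
    (h : ∀ᵐ x ∂μ, ‖v x‖ ≤ c * ‖u x‖) : l2norm μ v ≤ c * l2norm μ u := by
  rw [l2norm, l2norm, ← Real.sqrt_sq hc, ← Real.sqrt_mul (sq_nonneg c), ← integral_const_mul]
  refine Real.sqrt_le_sqrt (integral_mono_of_nonneg (ae_of_all _ fun x => sq_nonneg _)
    ((hu.integrable_norm_pow (by norm_num)).const_mul _) ?_)
  filter_upwards [h] with x hx
  rw [← mul_pow]
  gcongr

theorem lintegral_enorm_sq_eq {u : X → F} (hu : MemLp u 2 μ) :
    ∫⁻ x, ‖u x‖ₑ ^ 2 ∂μ = ENNReal.ofReal (l2norm μ u ^ 2) := by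
  rw [sq_l2norm, ofReal_integral_eq_lintegral_ofReal (hu.integrable_norm_pow (by norm_num))
    (ae_of_all _ fun x => sq_nonneg _)]
  refine lintegral_congr fun x => ?_
  rw [ENNReal.ofReal_pow (norm_nonneg _), ofReal_norm]

theorem l2norm_le_of_lintegral_le {u : X → F} (hu : MemLp u 2 μ) {c : ℝ} (hc : 0 ≤ c)
    (h : ∫⁻ x, ‖u x‖ₑ ^ 2 ∂μ ≤ ENNReal.ofReal (c ^ 2)) : l2norm μ u ≤ c := by
  rw [lintegral_enorm_sq_eq hu, ENNReal.ofReal_le_ofReal_iff (sq_nonneg c)] at h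
  exact (sq_le_sq₀ (l2norm_nonneg u) hc).1 h

theorem eLpNorm_eq_ofReal_l2norm {u : X → F} (hu : MemLp u 2 μ) :
    eLpNorm u 2 μ = ENNReal.ofReal (l2norm μ u) := by
  have h : eLpNorm u 2 μ ^ 2 = ENNReal.ofReal (l2norm μ u) ^ 2 := by
    rw [eLpNorm_two_sq, lintegral_enorm_sq_eq hu, ENNReal.ofReal_pow (l2norm_nonneg u)]
  exact (ENNReal.pow_right_strictMono two_ne_zero).injective h

end L2Norm

/-! ### The magnetic Hardy inequality -/

section Hardy

variable {d N : ℕ} {B : Space d → Matrix (Fin d) (Fin d) ℝ}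
  {ψ : Space d → Spinor N} {g : Fin d → Space d → Spinor N}

/-- The Euclidean length of a gradient. -/
noncomputable def gradNorm (g : Fin d → Space d → Spinor N) (x : Space d) : ℝ :=
  √(∑ j, ‖g j x‖ ^ 2)

theorem gradNorm_nonneg (g : Fin d → Space d → Spinor N) (x : Space d) : 0 ≤ gradNorm g x :=
  Real.sqrt_nonneg _

theorem sq_gradNorm (g : Fin d → Space d → Spinor N) (x : Space d) :
    gradNorm g x ^ 2 = ∑ j, ‖g j x‖ ^ 2 :=
  Real.sq_sqrt (Finset.sum_nonneg fun _ _ => sq_nonneg _)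

theorem memLp_gradNorm (hg : ∀ j, MemLp (g j) 2 volume) : MemLp (gradNorm g) 2 volume := by
  have hm : AEStronglyMeasurable (gradNorm g) volume := by
    refine Real.continuous_sqrt.comp_aestronglyMeasurable ?_
    have := Finset.univ.aestronglyMeasurable_sum (μ := (volume : Measure (Space d)))
      (f := fun j x => ‖g j x‖ ^ 2) fun j _ => (hg j).1.norm.pow 2
    refine this.congr (ae_of_all _ fun x => ?_)
    rw [Finset.sum_apply]
  rw [memLp_two_iff_integrable_sq hm]
  simp only [sq_gradNorm]
  exact integrable_finsetSum _ fun j _ => (hg j).integrable_norm_pow (by norm_num)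

/-- The radial component `x · g`. -/
noncomputable def radial (g : Fin d → Space d → Spinor N) (x : Space d) : Spinor N :=
  ∑ k, (x k : ℂ) • g k x

theorem norm_radial_le (g : Fin d → Space d → Spinor N) (x : Space d) :
    ‖radial g x‖ ≤ ‖x‖ * gradNorm g x := by
  refine (norm_sum_le _ _).trans ?_
  have h : ∀ k, ‖(x k : ℂ) • g k x‖ = |x k| * ‖g k x‖ := fun k => by
    rw [norm_smul, Complex.norm_real, Real.norm_eq_abs]
  simp only [h]
  refine abs_le_of_sq_le_sq' ?_ (by positivity [gradNorm_nonneg g x]) |>.2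
  rw [mul_pow, sq_gradNorm, EuclideanSpace.norm_sq_eq]
  simp only [Real.norm_eq_abs]
  exact Finset.sum_mul_sq_le_sq_mul_sq _ _ _

theorem IsMagneticPair.integral_form_eq (hp : IsMagneticPair B ψ g) (hd : 0 < d) (k : Fin d)
    {Q : Space d → Matrix (Fin N) (Fin N) ℂ} (hQ : ContDiffOn ℝ ∞ Q {0}ᶜ)
    (h₁ : Integrable fun x => ‖x‖⁻¹ * ‖(inner ℂ (ψ x) (toEuclideanLin (Q x) (ψ x)) : ℂ)‖)
    (h₂ : Integrable fun x => inner ℂ (ψ x) (toEuclideanLin (pderiv k Q x) (ψ x)))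
    (h₃ : Integrable fun x => inner ℂ (ψ x) (toEuclideanLin (Q x) (g k x))
      + inner ℂ (g k x) (toEuclideanLin (Q x) (ψ x))) :
    ∫ x, (inner ℂ (ψ x) (toEuclideanLin (Q x) (g k x))
        + inner ℂ (g k x) (toEuclideanLin (Q x) (ψ x)))
      = -∫ x, inner ℂ (ψ x) (toEuclideanLin (pderiv k Q x) (ψ x)) := by
  obtain ⟨θ, C, hθ⟩ := exists_isCutoffSeq d
  exact tendsto_nhds_unique (hθ.tendsto_integral hd h₃) (hp.tendsto_integral_form hθ hd k hQ h₁ h₂)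

theorem norm_sq_add_pos {δ : ℝ} (hδ : 0 ≤ δ) {x : Space d} (hx : x ≠ 0) : 0 < ‖x‖ ^ 2 + δ := by
  have := norm_pos_iff.2 hx
  positivity

theorem contDiffOn_coord_mul_inv {δ : ℝ} (hδ : 0 ≤ δ) (k : Fin d) :
    ContDiffOn ℝ ∞ (fun x : Space d => x k * (‖x‖ ^ 2 + δ)⁻¹) {0}ᶜ := by
  refine ContDiffOn.mul (EuclideanSpace.proj (𝕜 := ℝ) k).contDiff.contDiffOn (ContDiffOn.inv
    ((contDiff_norm_sq ℝ).add contDiff_const).contDiffOn fun x hx => (norm_sq_add_pos hδ hx).ne')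

theorem pderiv_coord_mul_inv {δ : ℝ} (hδ : 0 ≤ δ) (k : Fin d) {x : Space d} (hx : x ≠ 0) :
    pderiv k (fun x : Space d => x k * (‖x‖ ^ 2 + δ)⁻¹) x
      = (‖x‖ ^ 2 + δ)⁻¹ - 2 * x k ^ 2 * ((‖x‖ ^ 2 + δ)⁻¹) ^ 2 := by
  have hs := (norm_sq_add_pos hδ hx).ne'
  have h₁ : HasFDerivAt (fun x : Space d => x k) (EuclideanSpace.proj (𝕜 := ℝ) k) x :=
    (EuclideanSpace.proj (𝕜 := ℝ) k).hasFDerivAt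
  have h₂ : HasFDerivAt (fun x : Space d => ‖x‖ ^ 2 + δ) (2 • (innerSL ℝ x)) x :=
    (hasStrictFDerivAt_norm_sq x).hasFDerivAt.add_const δ
  have h₃ : HasFDerivAt (fun x : Space d => (‖x‖ ^ 2 + δ)⁻¹)
      (-((‖x‖ ^ 2 + δ) ^ 2)⁻¹ • 2 • (innerSL ℝ x)) x :=
    HasDerivAt.comp_hasFDerivAt (h₂ := fun t => t⁻¹) x (hasDerivAt_inv hs) h₂
  have h₄ : HasFDerivAt (fun x : Space d => x k * (‖x‖ ^ 2 + δ)⁻¹) _ x := h₁.mul h₃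
  rw [pderiv, h₄.fderiv]
  simp [EuclideanSpace.inner_single_right]
  ring

theorem pderiv_smul_one (k : Fin d) {q : Space d → ℝ} {x : Space d} (hq : DifferentiableAt ℝ q x) :
    pderiv k (fun x => q x • (1 : Matrix (Fin N) (Fin N) ℂ)) x = pderiv k q x • 1 := by
  have h : HasFDerivAt (fun x => q x • (1 : Matrix (Fin N) (Fin N) ℂ)) _ x :=
    hq.hasFDerivAt.smul_const 1
  rw [pderiv, h.fderiv]
  rfl

theorem inner_real_smul_one (c : ℝ) (u v : Spinor N) :
    inner ℂ u (toEuclideanLin (c • (1 : Matrix (Fin N) (Fin N) ℂ)) v) = (c : ℂ) * inner ℂ u v := by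
  rw [toEuclideanLin_real_smul, toEuclideanLin_one_apply, inner_smul_right]

theorem abs_coord_le (x : Space d) (k : Fin d) : |x k| ≤ ‖x‖ := by
  simpa using EuclideanSpace.norm_eq x ▸ PiLp.norm_apply_le x k

theorem memLp_inv_sqrt_smul (hd : 0 < d) {δ : ℝ} (hδ : 0 ≤ δ)
    (hψ : AEStronglyMeasurable ψ volume)
    (hint : Integrable fun x => (‖x‖ ^ 2 + δ)⁻¹ * ‖ψ x‖ ^ 2) :
    MemLp (fun x => (√(‖x‖ ^ 2 + δ))⁻¹ * ‖ψ x‖) 2 volume := by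
  have hm : AEStronglyMeasurable (fun x : Space d => (√(‖x‖ ^ 2 + δ))⁻¹ * ‖ψ x‖) volume := by
    refine AEStronglyMeasurable.mul (aestronglyMeasurable_of_continuousOn_compl hd ?_) hψ.norm
    refine ContinuousOn.inv₀ (Continuous.continuousOn (by fun_prop)) fun x hx => ?_
    exact (Real.sqrt_pos.2 (norm_sq_add_pos hδ hx)).ne'
  rw [memLp_two_iff_integrable_sq hm]
  refine hint.congr (ae_of_all _ fun x => ?_)
  simp only [mul_pow, inv_pow]
  rw [Real.sq_sqrt (by positivity)]

/-- Integration by parts against the vector field x/(|x|² + δ), one coordinate at a time, followed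
by summation. The case δ = 0 is admitted so that the identity can be reused, once Hardy's inequality
has supplied the integrability. -/
theorem IsMagneticPair.integral_radial (hp : IsMagneticPair B ψ g) (hd : 0 < d) {δ : ℝ}
    (hδ : 0 ≤ δ) (hint : Integrable fun x => (‖x‖ ^ 2 + δ)⁻¹ * ‖ψ x‖ ^ 2) :
    2 * ∫ x, (‖x‖ ^ 2 + δ)⁻¹ * (inner ℂ (ψ x) (radial g x)).re
      = -∫ x, (d * (‖x‖ ^ 2 + δ)⁻¹ - 2 * ‖x‖ ^ 2 * ((‖x‖ ^ 2 + δ)⁻¹) ^ 2) * ‖ψ x‖ ^ 2 := by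
  set q : Fin d → Space d → ℝ := fun k x => x k * (‖x‖ ^ 2 + δ)⁻¹ with hq
  have hu := memLp_inv_sqrt_smul hd hδ hp.memLp.1 hint
  have hqc : ∀ k, ContDiffOn ℝ ∞ (q k) {0}ᶜ := contDiffOn_coord_mul_inv hδ
  have hqm : ∀ k, AEStronglyMeasurable (q k) volume := fun k =>
    aestronglyMeasurable_of_continuousOn_compl hd (hqc k).continuousOn
  have hwm : AEStronglyMeasurable (fun x : Space d => (‖x‖ ^ 2 + δ)⁻¹) volume :=
    aestronglyMeasurable_of_continuousOn_compl hd (ContinuousOn.inv₀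
      (Continuous.continuousOn (by fun_prop)) fun x hx => (norm_sq_add_pos hδ hx).ne')
  have hpd : ∀ k, ∀ᵐ x, pderiv k (fun x => q k x • (1 : Matrix (Fin N) (Fin N) ℂ)) x
      = ((‖x‖ ^ 2 + δ)⁻¹ - 2 * x k ^ 2 * ((‖x‖ ^ 2 + δ)⁻¹) ^ 2) • 1 := by
    intro k
    filter_upwards [ae_ne_zero hd] with x hx
    rw [pderiv_smul_one, pderiv_coord_mul_inv hδ k hx]
    exact ((hqc k x hx).contDiffAt (isOpen_compl_singleton.mem_nhds hx)).differentiableAt (by simp)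
  have hbd : ∀ (k : Fin d) (x : Space d), x k ^ 2 * (‖x‖ ^ 2 + δ)⁻¹ ≤ 1 := by
    intro k x
    rw [← div_eq_mul_inv]
    refine div_le_one_of_le₀ ?_ (by positivity)
    have := abs_coord_le x k
    nlinarith [sq_abs (x k), abs_nonneg (x k)]
  have hpi : ∀ k, Integrable fun x : Space d =>
      ((‖x‖ ^ 2 + δ)⁻¹ - 2 * x k ^ 2 * ((‖x‖ ^ 2 + δ)⁻¹) ^ 2) * ‖ψ x‖ ^ 2 := by
    intro k
    refine (hint.const_mul 3).mono' ?_ (ae_of_all _ fun x => ?_)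
    · refine AEStronglyMeasurable.mul (hwm.sub (AEStronglyMeasurable.mul ?_ (hwm.pow 2)))
        (hp.memLp.1.norm.pow 2)
      exact Continuous.aestronglyMeasurable (by fun_prop)
    · rw [norm_mul, Real.norm_eq_abs, Real.norm_eq_abs, abs_of_nonneg (sq_nonneg ‖ψ x‖),
        ← mul_assoc]
      refine mul_le_mul_of_nonneg_right ?_ (sq_nonneg _)
      have h0 : 0 ≤ (‖x‖ ^ 2 + δ)⁻¹ := by positivity
      have h1 := mul_le_mul_of_nonneg_right (hbd k x) h0
      rw [abs_le]
      constructor <;> nlinarith [mul_nonneg (sq_nonneg (x k)) (sq_nonneg (‖x‖ ^ 2 + δ)⁻¹)]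
  have hF : ∀ (k : Fin d) (x : Space d), inner ℂ (ψ x) (toEuclideanLin (q k x • (1 : Matrix (Fin N) (Fin N) ℂ)) (g k x))
      + inner ℂ (g k x) (toEuclideanLin (q k x • (1 : Matrix (Fin N) (Fin N) ℂ)) (ψ x))
      = ((2 * (q k x * (inner ℂ (ψ x) (g k x)).re) : ℝ) : ℂ) := by
    intro k x
    rw [inner_real_smul_one, inner_real_smul_one, ← mul_add, ← inner_conj_symm (g k x),
      Complex.add_conj]
    push_cast
    ring
  have hri : ∀ k : Fin d, Integrable fun x : Space d => 2 * (q k x * (inner ℂ (ψ x) (g k x)).re) := by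
    intro k
    refine Integrable.const_mul (integrable_of_norm_le_mul hu (hp.memLp_grad k)
      ((hqm k).mul (Complex.continuous_re.comp_aestronglyMeasurable
        (hp.memLp.1.inner (hp.memLp_grad k).1))) ?_) 2
    filter_upwards [ae_ne_zero hd] with x hx
    have hs := norm_sq_add_pos hδ hx
    have hs' := Real.sqrt_pos.2 hs
    have h1 : |q k x| ≤ (√(‖x‖ ^ 2 + δ))⁻¹ := by
      simp only [hq]
      rw [abs_mul, abs_of_pos (inv_pos.2 hs), ← div_eq_mul_inv, inv_eq_one_div,
        div_le_div_iff₀ hs hs', one_mul]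
      calc |x k| * √(‖x‖ ^ 2 + δ) ≤ √(‖x‖ ^ 2 + δ) * √(‖x‖ ^ 2 + δ) := by
            gcongr
            exact Real.le_sqrt_of_sq_le (by nlinarith [abs_coord_le x k, abs_nonneg (x k)])
        _ = _ := Real.mul_self_sqrt hs.le
    change ‖q k x * (inner ℂ (ψ x) (g k x) : ℂ).re‖ ≤ ‖(√(‖x‖ ^ 2 + δ))⁻¹ * ‖ψ x‖‖ * ‖g k x‖
    rw [norm_mul (q k x), norm_mul (√(‖x‖ ^ 2 + δ))⁻¹, Real.norm_eq_abs, Real.norm_eq_abs,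
      Real.norm_of_nonneg (inv_nonneg.2 hs'.le), norm_norm, mul_assoc]
    exact mul_le_mul h1 ((Complex.abs_re_le_norm _).trans
      (norm_inner_le_norm (𝕜 := ℂ) (ψ x) (g k x))) (abs_nonneg _)
      (by positivity)
  have key : ∀ k : Fin d, ∫ x : Space d, 2 * (q k x * (inner ℂ (ψ x) (g k x)).re)
      = -∫ x, ((‖x‖ ^ 2 + δ)⁻¹ - 2 * x k ^ 2 * ((‖x‖ ^ 2 + δ)⁻¹) ^ 2) * ‖ψ x‖ ^ 2 := by
    intro k
    have hG : ∀ᵐ x, inner ℂ (ψ x) (toEuclideanLin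
        (pderiv k (fun x => q k x • (1 : Matrix (Fin N) (Fin N) ℂ)) x) (ψ x))
        = (((‖x‖ ^ 2 + δ)⁻¹ - 2 * x k ^ 2 * ((‖x‖ ^ 2 + δ)⁻¹) ^ 2) * ‖ψ x‖ ^ 2 : ℝ) := by
      filter_upwards [hpd k] with x hx
      rw [hx, inner_real_smul_one, inner_self_eq_norm_sq_to_K]
      push_cast
      rfl
    have := hp.integral_form_eq hd k (Q := fun x => q k x • (1 : Matrix (Fin N) (Fin N) ℂ))
      ((hqc k).smul contDiffOn_const) ?_ ?_ ?_
    · simp only [hF] at this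
      rw [integral_congr_ae hG, integral_complex_ofReal, integral_complex_ofReal] at this
      exact_mod_cast this
    · refine hint.mono' ?_ ?_
      · refine (Continuous.aestronglyMeasurable continuous_norm).aemeasurable.inv.aestronglyMeasurable.mul ?_
        simp only [inner_real_smul_one]
        exact ((Complex.continuous_ofReal.comp_aestronglyMeasurable (hqm k)).mul
          (hp.memLp.1.inner hp.memLp.1)).norm
      · filter_upwards [ae_ne_zero hd] with x hx
        have hs := norm_sq_add_pos hδ hx
        have hx' := norm_pos_iff.2 hx
        rw [inner_real_smul_one, norm_mul, norm_norm, norm_mul, Complex.norm_real, norm_inv,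
          norm_norm, inner_self_eq_norm_sq_to_K]
        simp only [hq, Real.norm_eq_abs, abs_mul, abs_of_pos (inv_pos.2 hs)]
        have h1 : ‖x‖⁻¹ * |x k| ≤ 1 := by
          rw [inv_mul_eq_div]
          exact div_le_one_of_le₀ (abs_coord_le x k) hx'.le
        calc ‖x‖⁻¹ * (|x k| * (‖x‖ ^ 2 + δ)⁻¹ * ‖(((‖ψ x‖ : ℝ) : ℂ)) ^ 2‖)
            = (‖x‖⁻¹ * |x k|) * ((‖x‖ ^ 2 + δ)⁻¹ * ‖ψ x‖ ^ 2) := by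
              rw [norm_pow, Complex.norm_real, norm_norm]
              ring
          _ ≤ _ := mul_le_of_le_one_left (by positivity) h1
    · exact (hpi k).ofReal.congr (hG.mono fun x hx => hx.symm)
    · simp only [hF]
      exact (hri k).ofReal
  have hsum := Finset.sum_congr rfl fun k (_ : k ∈ Finset.univ) => key k
  rw [← integral_finsetSum _ fun k _ => hri k, Finset.sum_neg_distrib,
    ← integral_finsetSum _ fun k _ => hpi k] at hsum
  rw [← integral_const_mul]
  refine Eq.trans (integral_congr_ae (ae_of_all _ fun x => ?_)) (hsum.trans ?_)
  · simp only [radial, inner_sum, inner_smul_right, Complex.re_sum, Complex.re_ofReal_mul,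
      Finset.mul_sum, hq]
    exact Finset.sum_congr rfl fun k _ => by ring
  · congr 1
    refine integral_congr_ae (ae_of_all _ fun x => ?_)
    simp only [EuclideanSpace.norm_sq_eq x, Real.norm_eq_abs, sq_abs]
    rw [← Finset.sum_mul, Finset.sum_sub_distrib, Finset.sum_const, Finset.card_univ,
      Fintype.card_fin, nsmul_eq_mul, ← Finset.sum_mul, ← Finset.mul_sum]

theorem l2norm_inv_sqrt_sq {δ : ℝ} (hδ : 0 ≤ δ) :
    l2norm volume (fun x : Space d => (√(‖x‖ ^ 2 + δ))⁻¹ * ‖ψ x‖) ^ 2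
      = ∫ x, (‖x‖ ^ 2 + δ)⁻¹ * ‖ψ x‖ ^ 2 := by
  rw [sq_l2norm]
  refine integral_congr_ae (ae_of_all _ fun x => ?_)
  simp only [norm_mul, norm_inv, Real.norm_eq_abs, mul_pow, inv_pow, sq_abs]
  rw [Real.sq_sqrt (by positivity)]

/-- For δ > 0 the weight is bounded, so integrability is free. With U the weighted norm, the
divergence of the field is at least (d - 2)/(|x|² + δ), and Cauchy-Schwarz gives (d - 2)U² ≤ 2UG. -/
theorem IsMagneticPair.l2norm_inv_sqrt_le (hp : IsMagneticPair B ψ g) (hd : 3 ≤ d) {δ : ℝ}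
    (hδ : 0 < δ) : MemLp (fun x => (√(‖x‖ ^ 2 + δ))⁻¹ * ‖ψ x‖) 2 volume ∧
      ((d : ℝ) - 2) * l2norm volume (fun x : Space d => (√(‖x‖ ^ 2 + δ))⁻¹ * ‖ψ x‖)
        ≤ 2 * l2norm volume (gradNorm g) := by
  have hd0 : 0 < d := by omega
  have hd3 : (3 : ℝ) ≤ d := by exact_mod_cast hd
  have hint : Integrable fun x : Space d => (‖x‖ ^ 2 + δ)⁻¹ * ‖ψ x‖ ^ 2 := by
    refine (hp.memLp.integrable_norm_pow (by norm_num)).bdd_mul (c := δ⁻¹) ?_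
      (ae_of_all _ fun x => ?_)
    · refine Continuous.aestronglyMeasurable (Continuous.inv₀ (by fun_prop) fun x => ?_)
      positivity
    · rw [Real.norm_of_nonneg (by positivity)]
      exact inv_anti₀ hδ (by nlinarith [sq_nonneg ‖x‖])
  have hu := memLp_inv_sqrt_smul hd0 hδ.le hp.memLp.1 hint
  refine ⟨hu, ?_⟩
  set U := l2norm volume (fun x : Space d => (√(‖x‖ ^ 2 + δ))⁻¹ * ‖ψ x‖) with hU
  have key := hp.integral_radial hd0 hδ.le hint
  have h₁ : ((d : ℝ) - 2) * U ^ 2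
      ≤ ∫ x, (d * (‖x‖ ^ 2 + δ)⁻¹ - 2 * ‖x‖ ^ 2 * ((‖x‖ ^ 2 + δ)⁻¹) ^ 2) * ‖ψ x‖ ^ 2 := by
    rw [hU, l2norm_inv_sqrt_sq hδ.le, ← integral_const_mul]
    have hle : ∀ x : Space d, ‖x‖ ^ 2 * (‖x‖ ^ 2 + δ)⁻¹ ≤ 1 := fun x => by
      rw [← div_eq_mul_inv]
      exact div_le_one_of_le₀ (by linarith) (by positivity)
    refine integral_mono (hint.const_mul _) ?_ fun x => ?_
    · have hb : Integrable fun x : Space d =>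
          (d - 2 * (‖x‖ ^ 2 * (‖x‖ ^ 2 + δ)⁻¹)) * ((‖x‖ ^ 2 + δ)⁻¹ * ‖ψ x‖ ^ 2) := by
        refine hint.bdd_mul (c := d + 2) ?_ (ae_of_all _ fun x => ?_)
        · refine Continuous.aestronglyMeasurable (continuous_const.sub (continuous_const.mul
            (Continuous.mul (by fun_prop) (Continuous.inv₀ (by fun_prop) fun x => ?_))))
          positivity
        · rw [Real.norm_eq_abs, abs_le]
          have := hle x
          have h0 : 0 ≤ ‖x‖ ^ 2 * (‖x‖ ^ 2 + δ)⁻¹ := by positivity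
          constructor <;> linarith
      refine hb.congr (ae_of_all _ fun x => ?_)
      ring
    · have h0 : 0 ≤ (‖x‖ ^ 2 + δ)⁻¹ * ‖ψ x‖ ^ 2 := by positivity
      have := mul_le_mul_of_nonneg_right (hle x) h0
      simp only []
      nlinarith
  have h₂ : |∫ x, (‖x‖ ^ 2 + δ)⁻¹ * (inner ℂ (ψ x) (radial g x)).re|
      ≤ U * l2norm volume (gradNorm g) := by
    refine norm_integral_le_l2norm_mul (G := ℝ) hu (memLp_gradNorm hp.memLp_grad)
      (ae_of_all _ fun x => ?_)
    have hs : 0 < ‖x‖ ^ 2 + δ := by positivity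
    have hx : ‖x‖ ≤ √(‖x‖ ^ 2 + δ) := Real.le_sqrt_of_sq_le (by linarith)
    rw [norm_mul, norm_mul, Real.norm_of_nonneg (by positivity : (0 : ℝ) ≤ (‖x‖ ^ 2 + δ)⁻¹),
      Real.norm_of_nonneg (by positivity : (0 : ℝ) ≤ (√(‖x‖ ^ 2 + δ))⁻¹), norm_norm,
      Real.norm_of_nonneg (gradNorm_nonneg g x), Real.norm_eq_abs]
    have hr : |(inner ℂ (ψ x) (radial g x)).re| ≤ ‖ψ x‖ * (√(‖x‖ ^ 2 + δ) * gradNorm g x) := by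
      refine (Complex.abs_re_le_norm _).trans ((norm_inner_le_norm _ _).trans ?_)
      gcongr
      exact (norm_radial_le g x).trans (mul_le_mul_of_nonneg_right hx (gradNorm_nonneg g x))
    calc _ ≤ (‖x‖ ^ 2 + δ)⁻¹ * (‖ψ x‖ * (√(‖x‖ ^ 2 + δ) * gradNorm g x)) := by gcongr
      _ = _ := by
        nth_rw 1 [← Real.mul_self_sqrt hs.le]
        field_simp
  -- The inequality is to be divided by U, so U = 0 is treated apart.
  rcases (l2norm_nonneg (μ := volume) fun x : Space d => (√(‖x‖ ^ 2 + δ))⁻¹ * ‖ψ x‖).eq_or_lt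
    with h0 | h0
  · rw [hU, ← h0, mul_zero]
    exact mul_nonneg zero_le_two (l2norm_nonneg _)
  · refine le_of_mul_le_mul_right ?_ (h0.trans_eq hU.symm)
    have := neg_le_of_abs_le h₂
    nlinarith

/-- **Hardy's inequality** for a magnetic gradient. -/
theorem IsMagneticPair.hardy (hp : IsMagneticPair B ψ g) (hd : 3 ≤ d) :
    MemLp (fun x => ‖x‖⁻¹ * ‖ψ x‖) 2 volume ∧
      ((d : ℝ) - 2) * l2norm volume (fun x : Space d => ‖x‖⁻¹ * ‖ψ x‖)
        ≤ 2 * l2norm volume (gradNorm g) := by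
  have hd0 : 0 < d := by omega
  have hd3 : (3 : ℝ) ≤ d := by exact_mod_cast hd
  have hd2 : 0 < (d : ℝ) - 2 := by linarith
  have hm : AEStronglyMeasurable (fun x => ‖x‖⁻¹ * ‖ψ x‖) volume :=
    (aestronglyMeasurable_of_continuousOn_compl hd0 (continuous_norm.continuousOn.inv₀
      fun x hx => norm_ne_zero_iff.2 hx)).mul hp.memLp.1.norm
  let δ : ℕ → ℝ := fun n => 1 / ((n : ℝ) + 1)
  have hδ : ∀ n, 0 < δ n := fun n => by positivity
  have hδt : Tendsto δ atTop (𝓝 0) := tendsto_one_div_add_atTop_nhds_zero_nat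
  have hlim : ∀ᵐ x : Space d, Tendsto (fun n => (√(‖x‖ ^ 2 + δ n))⁻¹ * ‖ψ x‖) atTop
      (𝓝 (‖x‖⁻¹ * ‖ψ x‖)) := by
    filter_upwards [ae_ne_zero hd0] with x hx
    have h := (Real.continuous_sqrt.tendsto _).comp (tendsto_const_nhds (x := ‖x‖ ^ 2) |>.add hδt)
    rw [add_zero, Real.sqrt_sq (norm_nonneg x)] at h
    exact (h.inv₀ (norm_ne_zero_iff.2 hx)).mul_const _
  -- Fatou's lemma as δ → 0: the regularised bounds are uniform and give both integrability and the
  -- inequality.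
  have hle := Lp.eLpNorm_lim_le_liminf_eLpNorm (p := 2) (μ := volume)
    (f := fun n (x : Space d) => (√(‖x‖ ^ 2 + δ n))⁻¹ * ‖ψ x‖)
    (fun n => (hp.l2norm_inv_sqrt_le hd (hδ n)).1.1) _ hlim
  have hc : 0 ≤ 2 * l2norm volume (gradNorm g) / ((d : ℝ) - 2) :=
    div_nonneg (mul_nonneg zero_le_two (l2norm_nonneg _)) hd2.le
  have hle' : eLpNorm (fun x => ‖x‖⁻¹ * ‖ψ x‖) 2 volume
      ≤ ENNReal.ofReal (2 * l2norm volume (gradNorm g) / ((d : ℝ) - 2)) := by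
    refine hle.trans (liminf_le_of_le (by isBoundedDefault) fun b hb => ?_)
    obtain ⟨n, hn⟩ := hb.exists
    refine hn.trans ?_
    obtain ⟨h₁, h₂⟩ := hp.l2norm_inv_sqrt_le hd (hδ n)
    rw [eLpNorm_eq_ofReal_l2norm h₁]
    refine ENNReal.ofReal_le_ofReal ?_
    rw [le_div_iff₀ hd2, mul_comm]
    exact h₂
  have hmem : MemLp (fun x => ‖x‖⁻¹ * ‖ψ x‖) 2 volume := ⟨hm, hle'.trans_lt ENNReal.ofReal_lt_top⟩
  refine ⟨hmem, ?_⟩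
  rw [eLpNorm_eq_ofReal_l2norm hmem, ENNReal.ofReal_le_ofReal_iff hc, le_div_iff₀ hd2] at hle'
  rw [mul_comm]
  exact hle'

end Hardy

end MagneticDirac

namespace MagneticDirac

open Filter Topology
open Matrix (toEuclideanLin)

/-! ### Symmetry of D and the Lichnerowicz formula -/

section Identities

variable {d N : ℕ} {α : Fin d → Matrix (Fin N) (Fin N) ℂ} {β : Matrix (Fin N) (Fin N) ℂ}
  {B : Space d → Matrix (Fin d) (Fin d) ℝ} {ψ : Space d → Spinor N}
  {g : Fin d → Space d → Spinor N}

/-- The kinetic part `-i α · g` of the Dirac operator. -/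
noncomputable def diracGrad (α : Fin d → Matrix (Fin N) (Fin N) ℂ) (g : Fin d → Space d → Spinor N)
    (x : Space d) : Spinor N :=
  (-Complex.I) • ∑ j, toEuclideanLin (α j) (g j x)

/-- The Zeeman matrix `∑_{jk} B_jk α_j α_k`. -/
noncomputable def zeeman (α : Fin d → Matrix (Fin N) (Fin N) ℂ)
    (M : Matrix (Fin d) (Fin d) ℝ) : Matrix (Fin N) (Fin N) ℂ :=
  ∑ j, ∑ k, (M j k : ℂ) • (α j * α k)

theorem memLp_diracGrad (hg : ∀ j, MemLp (g j) 2 volume) : MemLp (diracGrad α g) 2 volume :=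
  (memLp_finsetSum Finset.univ fun j _ => memLp_toEuclideanLin (α j) (hg j)).const_smul
    (-Complex.I)

theorem aestronglyMeasurable_entry (hB : AEStronglyMeasurable B volume) (j k : Fin d) :
    AEStronglyMeasurable (fun x => B x j k) volume :=
  (LinearMap.continuous_of_finiteDimensional
    (Matrix.entryLinearMap ℝ ℝ j k)).comp_aestronglyMeasurable hB

theorem norm_inner_toEuclideanLin_le (M : Matrix (Fin N) (Fin N) ℂ) (u v : Spinor N) :
    ‖(inner ℂ u (toEuclideanLin M v) : ℂ)‖ ≤ ‖M‖ * (‖u‖ * ‖v‖) :=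
  (norm_inner_le_norm (𝕜 := ℂ) u _).trans <| by
    rw [mul_left_comm]
    exact mul_le_mul_of_nonneg_left (norm_toEuclideanLin_le M v) (norm_nonneg u)

theorem IsMagneticPair.integrable_inner_grad (hp : IsMagneticPair B ψ g)
    (M : Matrix (Fin N) (Fin N) ℂ) (j : Fin d) :
    Integrable fun x => inner ℂ (ψ x) (toEuclideanLin M (g j x)) :=
  integrable_inner_of_memLp hp.memLp (memLp_toEuclideanLin M (hp.memLp_grad j))

theorem IsMagneticPair.integrable_inv_norm_mul (hp : IsMagneticPair B ψ g) (hd : 3 ≤ d)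
    {F : Space d → ℂ} (hF : AEStronglyMeasurable F volume) {v : Space d → Spinor N}
    (hv : MemLp v 2 volume) {c : ℝ} (h : ∀ x, ‖F x‖ ≤ c * (‖ψ x‖ * ‖v x‖)) :
    Integrable fun x => ‖x‖⁻¹ * ‖F x‖ := by
  refine ((integrable_norm_mul_norm (hp.hardy hd).1 hv).const_mul c).mono' ?_
    (ae_of_all _ fun x => ?_)
  · exact continuous_norm.aestronglyMeasurable.aemeasurable.inv.aestronglyMeasurable.mul hF.norm
  · rw [norm_mul, norm_inv, norm_norm, norm_norm, norm_mul, norm_inv, norm_norm, norm_norm]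
    calc ‖x‖⁻¹ * ‖F x‖ ≤ ‖x‖⁻¹ * (c * (‖ψ x‖ * ‖v x‖)) := by
          gcongr
          exact h x
      _ = _ := by ring

theorem IsMagneticPair.integrable_coord_field (hp : IsMagneticPair B ψ g)
    (hB : AEStronglyMeasurable B volume) (hBψ : MemLp (fun x => (‖x‖ * ‖B x‖) • ψ x) 2 volume)
    (M : Matrix (Fin N) (Fin N) ℂ) (i j k : Fin d) :
    Integrable fun x => ((x i * B x j k : ℝ) : ℂ) * inner ℂ (ψ x) (toEuclideanLin M (ψ x)) := by
  refine ((integrable_norm_mul_norm hBψ hp.memLp).const_mul ‖M‖).mono' ?_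
    (ae_of_all _ fun x => ?_)
  · refine AEStronglyMeasurable.mul (Complex.continuous_ofReal.comp_aestronglyMeasurable ?_)
      (hp.memLp.1.inner (memLp_toEuclideanLin M hp.memLp).1)
    exact (EuclideanSpace.proj (𝕜 := ℝ) i).continuous.aestronglyMeasurable.mul
      (aestronglyMeasurable_entry hB j k)
  · rw [norm_mul, Complex.norm_real, norm_mul, norm_smul, norm_mul, norm_norm, norm_norm,
      Real.norm_eq_abs, Real.norm_eq_abs]
    calc |x i| * |B x j k| * ‖(inner ℂ (ψ x) (toEuclideanLin M (ψ x)) : ℂ)‖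
        ≤ ‖x‖ * ‖B x‖ * (‖M‖ * (‖ψ x‖ * ‖ψ x‖)) := by
          gcongr
          · exact abs_coord_le x i
          · exact abs_entry_le_norm _ j k
          · exact norm_inner_toEuclideanLin_le _ _ _
      _ = _ := by ring

/-- Although B itself has no weight, |B||ψ|² = (|x||B||ψ|)(|x|⁻¹|ψ|) is a product of two L²
functions by Hardy's inequality. -/
theorem IsMagneticPair.integrable_field (hp : IsMagneticPair B ψ g) (hd : 3 ≤ d)
    (hB : AEStronglyMeasurable B volume) (hBψ : MemLp (fun x => (‖x‖ * ‖B x‖) • ψ x) 2 volume)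
    (M : Matrix (Fin N) (Fin N) ℂ) (j k : Fin d) :
    Integrable fun x => (B x j k : ℂ) * inner ℂ (ψ x) (toEuclideanLin M (ψ x)) := by
  refine ((integrable_norm_mul_norm hBψ (hp.hardy hd).1).const_mul ‖M‖).mono' ?_ ?_
  · exact AEStronglyMeasurable.mul (Complex.continuous_ofReal.comp_aestronglyMeasurable
      (aestronglyMeasurable_entry hB j k)) (hp.memLp.1.inner (memLp_toEuclideanLin M hp.memLp).1)
  · filter_upwards [ae_ne_zero (d := d) (by omega)] with x hx
    have hx' : ‖x‖ ≠ 0 := norm_ne_zero_iff.2 hx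
    rw [norm_mul, Complex.norm_real, norm_smul, norm_mul, norm_norm, norm_norm, norm_mul, norm_inv,
      norm_norm, norm_norm, Real.norm_eq_abs]
    calc |B x j k| * ‖(inner ℂ (ψ x) (toEuclideanLin M (ψ x)) : ℂ)‖
        ≤ ‖B x‖ * (‖M‖ * (‖ψ x‖ * ‖ψ x‖)) := by
          gcongr
          · exact abs_entry_le_norm _ j k
          · exact norm_inner_toEuclideanLin_le _ _ _
      _ = _ := by field_simp

/-- For a constant Hermitian matrix Q, integration by parts has no derivative term and says that ⟨ψ,
Q g_k⟩ has vanishing real part after integration. Taking Q = -iMα_k and summing over k gives the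
claim. The choices M = i and M = β are used below. -/
theorem IsMagneticPair.re_integral_mul_diracGrad (hp : IsMagneticPair B ψ g) (hd : 3 ≤ d)
    {M : Matrix (Fin N) (Fin N) ℂ} (hM : ∀ k, ((-Complex.I) • (M * α k)).IsHermitian) :
    (∫ x, inner ℂ (ψ x) (toEuclideanLin M (diracGrad α g x))).re = 0 := by
  have hQ : ∀ k (u v : Spinor N), inner ℂ u (toEuclideanLin ((-Complex.I) • (M * α k)) v)
      = -Complex.I * inner ℂ u (toEuclideanLin M (toEuclideanLin (α k) v)) := fun k u v => by
    rw [map_smul, LinearMap.smul_apply, inner_smul_right, toEuclideanLin_mul_apply]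
  have hi : ∀ k, Integrable fun x =>
      inner ℂ (ψ x) (toEuclideanLin ((-Complex.I) • (M * α k)) (g k x)) := fun k =>
    hp.integrable_inner_grad _ k
  have hre : ∀ k, (∫ x, inner ℂ (ψ x) (toEuclideanLin ((-Complex.I) • (M * α k)) (g k x))).re
      = 0 := by
    intro k
    set Q := (-Complex.I) • (M * α k) with hQdef
    have hF : ∀ x, inner ℂ (ψ x) (toEuclideanLin Q (g k x)) + inner ℂ (g k x) (toEuclideanLin Q (ψ x))
        = ((2 * (inner ℂ (ψ x) (toEuclideanLin Q (g k x))).re : ℝ) : ℂ) := fun x => by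
      rw [← (hM k).inner_toEuclideanLin (g k x), ← inner_conj_symm _ (ψ x), Complex.add_conj]
    have h := hp.integral_form_eq (by omega) k (Q := fun _ => Q) contDiffOn_const ?_ ?_ ?_
    · have hz : ∀ x : Space d, pderiv k (fun _ => Q) x = 0 := fun x => by
        rw [pderiv, fderiv_fun_const]
        rfl
      simp only [hF, hz, map_zero, LinearMap.zero_apply, inner_zero_right, integral_zero,
        neg_zero] at h
      rw [integral_complex_ofReal, integral_const_mul, Complex.ofReal_eq_zero] at h
      have h' := mul_eq_zero.1 h |>.resolve_left two_ne_zero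
      rw [← RCLike.re_eq_complex_re, ← integral_re (hi k)]
      exact h'
    · exact hp.integrable_inv_norm_mul hd
        (hp.memLp.1.inner (memLp_toEuclideanLin Q hp.memLp).1) hp.memLp
        fun x => norm_inner_toEuclideanLin_le Q _ _
    · have hz : ∀ x : Space d, pderiv k (fun _ => Q) x = 0 := fun x => by
        rw [pderiv, fderiv_fun_const]
        rfl
      simp [hz]
    · simp only [hF]
      exact ((hi k).re.const_mul 2).ofReal
  have e : ∫ x, inner ℂ (ψ x) (toEuclideanLin M (diracGrad α g x))
      = ∑ k, ∫ x, inner ℂ (ψ x) (toEuclideanLin ((-Complex.I) • (M * α k)) (g k x)) := by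
    rw [← integral_finsetSum _ fun k _ => hi k]
    refine integral_congr_ae (ae_of_all _ fun x => ?_)
    simp only [diracGrad, map_smul, LinearMap.smul_apply, toEuclideanLin_mul_apply,
      inner_smul_right, map_sum, inner_sum, Finset.mul_sum]
  rw [e, Complex.re_sum]
  exact Finset.sum_eq_zero fun k _ => hre k

/-- The kinetic energy form is real. -/
theorem IsMagneticPair.im_integral_diracGrad (hp : IsMagneticPair B ψ g) (hd : 3 ≤ d)
    (hαβ : IsDiracMatrices α β) : (∫ x, inner ℂ (ψ x) (diracGrad α g x)).im = 0 := by
  have h := hp.re_integral_mul_diracGrad hd (α := α)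
    (M := Complex.I • (1 : Matrix (Fin N) (Fin N) ℂ)) fun k => by
      simpa [smul_smul] using hαβ.alpha_hermitian k
  simpa [toEuclideanLin_one_apply, inner_smul_right, integral_const_mul] using h

/-- The kinetic term is orthogonal, in the real sense, to the mass term. -/
theorem IsMagneticPair.re_integral_beta_diracGrad (hp : IsMagneticPair B ψ g) (hd : 3 ≤ d)
    (hαβ : IsDiracMatrices α β) :
    (∫ x, inner ℂ (toEuclideanLin β (ψ x)) (diracGrad α g x)).re = 0 := by
  have h := hp.re_integral_mul_diracGrad hd (α := α) (M := β) fun k => by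
    have := hαβ.alpha_beta_anticomm k
    rw [Matrix.IsHermitian, Matrix.conjTranspose_smul, Matrix.conjTranspose_mul,
      hαβ.beta_hermitian.eq, (hαβ.alpha_hermitian k).eq, eq_neg_of_add_eq_zero_left this]
    simp
  simpa only [hαβ.beta_hermitian.inner_toEuclideanLin] using h

/-- This is the commutation relation with the weight 1. The cutoff errors are of size |x|⁻¹|ψ||g|,
which is integrable by Hardy's inequality. -/
theorem IsMagneticPair.integral_commutator_eq (hp : IsMagneticPair B ψ g) (hd : 3 ≤ d)
    (hB : AEStronglyMeasurable B volume) (hBψ : MemLp (fun x => (‖x‖ * ‖B x‖) • ψ x) 2 volume)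
    (M : Matrix (Fin N) (Fin N) ℂ) (j k : Fin d) :
    ∫ x, (inner ℂ (g j x) (toEuclideanLin M (g k x)) - inner ℂ (g k x) (toEuclideanLin M (g j x)))
      = ∫ x, Complex.I * ((B x j k : ℂ) * inner ℂ (ψ x) (toEuclideanLin M (ψ x))) := by
  obtain ⟨θ, C, hθ⟩ := exists_isCutoffSeq d
  have hz : ∀ (i : Fin d) (x : Space d), pderiv i (fun _ => (1 : ℝ)) x = 0 := fun i x => by
    rw [pderiv, fderiv_fun_const]
    rfl
  have t := hp.tendsto_commutator hθ (by omega) j k M (X := fun _ => 1) contDiff_const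
    (fun i => ?_) ?_
  · simp only [hz, Complex.ofReal_zero, zero_mul, neg_zero, add_zero, zero_add, one_mul,
      Complex.ofReal_one] at t
    refine tendsto_nhds_unique (hθ.tendsto_integral (by omega) ?_) t
    exact (integrable_inner_of_memLp (hp.memLp_grad j)
      (memLp_toEuclideanLin M (hp.memLp_grad k))).sub' (integrable_inner_of_memLp (hp.memLp_grad k)
      (memLp_toEuclideanLin M (hp.memLp_grad j)))
  · simp only [Complex.ofReal_one, one_mul]
    exact hp.integrable_inv_norm_mul hd
      (hp.memLp.1.inner (memLp_toEuclideanLin M (hp.memLp_grad i)).1) (hp.memLp_grad i)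
      fun x => norm_inner_toEuclideanLin_le M _ _
  · simp only [hz, Complex.ofReal_zero, zero_mul, neg_zero, add_zero, zero_add, one_mul]
    exact (hp.integrable_field hd hB hBψ M j k).const_mul _

theorem integrable_finsetSum₂ {F : Fin d → Fin d → Space d → ℂ}
    (h : ∀ j k, Integrable (F j k)) : Integrable fun x => ∑ j, ∑ k, F j k x :=
  integrable_finsetSum _ fun j _ => integrable_finsetSum _ fun k _ => h j k

theorem integral_finsetSum₂ {F : Fin d → Fin d → Space d → ℂ} (h : ∀ j k, Integrable (F j k)) :
    ∫ x, ∑ j, ∑ k, F j k x = ∑ j, ∑ k, ∫ x, F j k x := by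
  rw [integral_finsetSum _ fun j _ => integrable_finsetSum _ fun k _ => h j k]
  exact Finset.sum_congr rfl fun j _ => integral_finsetSum _ fun k _ => h j k

theorem inner_zeeman (M : Matrix (Fin d) (Fin d) ℝ) (u v : Spinor N) :
    inner ℂ u (toEuclideanLin (zeeman α M) v)
      = ∑ j, ∑ k, (M j k : ℂ) * inner ℂ u (toEuclideanLin (α j * α k) v) := by
  simp only [zeeman, map_sum, map_smul, LinearMap.sum_apply, LinearMap.smul_apply, inner_sum,
    inner_smul_right]

/-- The pointwise identity behind the Lichnerowicz formula. -/
theorem IsDiracMatrices.two_mul_inner_diracGrad (hαβ : IsDiracMatrices α β)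
    (g : Fin d → Space d → Spinor N) (x : Space d) :
    2 * inner ℂ (diracGrad α g x) (diracGrad α g x)
      = 2 * ((gradNorm g x ^ 2 : ℝ) : ℂ)
        + ∑ j, ∑ k, (inner ℂ (g j x) (toEuclideanLin (α j * α k) (g k x))
          - inner ℂ (g k x) (toEuclideanLin (α j * α k) (g j x))) := by
  have e : inner ℂ (diracGrad α g x) (diracGrad α g x)
      = ∑ j, ∑ k, inner ℂ (g j x) (toEuclideanLin (α j * α k) (g k x)) := by
    simp only [diracGrad, inner_smul_left, inner_smul_right, sum_inner, inner_sum,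
      (hαβ.alpha_hermitian _).inner_toEuclideanLin, ← toEuclideanLin_mul_apply]
    rw [← Finset.mul_sum, ← mul_assoc, Finset.sum_comm]
    simp
  have e' : inner ℂ (diracGrad α g x) (diracGrad α g x)
      = ∑ j, ∑ k, inner ℂ (g k x) (toEuclideanLin (α k * α j) (g j x)) := by
    rw [e, Finset.sum_comm]
  -- The anticommutation relations reverse the order of the two matrices: off the diagonal this
  -- costs a sign, and on the diagonal it leaves the term that sums to |g|².
  have hr : ∀ j k, inner ℂ (g k x) (toEuclideanLin (α k * α j) (g j x))
      = -inner ℂ (g k x) (toEuclideanLin (α j * α k) (g j x))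
        + if j = k then 2 * ((‖g j x‖ ^ 2 : ℝ) : ℂ) else 0 := by
    intro j k
    rw [eq_sub_of_add_eq (hαβ.alpha_anticomm k j), map_sub, LinearMap.sub_apply, inner_sub_right,
      sub_eq_neg_add]
    congr 1
    by_cases h : j = k
    · subst h
      rw [if_pos rfl, if_pos rfl, show (2 : Matrix (Fin N) (Fin N) ℂ) = (2 : ℂ) • 1 by
        rw [two_smul, one_add_one_eq_two], map_smul, LinearMap.smul_apply,
        toEuclideanLin_one_apply, inner_smul_right, inner_self_eq_norm_sq_to_K]
      simp
    · rw [if_neg h, if_neg (Ne.symm h), map_zero, LinearMap.zero_apply, inner_zero_right]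
  rw [two_mul]
  nth_rewrite 1 [e]
  rw [e']
  simp only [hr, Finset.sum_add_distrib, Finset.sum_sub_distrib, Finset.sum_neg_distrib,
    Finset.sum_ite_eq, Finset.mem_univ, if_true, sq_gradNorm]
  push_cast
  rw [← Finset.mul_sum]
  ring

/-- The Lichnerowicz formula in integrated form. -/
theorem IsMagneticPair.integral_inner_diracGrad_self (hp : IsMagneticPair B ψ g) (hd : 3 ≤ d)
    (hαβ : IsDiracMatrices α β) (hB : AEStronglyMeasurable B volume)
    (hBψ : MemLp (fun x => (‖x‖ * ‖B x‖) • ψ x) 2 volume) :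
    l2norm volume (diracGrad α g) ^ 2 = l2norm volume (gradNorm g) ^ 2
      + (Complex.I / 2 * ∫ x, inner ℂ (ψ x) (toEuclideanLin (zeeman α (B x)) (ψ x))).re := by
  have hD := memLp_diracGrad (α := α) hp.memLp_grad
  have hG := memLp_gradNorm hp.memLp_grad
  have hi : ∀ j k, Integrable fun x => inner ℂ (g j x) (toEuclideanLin (α j * α k) (g k x))
      - inner ℂ (g k x) (toEuclideanLin (α j * α k) (g j x)) := fun j k =>
    (integrable_inner_of_memLp (hp.memLp_grad j) (memLp_toEuclideanLin _ (hp.memLp_grad k))).sub'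
      (integrable_inner_of_memLp (hp.memLp_grad k) (memLp_toEuclideanLin _ (hp.memLp_grad j)))
  have hGi : Integrable fun x => 2 * ((gradNorm g x ^ 2 : ℝ) : ℂ) := by
    refine Integrable.const_mul (Integrable.ofReal ?_) 2
    exact hG.integrable_sq
  have key : 2 * ∫ x, inner ℂ (diracGrad α g x) (diracGrad α g x)
      = 2 * ((l2norm volume (gradNorm g) ^ 2 : ℝ) : ℂ)
        + Complex.I * ∫ x, inner ℂ (ψ x) (toEuclideanLin (zeeman α (B x)) (ψ x)) := by
    rw [← integral_const_mul]
    simp only [hαβ.two_mul_inner_diracGrad]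
    rw [integral_add hGi (integrable_finsetSum₂ hi), integral_finsetSum₂ hi, integral_const_mul,
      integral_complex_ofReal, sq_l2norm]
    simp only [hp.integral_commutator_eq hd hB hBψ, inner_zeeman, integral_const_mul]
    rw [integral_finsetSum₂ fun j k => hp.integrable_field hd hB hBψ _ j k, Finset.mul_sum]
    simp only [Finset.mul_sum, Real.norm_eq_abs, sq_abs]
  have hT : ∫ x, inner ℂ (diracGrad α g x) (diracGrad α g x)
      = ((l2norm volume (diracGrad α g) ^ 2 : ℝ) : ℂ) := by
    rw [sq_l2norm, ← integral_complex_ofReal]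
    refine integral_congr_ae (ae_of_all _ fun x => ?_)
    simp [inner_self_eq_norm_sq_to_K]
  rw [hT] at key
  have := congrArg Complex.re key
  rw [show Complex.I / 2 * ∫ x, inner ℂ (ψ x) (toEuclideanLin (zeeman α (B x)) (ψ x))
    = ((1 / 2 : ℝ) : ℂ) * (Complex.I * ∫ x, inner ℂ (ψ x) (toEuclideanLin (zeeman α (B x)) (ψ x))) by
      push_cast; ring, Complex.re_ofReal_mul]
  rw [Complex.add_re, show (2 : ℂ) = ((2 : ℝ) : ℂ) by norm_num, Complex.re_ofReal_mul,
    Complex.re_ofReal_mul, Complex.ofReal_re, Complex.ofReal_re] at this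
  linarith

end Identities

end MagneticDirac

namespace MagneticDirac

open Filter Topology
open Matrix (toEuclideanLin)

/-! ### The virial identity -/

section Virial

variable {d N : ℕ} {α : Fin d → Matrix (Fin N) (Fin N) ℂ} {β : Matrix (Fin N) (Fin N) ℂ}
  {B : Space d → Matrix (Fin d) (Fin d) ℝ} {ψ : Space d → Spinor N}
  {g : Fin d → Space d → Spinor N} {W : Space d → Matrix (Fin N) (Fin N) ℂ}

theorem fderiv_apply_eq_sum {F : Type*} [NormedAddCommGroup F] [NormedSpace ℝ F]
    (f : Space d → F) (x v : Space d) : fderiv ℝ f x v = ∑ k, v k • pderiv k f x := by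
  conv_lhs => rw [← (EuclideanSpace.basisFun (Fin d) ℝ).sum_repr v]
  simp [pderiv]

theorem norm_pderiv_le {F : Type*} [NormedAddCommGroup F] [NormedSpace ℝ F] (k : Fin d)
    (f : Space d → F) (x : Space d) : ‖pderiv k f x‖ ≤ ‖fderiv ℝ f x‖ := by
  simpa using! (fderiv ℝ f x).le_opNorm (EuclideanSpace.single k 1)

theorem pderiv_coord (j k : Fin d) (x : Space d) :
    pderiv j (fun x : Space d => x k) x = if j = k then 1 else 0 := by
  have h : HasFDerivAt (fun x : Space d => x k) (EuclideanSpace.proj (𝕜 := ℝ) k) x :=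
    (EuclideanSpace.proj (𝕜 := ℝ) k).hasFDerivAt
  rw [pderiv, h.fderiv]
  simp [eq_comm]

theorem pderiv_coord_smul (k : Fin d) {x : Space d} (hW : DifferentiableAt ℝ W x) :
    pderiv k (fun x => x k • W x) x = W x + x k • pderiv k W x := by
  have h₁ : HasFDerivAt (fun x : Space d => x k) (EuclideanSpace.proj (𝕜 := ℝ) k) x :=
    (EuclideanSpace.proj (𝕜 := ℝ) k).hasFDerivAt
  have h : HasFDerivAt (fun x => x k • W x) _ x := h₁.smul hW.hasFDerivAt
  rw [pderiv, h.fderiv, add_comm]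
  simp [pderiv]

theorem clifford_field_apply (M : Matrix (Fin d) (Fin d) ℝ) (x : Space d) (u v : Spinor N) :
    inner ℂ u (toEuclideanLin (clifford α (toEuclideanLin M x)) v)
      = ∑ j, ∑ k, ((x k * M j k : ℝ) : ℂ) * inner ℂ u (toEuclideanLin (α j) v) := by
  rw [clifford_toEuclideanLin, inner_sum]
  refine Finset.sum_congr rfl fun j _ => ?_
  rw [inner_smul_right, ← Finset.sum_mul, Matrix.toLpLin_apply]
  congr 1
  simp only [Matrix.mulVec, dotProduct]
  push_cast
  exact Finset.sum_congr rfl fun k _ => mul_comm _ _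

theorem aestronglyMeasurable_fderiv (hd : 0 < d) (hW : ContDiffOn ℝ ∞ W {0}ᶜ) :
    AEStronglyMeasurable (fderiv ℝ W) volume :=
  aestronglyMeasurable_of_continuousOn_compl hd
    (hW.continuousOn_fderiv_of_isOpen isOpen_compl_singleton (by simp))

theorem differentiableAt_of_contDiffOn_compl (hW : ContDiffOn ℝ ∞ W {0}ᶜ) {x : Space d}
    (hx : x ≠ 0) : DifferentiableAt ℝ W x :=
  ((hW x hx).contDiffAt (isOpen_compl_singleton.mem_nhds hx)).differentiableAt (by simp)

/-- A virial identity for solutions of `-i α · ∇_A ψ = W ψ`. -/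
theorem IsMagneticPair.virial (hp : IsMagneticPair B ψ g) (hd : 3 ≤ d)
    (hαβ : IsDiracMatrices α β) (hB : AEStronglyMeasurable B volume)
    (hBψ : MemLp (fun x => (‖x‖ * ‖B x‖) • ψ x) 2 volume) (hW : ContDiffOn ℝ ∞ W {0}ᶜ)
    (hWh : ∀ᵐ x, (W x).IsHermitian) (hDW : ∀ᵐ x, diracGrad α g x = toEuclideanLin (W x) (ψ x))
    (hWψ : MemLp (fun x => (‖x‖ * ‖fderiv ℝ W x‖) • ψ x) 2 volume) :
    ∫ x, inner ℂ (ψ x) (diracGrad α g x)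
      = -(∫ x, inner ℂ (ψ x) (toEuclideanLin (fderiv ℝ W x x) (ψ x)))
        + ∫ x, inner ℂ (ψ x) (toEuclideanLin (clifford α (toEuclideanLin (B x) x)) (ψ x)) := by
  have hd0 : 0 < d := by omega
  -- The integral of θ_n x_k(⟨Dψ, g_k⟩ + ⟨g_k, Dψ⟩) is evaluated in two ways: expanding D gives
  -- commutators, while Dψ = Wψ allows integration by parts. Cutoffs are needed because x_k|g|² need
  -- not be integrable; both limits nevertheless exist, and comparing them gives the identity.
  obtain ⟨θ, C, hθ⟩ := exists_isCutoffSeq d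
  have hD := memLp_diracGrad (α := α) hp.memLp_grad
  have hcX : ∀ k : Fin d, ContDiff ℝ ∞ fun x : Space d => x k := fun k =>
    (EuclideanSpace.proj (𝕜 := ℝ) k).contDiff
  have hψD := integrable_inner_of_memLp hp.memLp hD
  -- the limit of the commutators
  have hi₁ : ∀ j k : Fin d, Integrable fun x : Space d =>
      -(((pderiv j (fun x : Space d => x k) x : ℝ) : ℂ)
          * inner ℂ (ψ x) (toEuclideanLin (α j) (g k x)))
        + ((pderiv k (fun x : Space d => x k) x : ℝ) : ℂ)
          * inner ℂ (ψ x) (toEuclideanLin (α j) (g j x))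
        + Complex.I * ((x k * B x j k : ℝ) * inner ℂ (ψ x) (toEuclideanLin (α j) (ψ x))) := by
    intro j k
    simp only [pderiv_coord]
    exact (((hp.integrable_inner_grad _ _).const_mul _).fun_neg.fun_add
      ((hp.integrable_inner_grad _ _).const_mul _)).fun_add
      ((hp.integrable_coord_field hB hBψ _ _ _ _).const_mul _)
  have t₁ := fun j k => hp.tendsto_commutator hθ hd0 j k (α j) (hcX k) (fun i => by
    refine (((integrable_norm_mul_norm hp.memLp (hp.memLp_grad i)).const_mul ‖α j‖).mono' ?_ ?_)
    · refine continuous_norm.aestronglyMeasurable.aemeasurable.inv.aestronglyMeasurable.mul ?_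
      exact ((Complex.continuous_ofReal.comp (hcX k).continuous).aestronglyMeasurable.mul
        (hp.integrable_inner_grad _ _).1).norm
    · filter_upwards [ae_ne_zero hd0] with x hx
      have hx' := norm_pos_iff.2 hx
      rw [norm_mul, norm_inv, norm_norm, norm_norm, norm_mul, Complex.norm_real, Real.norm_eq_abs,
        ← mul_assoc]
      refine (mul_le_of_le_one_left (norm_nonneg _) ?_).trans (norm_inner_toEuclideanLin_le _ _ _)
      rw [inv_mul_eq_div]
      exact div_le_one_of_le₀ (abs_coord_le x k) hx'.le) (hi₁ j k)
  -- the limit of the integrations by parts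
  have hpd : ∀ k : Fin d, ∀ᵐ x : Space d,
      inner ℂ (ψ x) (toEuclideanLin (pderiv k (fun x => x k • W x) x) (ψ x))
        = inner ℂ (ψ x) (diracGrad α g x)
          + (x k : ℂ) * inner ℂ (ψ x) (toEuclideanLin (pderiv k W x) (ψ x)) := by
    intro k
    filter_upwards [ae_ne_zero hd0, hDW] with x hx h
    rw [pderiv_coord_smul k (differentiableAt_of_contDiffOn_compl hW hx), map_add,
      LinearMap.add_apply, inner_add_right, h, toEuclideanLin_real_smul, inner_smul_right]
  have hi₂ : ∀ k : Fin d, Integrable fun x : Space d =>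
      (x k : ℂ) * inner ℂ (ψ x) (toEuclideanLin (pderiv k W x) (ψ x)) := by
    intro k
    refine (integrable_norm_mul_norm hWψ hp.memLp).mono' ?_ (ae_of_all _ fun x => ?_)
    · refine (Complex.continuous_ofReal.comp (hcX k).continuous).aestronglyMeasurable.mul
        (hp.memLp.1.inner ((matrixAction N).aestronglyMeasurable_comp₂ ?_ hp.memLp.1))
      exact (ContinuousLinearMap.apply ℝ _ (EuclideanSpace.single k (1 : ℝ))).continuous
        |>.comp_aestronglyMeasurable (aestronglyMeasurable_fderiv hd0 hW)
    · rw [norm_mul, Complex.norm_real, norm_smul, norm_mul, norm_norm, norm_norm, Real.norm_eq_abs]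
      calc |x k| * ‖(inner ℂ (ψ x) (toEuclideanLin (pderiv k W x) (ψ x)) : ℂ)‖
          ≤ ‖x‖ * (‖fderiv ℝ W x‖ * (‖ψ x‖ * ‖ψ x‖)) := by
            gcongr
            · exact abs_coord_le x k
            · refine (norm_inner_toEuclideanLin_le _ _ _).trans ?_
              gcongr
              exact norm_pderiv_le k W x
        _ = _ := by ring
  have t₂ := fun k => hp.tendsto_integral_form hθ hd0 k (Q := fun x => x k • W x)
    ((hcX k).contDiffOn.smul hW) (by
      refine (integrable_norm_mul_norm hp.memLp hD).mono' ?_ ?_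
      · refine continuous_norm.aestronglyMeasurable.aemeasurable.inv.aestronglyMeasurable.mul ?_
        refine (hp.memLp.1.inner ((matrixAction N).aestronglyMeasurable_comp₂ ?_ hp.memLp.1)).norm
        exact (hcX k).continuous.aestronglyMeasurable.smul
          (aestronglyMeasurable_of_continuousOn_compl hd0 hW.continuousOn)
      · filter_upwards [ae_ne_zero hd0, hDW] with x hx h
        have hx' := norm_pos_iff.2 hx
        rw [toEuclideanLin_real_smul, inner_smul_right, norm_mul, norm_inv, norm_norm, norm_norm,
          norm_mul, Complex.norm_real, Real.norm_eq_abs, ← mul_assoc, h]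
        refine (mul_le_of_le_one_left (norm_nonneg _) ?_).trans (norm_inner_le_norm _ _)
        rw [inv_mul_eq_div]
        exact div_le_one_of_le₀ (abs_coord_le x k) hx'.le)
    ((hψD.add (hi₂ k)).congr ((hpd k).mono fun x hx => hx.symm))
  -- both sequences agree
  have hlim : ∀ k : Fin d, ∑ j, Complex.I * ∫ x : Space d,
      (-(((pderiv j (fun x : Space d => x k) x : ℝ) : ℂ)
          * inner ℂ (ψ x) (toEuclideanLin (α j) (g k x)))
        + ((pderiv k (fun x : Space d => x k) x : ℝ) : ℂ)
          * inner ℂ (ψ x) (toEuclideanLin (α j) (g j x))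
        + Complex.I * ((x k * B x j k : ℝ) * inner ℂ (ψ x) (toEuclideanLin (α j) (ψ x))))
      = -∫ x, inner ℂ (ψ x) (toEuclideanLin (pderiv k (fun x => x k • W x) x) (ψ x)) := by
    intro k
    refine tendsto_nhds_unique (tendsto_finsetSum _ fun j _ => (t₁ j k).const_mul Complex.I)
      ((t₂ k).congr fun n => ?_)
    have cw : Continuous fun x => θ n x * x k := (hθ.contDiff n).continuous.mul (hcX k).continuous
    have sw : HasCompactSupport fun x => θ n x * x k := (hθ.hasCompactSupport n).mul_right
    have i₁ : ∀ j, Integrable fun x => (θ n x : ℂ) * ((x k : ℂ) *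
        (inner ℂ (g j x) (toEuclideanLin (α j) (g k x))
          - inner ℂ (g k x) (toEuclideanLin (α j) (g j x)))) := by
      intro j
      have a₁ := integrable_weight_inner (α j) (hp.memLp_grad j)
        (memLp_weight_smul cw sw (hp.memLp_grad k))
      have a₂ := integrable_weight_inner (α j) (hp.memLp_grad k)
        (memLp_weight_smul cw sw (hp.memLp_grad j))
      refine (a₁.sub' a₂).congr (ae_of_all _ fun x => ?_)
      simp only []
      push_cast
      ring
    simp only [← integral_const_mul]
    rw [← integral_finsetSum _ fun j _ => (i₁ j).const_mul _]
    refine integral_congr_ae ?_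
    filter_upwards [hWh, hDW] with x hx h
    -- Hermiticity of `W` moves it onto ψ, where it is again Dψ; this identifies the two sequences
    -- at finite n.
    have h₁ : inner ℂ (ψ x) (toEuclideanLin (W x) (g k x)) = inner ℂ (diracGrad α g x) (g k x) := by
      rw [h, hx.inner_toEuclideanLin]
    rw [toEuclideanLin_real_smul, toEuclideanLin_real_smul, inner_smul_right, inner_smul_right, h₁,
      ← h]
    simp only [diracGrad, inner_smul_left, inner_smul_right, sum_inner, inner_sum,
      (hαβ.alpha_hermitian _).inner_toEuclideanLin, map_neg, Complex.conj_I, neg_neg]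
    rw [Finset.mul_sum, Finset.mul_sum, Finset.mul_sum, Finset.mul_sum, ← Finset.sum_add_distrib,
      Finset.mul_sum]
    refine Finset.sum_congr rfl fun j _ => ?_
    ring
  have hsum := Finset.sum_congr rfl fun k (_ : k ∈ Finset.univ) => hlim k
  -- Since ∂_j x_k = δ_jk, the sum over all pairs contributes -d⟨ψ, Dψ⟩ and the diagonal returns one
  -- copy, whence the factor d - 1.
  have hL : ∑ k : Fin d, ∑ j, Complex.I * ∫ x : Space d,
      (-(((pderiv j (fun x : Space d => x k) x : ℝ) : ℂ)
          * inner ℂ (ψ x) (toEuclideanLin (α j) (g k x)))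
        + ((pderiv k (fun x : Space d => x k) x : ℝ) : ℂ)
          * inner ℂ (ψ x) (toEuclideanLin (α j) (g j x))
        + Complex.I * ((x k * B x j k : ℝ) * inner ℂ (ψ x) (toEuclideanLin (α j) (ψ x))))
      = -(((d : ℂ) - 1) * ∫ x, inner ℂ (ψ x) (diracGrad α g x))
        - ∫ x, inner ℂ (ψ x) (toEuclideanLin (clifford α (toEuclideanLin (B x) x)) (ψ x)) := by
    rw [Finset.sum_comm]
    have hB₁ := integrable_finsetSum₂ fun j k =>
      hp.integrable_coord_field hB hBψ (α j) k j k
    simp only [← clifford_field_apply] at hB₁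
    simp only [← integral_const_mul]
    rw [← integral_finsetSum₂ fun j k => (hi₁ j k).const_mul Complex.I, ← integral_neg,
      ← integral_sub ((hψD.const_mul _).fun_neg) hB₁]
    refine integral_congr_ae (ae_of_all _ fun x => ?_)
    simp only [pderiv_coord, clifford_field_apply, diracGrad, inner_smul_right, inner_sum]
    trans ∑ j, ∑ k, ((if j = k then -(Complex.I * inner ℂ (ψ x) (toEuclideanLin (α j) (g j x)))
      else 0) + (Complex.I * inner ℂ (ψ x) (toEuclideanLin (α j) (g j x))
        - ((x k * B x j k : ℝ) : ℂ) * inner ℂ (ψ x) (toEuclideanLin (α j) (ψ x))))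
    · refine Finset.sum_congr rfl fun j _ => Finset.sum_congr rfl fun k _ => ?_
      simp only [if_true]
      split_ifs with h
      · subst h
        push_cast
        linear_combination (x j * B x j j * inner ℂ (ψ x) (toEuclideanLin (α j) (ψ x)))
          * Complex.I_mul_I
      · push_cast
        linear_combination (x k * B x j k * inner ℂ (ψ x) (toEuclideanLin (α j) (ψ x)))
          * Complex.I_mul_I
    · simp only [Finset.sum_add_distrib, Finset.sum_sub_distrib, Finset.sum_ite_eq,
        Finset.mem_univ, if_true, Finset.sum_const, Finset.card_univ, Fintype.card_fin,
        nsmul_eq_mul, ← Finset.mul_sum, Finset.sum_neg_distrib]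
      ring
  -- Here the divergence of x gives the factor d, one more than on the commutator side. This surplus
  -- is the term ⟨ψ, Dψ⟩ that survives in the result.
  have hR : ∑ k : Fin d, -∫ x, inner ℂ (ψ x)
        (toEuclideanLin (pderiv k (fun x => x k • W x) x) (ψ x))
      = -((d : ℂ) * ∫ x, inner ℂ (ψ x) (diracGrad α g x))
        - ∫ x, inner ℂ (ψ x) (toEuclideanLin (fderiv ℝ W x x) (ψ x)) := by
    have e : ∀ k : Fin d, ∫ x, inner ℂ (ψ x)
        (toEuclideanLin (pderiv k (fun x => x k • W x) x) (ψ x))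
        = (∫ x, inner ℂ (ψ x) (diracGrad α g x))
          + ∫ x : Space d, (x k : ℂ) * inner ℂ (ψ x) (toEuclideanLin (pderiv k W x) (ψ x)) :=
      fun k => by rw [integral_congr_ae (hpd k), integral_add hψD (hi₂ k)]
    simp only [e]
    rw [Finset.sum_neg_distrib, Finset.sum_add_distrib, Finset.sum_const, Finset.card_univ,
      Fintype.card_fin, nsmul_eq_mul, ← integral_finsetSum _ fun k _ => hi₂ k, neg_add,
      sub_eq_add_neg]
    congr 3
    funext x
    simp only [fderiv_apply_eq_sum W x x, map_sum, LinearMap.sum_apply, inner_sum,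
      toEuclideanLin_real_smul, inner_smul_right]
  rw [hL, hR] at hsum
  linear_combination hsum

end Virial

end MagneticDirac

namespace MagneticDirac

open Filter Topology
open Matrix (toEuclideanLin)

/-! ### Consequences for eigenfunctions -/

section Eigenfunction

variable {d N : ℕ} {α : Fin d → Matrix (Fin N) (Fin N) ℂ} {β : Matrix (Fin N) (Fin N) ℂ} {m : ℝ}
  {B : Space d → Matrix (Fin d) (Fin d) ℝ} {ψ : Space d → Spinor N}
  {g : Fin d → Space d → Spinor N} {V : Space d → Matrix (Fin N) (Fin N) ℂ} {z : ℂ}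

theorem IsDiracMatrices.norm_beta_apply (hαβ : IsDiracMatrices α β) (v : Spinor N) :
    ‖toEuclideanLin β v‖ = ‖v‖ := by
  have h : ‖toEuclideanLin β v‖ ^ 2 = ‖v‖ ^ 2 := by
    rw [← inner_self_eq_norm_sq (𝕜 := ℂ), hαβ.beta_hermitian.inner_toEuclideanLin,
      ← toEuclideanLin_mul_apply, hαβ.beta_sq, toEuclideanLin_one_apply, inner_self_eq_norm_sq]
  exact (sq_eq_sq₀ (norm_nonneg _) (norm_nonneg _)).1 h

/-- β and c(u) are Hermitian and anticommute, so their product is anti-Hermitian. This removes the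
mass-field cross term from the virial estimate. -/
theorem IsDiracMatrices.re_inner_beta_clifford (hαβ : IsDiracMatrices α β) (u : Space d)
    (v : Spinor N) :
    (inner ℂ (toEuclideanLin β v) (toEuclideanLin (clifford α u) v) : ℂ).re = 0 := by
  have h : (inner ℂ (toEuclideanLin β v) (toEuclideanLin (clifford α u) v) : ℂ)
      = -inner ℂ (toEuclideanLin (clifford α u) v) (toEuclideanLin β v) := by
    rw [hαβ.beta_hermitian.inner_toEuclideanLin, (hαβ.clifford_hermitian u).inner_toEuclideanLin,
      ← toEuclideanLin_mul_apply, ← toEuclideanLin_mul_apply, hαβ.clifford_beta_anticomm, map_neg,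
      LinearMap.neg_apply, inner_neg_right, neg_neg]
  rw [← inner_conj_symm] at h
  have := congrArg Complex.re h
  rw [Complex.conj_re, Complex.neg_re] at this
  have e : (inner ℂ (toEuclideanLin β v) (toEuclideanLin (clifford α u) v) : ℂ).re
      = (inner ℂ (toEuclideanLin (clifford α u) v) (toEuclideanLin β v) : ℂ).re := by
    rw [← inner_conj_symm, Complex.conj_re]
  linarith

theorem norm_clifford_field_le (hαβ : IsDiracMatrices α β) (M : Matrix (Fin d) (Fin d) ℝ)
    (x : Space d) (v : Spinor N) :
    ‖toEuclideanLin (clifford α (toEuclideanLin M x)) v‖ ≤ ‖(‖x‖ * ‖M‖) • v‖ := by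
  rw [hαβ.norm_clifford_apply, norm_smul, norm_mul, norm_norm, norm_norm, mul_comm ‖x‖]
  gcongr
  exact norm_toEuclideanLin_le M x

theorem norm_fderiv_self_apply_le (x : Space d) (v : Spinor N) :
    ‖toEuclideanLin (fderiv ℝ V x x) v‖ ≤ ‖(‖x‖ * ‖fderiv ℝ V x‖) • v‖ := by
  refine (norm_toEuclideanLin_le _ _).trans ?_
  rw [norm_smul, norm_mul, norm_norm, norm_norm, mul_comm ‖x‖]
  gcongr
  exact (fderiv ℝ V x).le_opNorm x

theorem memLp_clifford_field (hαβ : IsDiracMatrices α β) (hB : AEStronglyMeasurable B volume)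
    (hψ : AEStronglyMeasurable ψ volume) (hBψ : MemLp (fun x => (‖x‖ * ‖B x‖) • ψ x) 2 volume) :
    MemLp (fun x => toEuclideanLin (clifford α (toEuclideanLin (B x) x)) (ψ x)) 2 volume := by
  refine hBψ.of_le ?_ (ae_of_all _ fun x => norm_clifford_field_le hαβ _ _ _)
  refine (matrixAction N).aestronglyMeasurable_comp₂ ?_ hψ
  refine (LinearMap.continuous_of_finiteDimensional (clifford α)).comp_aestronglyMeasurable ?_
  have h : ∀ M : Matrix (Fin d) (Fin d) ℝ, ∀ x : Space d, toEuclideanLin M x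
      = ∑ j, ∑ k, (M j k * x k) • EuclideanSpace.single j (1 : ℝ) := fun M x => by
    ext i
    simp only [← Finset.sum_smul, Matrix.toLpLin_apply, Matrix.mulVec, dotProduct, WithLp.ofLp_sum,
      Finset.sum_apply, PiLp.smul_apply, PiLp.single_apply, smul_eq_mul, mul_ite, mul_one, mul_zero,
      Finset.sum_ite_eq, Finset.mem_univ, if_true]
  simp only [h]
  refine Finset.aestronglyMeasurable_fun_sum _ fun j _ =>
    Finset.aestronglyMeasurable_fun_sum _ fun k _ => AEStronglyMeasurable.smul_const
      ((aestronglyMeasurable_entry hB j k).mul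
        (EuclideanSpace.proj (𝕜 := ℝ) k).continuous.aestronglyMeasurable) _

theorem memLp_fderiv_self (hd : 0 < d) (hV : ContDiffOn ℝ ∞ V {0}ᶜ)
    (hψ : AEStronglyMeasurable ψ volume)
    (hVψ : MemLp (fun x => (‖x‖ * ‖fderiv ℝ V x‖) • ψ x) 2 volume) :
    MemLp (fun x => toEuclideanLin (fderiv ℝ V x x) (ψ x)) 2 volume := by
  refine hVψ.of_le ?_ (ae_of_all _ fun x => norm_fderiv_self_apply_le _ _)
  refine (matrixAction N).aestronglyMeasurable_comp₂ ?_ hψ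
  exact (ContinuousLinearMap.apply ℝ (Matrix (Fin N) (Fin N) ℂ)).flip.aestronglyMeasurable_comp₂
    (aestronglyMeasurable_fderiv hd hV) aestronglyMeasurable_id

/-- The electric term is controlled by Hardy's inequality. -/
theorem IsMagneticPair.memLp_electric (hp : IsMagneticPair B ψ g) (hd : 3 ≤ d)
    (hV : ContDiffOn ℝ ∞ V {0}ᶜ) {ε : ℝ} (hε : ∀ x, ‖x‖ * ‖V x‖ ≤ ε) :
    MemLp (fun x => toEuclideanLin (V x) (ψ x)) 2 volume ∧
      l2norm volume (fun x => toEuclideanLin (V x) (ψ x))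
        ≤ ε * l2norm volume (fun x => ‖x‖⁻¹ * ‖ψ x‖) := by
  have hd0 : 0 < d := by omega
  have hε0 : 0 ≤ ε := le_trans (by positivity) (hε 0)
  have hle : ∀ᵐ x, ‖toEuclideanLin (V x) (ψ x)‖ ≤ ε * ‖‖x‖⁻¹ * ‖ψ x‖‖ := by
    filter_upwards [ae_ne_zero hd0] with x hx
    have hx' := norm_pos_iff.2 hx
    refine (norm_toEuclideanLin_le _ _).trans ?_
    rw [norm_mul, norm_inv, norm_norm, norm_norm, ← mul_assoc, ← div_eq_mul_inv]
    gcongr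
    rw [le_div_iff₀ hx', mul_comm]
    exact hε x
  refine ⟨(hp.hardy hd).1.of_le_mul ?_ hle, l2norm_le_mul (hp.hardy hd).1 hε0 hle⟩
  exact (matrixAction N).aestronglyMeasurable_comp₂
    (aestronglyMeasurable_of_continuousOn_compl hd0 hV.continuousOn) hp.memLp.1

theorem im_integral_eq_zero {f : Space d → ℂ} (h : ∀ᵐ x, (f x).im = 0) : (∫ x, f x).im = 0 := by
  have : ∫ x, f x = ((∫ x, (f x).re : ℝ) : ℂ) := by
    rw [← integral_complex_ofReal]
    refine integral_congr_ae (h.mono fun x hx => Complex.ext (by simp) (by simp [hx]))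
  rw [this, Complex.ofReal_im]

/-- Eigenvalues are real. -/
theorem IsMagneticPair.im_eigenvalue (hp : IsMagneticPair B ψ g) (hd : 3 ≤ d)
    (hαβ : IsDiracMatrices α β) (hVh : ∀ᵐ x, (V x).IsHermitian)
    (hVψ : MemLp (fun x => toEuclideanLin (V x) (ψ x)) 2 volume)
    (hz : ∀ᵐ x, diracGrad α g x + (m : ℂ) • toEuclideanLin β (ψ x) + toEuclideanLin (V x) (ψ x)
      = z • ψ x) (hψ : l2norm volume ψ ≠ 0) : z.im = 0 := by
  have hD := memLp_diracGrad (α := α) hp.memLp_grad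
  have hβ := memLp_toEuclideanLin β hp.memLp
  have e : z * ((l2norm volume ψ ^ 2 : ℝ) : ℂ) = (∫ x, inner ℂ (ψ x) (diracGrad α g x))
      + (m : ℂ) * (∫ x, inner ℂ (ψ x) (toEuclideanLin β (ψ x)))
      + ∫ x, inner ℂ (ψ x) (toEuclideanLin (V x) (ψ x)) := by
    have i₁ := integrable_inner_of_memLp hp.memLp hD
    have i₂ := (integrable_inner_of_memLp hp.memLp hβ).const_mul (m : ℂ)
    have i₃ := integrable_inner_of_memLp hp.memLp hVψ
    rw [← integral_const_mul, ← integral_add i₁ i₂, ← integral_add (i₁.fun_add i₂) i₃, sq_l2norm,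
      ← integral_complex_ofReal, ← integral_const_mul]
    refine integral_congr_ae (hz.mono fun x hx => ?_)
    simp only []
    rw [← inner_smul_right, ← inner_add_right, ← inner_add_right, hx, inner_smul_right,
      inner_self_eq_norm_sq_to_K]
    simp
  have h := congrArg Complex.im e
  rw [Complex.im_mul_ofReal, Complex.add_im, Complex.add_im, Complex.im_ofReal_mul,
    hp.im_integral_diracGrad hd hαβ,
    im_integral_eq_zero (ae_of_all _ fun x => hαβ.beta_hermitian.inner_toEuclideanLin_self_im _),
    im_integral_eq_zero (hVh.mono fun x hx => hx.inner_toEuclideanLin_self_im _)] at h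
  simpa [hψ] using h

/-- The virial identity for an eigenfunction, as an estimate of the kinetic energy. -/
theorem IsMagneticPair.virial_estimate (hp : IsMagneticPair B ψ g) (hd : 3 ≤ d)
    (hαβ : IsDiracMatrices α β) (hm : 0 ≤ m) (hB : AEStronglyMeasurable B volume)
    (hBψ : MemLp (fun x => (‖x‖ * ‖B x‖) • ψ x) 2 volume) (hV : ContDiffOn ℝ ∞ V {0}ᶜ)
    (hVh : ∀ᵐ x, (V x).IsHermitian)
    (hVψ : MemLp (fun x => toEuclideanLin (V x) (ψ x)) 2 volume)
    (hV'ψ : MemLp (fun x => (‖x‖ * ‖fderiv ℝ V x‖) • ψ x) 2 volume)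
    (hz : ∀ᵐ x, diracGrad α g x + (m : ℂ) • toEuclideanLin β (ψ x) + toEuclideanLin (V x) (ψ x)
      = z • ψ x) (hψ : l2norm volume ψ ≠ 0) :
    l2norm volume (diracGrad α g) ^ 2
      ≤ (∫ x, inner ℂ (diracGrad α g x)
          (toEuclideanLin (clifford α (toEuclideanLin (B x) x)) (ψ x))).re
        + l2norm volume (fun x => toEuclideanLin (V x) (ψ x)) * l2norm volume (diracGrad α g)
        + l2norm volume (fun x => toEuclideanLin (V x) (ψ x))
          * l2norm volume (fun x => (‖x‖ * ‖B x‖) • ψ x)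
        + l2norm volume (diracGrad α g) * l2norm volume (fun x => (‖x‖ * ‖fderiv ℝ V x‖) • ψ x)
        + m * (∫ x, ‖x‖ * ‖fderiv ℝ V x‖ * ‖ψ x‖ ^ 2)
        + l2norm volume (fun x => toEuclideanLin (V x) (ψ x))
          * l2norm volume (fun x => (‖x‖ * ‖fderiv ℝ V x‖) • ψ x) := by
  have hd0 : 0 < d := by omega
  have hD := memLp_diracGrad (α := α) hp.memLp_grad
  have hβ := memLp_toEuclideanLin β hp.memLp
  have hc := memLp_clifford_field hαβ hB hp.memLp.1 hBψ
  have hf := memLp_fderiv_self hd0 hV hp.memLp.1 hV'ψ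
  have hzim := hp.im_eigenvalue hd hαβ hVh hVψ hz hψ
  obtain ⟨e, rfl⟩ : ∃ e : ℝ, z = (e : ℂ) := ⟨z.re, Complex.ext (by simp) (by simp [hzim])⟩
  -- The eigenvalue equation reads Dψ = Wψ. Reality of the eigenvalue makes `W` Hermitian, and its
  -- gradient is that of -V.
  set W : Space d → Matrix (Fin N) (Fin N) ℂ := fun x => ((e : ℂ) • 1 - (m : ℂ) • β) - V x with hWdef
  have hfd : ∀ x, fderiv ℝ W x = -fderiv ℝ V x := fun x => by
    rw [hWdef, fderiv_const_sub]
  have hDW : ∀ᵐ x, diracGrad α g x = toEuclideanLin (W x) (ψ x) := by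
    filter_upwards [hz] with x hx
    simp only [hWdef, map_sub, LinearMap.sub_apply, map_smul, LinearMap.smul_apply,
      toEuclideanLin_one_apply, ← hx]
    abel
  have hWh : ∀ᵐ x, (W x).IsHermitian := by
    filter_upwards [hVh] with x hx
    rw [Matrix.IsHermitian]
    simp only [hWdef, Matrix.conjTranspose_sub, Matrix.conjTranspose_smul, hx.eq,
      hαβ.beta_hermitian.eq, Matrix.conjTranspose_one]
    simp
  have vir := hp.virial hd hαβ hB hBψ (contDiffOn_const.sub hV) hWh hDW (by
    have : (fun x => (‖x‖ * ‖fderiv ℝ W x‖) • ψ x) = fun x => (‖x‖ * ‖fderiv ℝ V x‖) • ψ x := by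
      funext x
      rw [hfd, norm_neg]
    rw [← hWdef, this]
    exact hV'ψ)
  simp only [← hWdef, hfd, neg_apply, map_neg, LinearMap.neg_apply,
    inner_neg_right, integral_neg, neg_neg] at vir
  -- Multiplication by the eigenvalue is traded for Dψ + mβψ + Vψ in the left slot, so the
  -- eigenvalue itself leaves the estimate.
  have split : ∀ {f : Space d → Spinor N}, MemLp f 2 volume →
      (e : ℂ) * ∫ x, inner ℂ (ψ x) (f x) = (∫ x, inner ℂ (diracGrad α g x) (f x))
        + (m : ℂ) * (∫ x, inner ℂ (toEuclideanLin β (ψ x)) (f x))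
        + ∫ x, inner ℂ (toEuclideanLin (V x) (ψ x)) (f x) := by
    intro f hf
    have i₁ := integrable_inner_of_memLp hD hf
    have i₂ := (integrable_inner_of_memLp hβ hf).const_mul (m : ℂ)
    have i₃ := integrable_inner_of_memLp hVψ hf
    rw [← integral_const_mul, ← integral_const_mul, ← integral_add i₁ i₂,
      ← integral_add (i₁.fun_add i₂) i₃]
    refine integral_congr_ae (hz.mono fun x hx => ?_)
    simp only []
    have h := congrArg (fun v => inner ℂ v (f x)) hx
    simp only [inner_add_left, inner_smul_left, Complex.conj_ofReal] at h
    exact h.symm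
  -- Of the three mass terms, those paired with Dψ and with c(Bx)ψ have zero real part; only the one
  -- paired with x·∇V survives.
  have key := congrArg (fun w : ℂ => ((e : ℂ) * w).re) vir
  simp only [mul_add] at key
  rw [split hD, split hf, split hc] at key
  simp only [Complex.add_re, Complex.re_ofReal_mul] at key
  rw [hp.re_integral_beta_diracGrad hd hαβ] at key
  have hβc : (∫ x, inner ℂ (toEuclideanLin β (ψ x))
      (toEuclideanLin (clifford α (toEuclideanLin (B x) x)) (ψ x))).re = 0 := by
    rw [← RCLike.re_eq_complex_re, ← integral_re (integrable_inner_of_memLp hβ hc)]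
    simp only [RCLike.re_eq_complex_re, hαβ.re_inner_beta_clifford, integral_zero]
  have hT : (∫ x, inner ℂ (diracGrad α g x) (diracGrad α g x)).re
      = l2norm volume (diracGrad α g) ^ 2 := by
    rw [sq_l2norm, ← RCLike.re_eq_complex_re, ← integral_re (integrable_inner_of_memLp hD hD)]
    simp only [inner_self_eq_norm_sq]
  rw [hβc, hT] at key
  have b₁ := (Complex.abs_re_le_norm _).trans (norm_integral_le_l2norm_mul hVψ hD (G := ℂ)
    (f := fun x => inner ℂ (toEuclideanLin (V x) (ψ x)) (diracGrad α g x))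
    (ae_of_all _ fun x => norm_inner_le_norm _ _))
  have b₂ := (Complex.abs_re_le_norm _).trans (norm_integral_le_l2norm_mul hVψ hBψ (G := ℂ)
    (f := fun x => inner ℂ (toEuclideanLin (V x) (ψ x))
      (toEuclideanLin (clifford α (toEuclideanLin (B x) x)) (ψ x)))
    (ae_of_all _ fun x => (norm_inner_le_norm _ _).trans
      (mul_le_mul_of_nonneg_left (norm_clifford_field_le hαβ _ _ _) (norm_nonneg _))))
  have b₃ := (Complex.abs_re_le_norm _).trans (norm_integral_le_l2norm_mul hD hV'ψ (G := ℂ)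
    (f := fun x => inner ℂ (diracGrad α g x) (toEuclideanLin (fderiv ℝ V x x) (ψ x)))
    (ae_of_all _ fun x => (norm_inner_le_norm _ _).trans
      (mul_le_mul_of_nonneg_left (norm_fderiv_self_apply_le _ _) (norm_nonneg _))))
  have b₄ := (Complex.abs_re_le_norm _).trans (norm_integral_le_l2norm_mul hVψ hV'ψ (G := ℂ)
    (f := fun x => inner ℂ (toEuclideanLin (V x) (ψ x)) (toEuclideanLin (fderiv ℝ V x x) (ψ x)))
    (ae_of_all _ fun x => (norm_inner_le_norm _ _).trans
      (mul_le_mul_of_nonneg_left (norm_fderiv_self_apply_le _ _) (norm_nonneg _))))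
  have b₅ : |(∫ x, inner ℂ (toEuclideanLin β (ψ x)) (toEuclideanLin (fderiv ℝ V x x) (ψ x))).re|
      ≤ ∫ x, ‖x‖ * ‖fderiv ℝ V x‖ * ‖ψ x‖ ^ 2 := by
    refine (Complex.abs_re_le_norm _).trans (norm_integral_le_of_norm_le ?_
      (ae_of_all _ fun x => ?_))
    · refine (integrable_norm_mul_norm hV'ψ hp.memLp).congr (ae_of_all _ fun x => ?_)
      simp only [norm_smul, norm_mul, norm_norm]
      ring
    · refine (norm_inner_le_norm _ _).trans ?_
      rw [hαβ.norm_beta_apply]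
      refine (mul_le_mul_of_nonneg_left (norm_fderiv_self_apply_le _ _) (norm_nonneg _)).trans_eq ?_
      rw [norm_smul, norm_mul, norm_norm, norm_norm]
      ring
  have b₅' := mul_le_mul_of_nonneg_left ((le_abs_self _).trans b₅) hm
  have := neg_le_of_abs_le b₁
  have := le_of_abs_le b₂
  have := le_of_abs_le b₃
  have := le_of_abs_le b₄
  linarith

end Eigenfunction

end MagneticDirac

namespace MagneticDirac

open Filter Topology
open Matrix (toEuclideanLin)

/-! ### Spin terms: odd dimension, even dimension and the shifted gradient -/

section Zeeman

variable {d N : ℕ} {α : Fin d → Matrix (Fin N) (Fin N) ℂ} {β : Matrix (Fin N) (Fin N) ℂ}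
  {B : Space d → Matrix (Fin d) (Fin d) ℝ} {ψ : Space d → Spinor N}
  {g : Fin d → Space d → Spinor N}

theorem IsMagneticPair.integrable_zeeman (hp : IsMagneticPair B ψ g) (hd : 3 ≤ d)
    (hB : AEStronglyMeasurable B volume)
    (hBψ : MemLp (fun x => (‖x‖ * ‖B x‖) • ψ x) 2 volume) :
    Integrable fun x => inner ℂ (ψ x) (toEuclideanLin (zeeman α (B x)) (ψ x)) := by
  simp only [inner_zeeman]
  exact integrable_finsetSum₂ fun j k => hp.integrable_field hd hB hBψ _ j k

theorem norm_mul_norm_eq (M : Matrix (Fin d) (Fin d) ℝ) (v : Spinor N) {x : Space d} (hx : x ≠ 0) :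
    ‖M‖ * (‖v‖ * ‖v‖) = ‖(‖x‖ * ‖M‖) • v‖ * ‖‖x‖⁻¹ * ‖v‖‖ := by
  have hx' : ‖x‖ ≠ 0 := norm_ne_zero_iff.2 hx
  simp only [norm_smul, norm_mul, norm_inv, norm_norm]
  field_simp

/-- The two terms are estimated separately. The factor d - 1 instead of d, due to the kernel of B,
combined with Hardy's constant 2/(d - 2), produces the coefficient 1 + 1/(d - 2). -/
theorem IsMagneticPair.re_clifford_sub_zeeman_le_of_odd (hp : IsMagneticPair B ψ g) (hd : 3 ≤ d)
    (hodd : Odd d) (hαβ : IsDiracMatrices α β) (hBs : ∀ᵐ x, (B x)ᵀ = -(B x))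
    (hBψ : MemLp (fun x => (‖x‖ * ‖B x‖) • ψ x) 2 volume) :
    (∫ x, inner ℂ (diracGrad α g x)
          (toEuclideanLin (clifford α (toEuclideanLin (B x) x)) (ψ x))).re
        - (Complex.I / 2 * ∫ x, inner ℂ (ψ x) (toEuclideanLin (zeeman α (B x)) (ψ x))).re
      ≤ l2norm volume (fun x => (‖x‖ * ‖B x‖) • ψ x) * (l2norm volume (diracGrad α g)
        + ((d : ℝ) - 1) / 2 * l2norm volume (fun x => ‖x‖⁻¹ * ‖ψ x‖)) := by
  have hd1 : (0 : ℝ) ≤ d - 1 := by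
    have : (3 : ℝ) ≤ d := by exact_mod_cast hd
    linarith
  have hY := (hp.hardy hd).1
  have b₁ := (Complex.abs_re_le_norm _).trans (norm_integral_le_l2norm_mul
    (memLp_diracGrad (α := α) hp.memLp_grad) hBψ (G := ℂ)
    (f := fun x => inner ℂ (diracGrad α g x)
      (toEuclideanLin (clifford α (toEuclideanLin (B x) x)) (ψ x)))
    (ae_of_all _ fun x => (norm_inner_le_norm _ _).trans
      (mul_le_mul_of_nonneg_left (norm_clifford_field_le hαβ _ _ _) (norm_nonneg _))))
  have b₂ : ‖∫ x, inner ℂ (ψ x) (toEuclideanLin (zeeman α (B x)) (ψ x))‖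
      ≤ ((d : ℝ) - 1) * (l2norm volume (fun x => (‖x‖ * ‖B x‖) • ψ x)
        * l2norm volume (fun x => ‖x‖⁻¹ * ‖ψ x‖)) := by
    have h := norm_integral_le_of_norm_le
      (f := fun x => inner ℂ (ψ x) (toEuclideanLin (zeeman α (B x)) (ψ x)))
      ((integrable_norm_mul_norm hBψ hY).const_mul ((d : ℝ) - 1)) (by
        filter_upwards [ae_ne_zero (d := d) (by omega), hBs] with x hx hs
        rw [← norm_mul_norm_eq (B x) (ψ x) hx]
        refine (norm_inner_le_norm (𝕜 := ℂ) _ _).trans ?_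
        have := mul_le_mul_of_nonneg_left (hαβ.norm_sum_le_of_odd hs hodd (ψ x)) (norm_nonneg (ψ x))
        rw [zeeman]
        linarith)
    rw [integral_const_mul] at h
    exact h.trans (mul_le_mul_of_nonneg_left (integral_norm_mul_norm_le hBψ hY) hd1)
  have b₃ := Complex.abs_re_le_norm
    (Complex.I / 2 * ∫ x, inner ℂ (ψ x) (toEuclideanLin (zeeman α (B x)) (ψ x)))
  rw [norm_mul, norm_div, Complex.norm_I, Complex.norm_two] at b₃
  have := le_of_abs_le b₁
  have := neg_le_of_abs_le b₃
  linarith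

/-- The Dirac gradient corrected by a radial term. -/
noncomputable def shiftedGrad (α : Fin d → Matrix (Fin N) (Fin N) ℂ)
    (g : Fin d → Space d → Spinor N) (ψ : Space d → Spinor N) (x : Space d) : Spinor N :=
  diracGrad α g x + (-Complex.I * (((‖x‖ ^ 2)⁻¹ : ℝ) : ℂ)) • toEuclideanLin (clifford α x) (ψ x)

theorem IsMagneticPair.memLp_shiftedGrad (hp : IsMagneticPair B ψ g) (hd : 3 ≤ d)
    (hαβ : IsDiracMatrices α β) : MemLp (shiftedGrad α g ψ) 2 volume := by
  refine (memLp_diracGrad hp.memLp_grad).add ((hp.hardy hd).1.of_le ?_ ?_)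
  · have h : AEStronglyMeasurable (fun x : Space d => (‖x‖ ^ 2)⁻¹) volume :=
      (continuous_norm.pow 2).aestronglyMeasurable.aemeasurable.inv.aestronglyMeasurable
    exact ((Complex.continuous_ofReal.comp_aestronglyMeasurable h).const_mul (-Complex.I)).smul
      ((matrixAction N).aestronglyMeasurable_comp₂
      (LinearMap.continuous_of_finiteDimensional (clifford α)).aestronglyMeasurable hp.memLp.1)
  · filter_upwards [ae_ne_zero (d := d) (by omega)] with x hx
    have hx' : ‖x‖ ≠ 0 := norm_ne_zero_iff.2 hx
    rw [norm_smul, hαβ.norm_clifford_apply, norm_mul, norm_neg, Complex.norm_I, one_mul,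
      Complex.norm_real, norm_inv, norm_pow, norm_norm, norm_mul, norm_inv, norm_norm, norm_norm]
    field_simp
    exact le_rfl

/-- The two terms must be combined before taking absolute values: the radial part of the spin term
has the form ⟨ψ, c(r)c(Br)ψ⟩ and pairs with the same spinor c(Bx)ψ as the kinetic term. Moving it
there shifts Dψ and leaves a tangential spin term of size d - 2. -/
theorem IsMagneticPair.re_clifford_sub_zeeman_le_of_even (hp : IsMagneticPair B ψ g) (hd : 3 ≤ d)
    (heven : Even d) (hαβ : IsDiracMatrices α β) (hB : AEStronglyMeasurable B volume)
    (hBs : ∀ᵐ x, (B x)ᵀ = -(B x))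
    (hBψ : MemLp (fun x => (‖x‖ * ‖B x‖) • ψ x) 2 volume) :
    (∫ x, inner ℂ (diracGrad α g x)
          (toEuclideanLin (clifford α (toEuclideanLin (B x) x)) (ψ x))).re
        - (Complex.I / 2 * ∫ x, inner ℂ (ψ x) (toEuclideanLin (zeeman α (B x)) (ψ x))).re
      ≤ l2norm volume (fun x => (‖x‖ * ‖B x‖) • ψ x) * (l2norm volume (shiftedGrad α g ψ)
        + ((d : ℝ) - 2) / 2 * l2norm volume (fun x => ‖x‖⁻¹ * ‖ψ x‖)) := by
  have hd2 : (0 : ℝ) ≤ ((d : ℝ) - 2) / 2 := by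
    have : (3 : ℝ) ≤ d := by exact_mod_cast hd
    linarith
  have hY := (hp.hardy hd).1
  have hη := hp.memLp_shiftedGrad hd hαβ
  have i₁ := integrable_inner_of_memLp (memLp_diracGrad (α := α) hp.memLp_grad)
    (memLp_clifford_field hαβ hB hp.memLp.1 hBψ)
  have i₂ := (hp.integrable_zeeman hd (α := α) hB hBψ).const_mul (Complex.I / 2)
  have n₁ := integrable_norm_mul_norm hη hBψ
  have n₂ := (integrable_norm_mul_norm hBψ hY).const_mul (((d : ℝ) - 2) / 2)
  rw [← Complex.sub_re, ← integral_const_mul, ← integral_sub i₁ i₂]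
  refine (Complex.re_le_norm _).trans ((norm_integral_le_of_norm_le (n₁.add n₂) ?_).trans ?_)
  · filter_upwards [ae_ne_zero (d := d) (by omega), hBs] with x hx hs
    have hx' : ‖x‖ ≠ 0 := norm_ne_zero_iff.2 hx
    set r : Space d := ‖x‖⁻¹ • x with hr
    have hr1 : ‖r‖ = 1 := by
      rw [hr, norm_smul, norm_inv, norm_norm, inv_mul_cancel₀ hx']
    set c := toEuclideanLin (clifford α (toEuclideanLin (B x) x)) (ψ x) with hc
    have hcr : toEuclideanLin (clifford α r * clifford α (toEuclideanLin (B x) r)) (ψ x)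
        = (((‖x‖ ^ 2)⁻¹ : ℝ) : ℂ) • toEuclideanLin (clifford α x) c := by
      rw [hr, map_smul, LinearMap.map_smul, LinearMap.map_smul, smul_mul_smul_comm,
        toEuclideanLin_real_smul, toEuclideanLin_mul_apply, sq, mul_inv]
    have he := hαβ.norm_sum_add_le_of_even hs heven (by omega) hr1 (ψ x)
    rw [← zeeman, map_add, LinearMap.add_apply, map_smul, LinearMap.smul_apply, hcr] at he
    set ζ := toEuclideanLin (zeeman α (B x)) (ψ x) with hζ
    -- Adding and subtracting |x|⁻²c(x)c(Bx) = c(r)c(Br): the shift carries coefficient -i and the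
    -- spin term factor i/2, hence the 2 inside the bracket.
    have e : inner ℂ (diracGrad α g x) c - Complex.I / 2 * inner ℂ (ψ x) ζ
        = inner ℂ (shiftedGrad α g ψ x) c - Complex.I / 2 * inner ℂ (ψ x)
          (ζ + (2 : ℂ) • (((‖x‖ ^ 2)⁻¹ : ℝ) : ℂ) • toEuclideanLin (clifford α x) c) := by
      rw [shiftedGrad, inner_add_left, inner_smul_left, inner_add_right, inner_smul_right,
        inner_smul_right, (hαβ.clifford_hermitian x).inner_toEuclideanLin, map_mul, map_neg,
        Complex.conj_I, Complex.conj_ofReal]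
      ring
    change ‖inner ℂ (diracGrad α g x) c - Complex.I / 2 * inner ℂ (ψ x) ζ‖ ≤ _
    rw [e]
    refine (norm_sub_le _ _).trans (add_le_add ?_ ?_)
    · exact (norm_inner_le_norm _ _).trans
        (mul_le_mul_of_nonneg_left (norm_clifford_field_le hαβ _ _ _) (norm_nonneg _))
    · beta_reduce
      rw [← norm_mul_norm_eq (B x) (ψ x) hx, norm_mul, norm_div, Complex.norm_I, Complex.norm_two]
      have := (norm_inner_le_norm (𝕜 := ℂ) _ _).trans
        (mul_le_mul_of_nonneg_left he (norm_nonneg (ψ x)))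
      linarith
  · simp only [Pi.add_apply]
    rw [integral_add n₁ n₂, integral_const_mul]
    have a₁ := integral_norm_mul_norm_le hη hBψ
    have a₂ := mul_le_mul_of_nonneg_left (integral_norm_mul_norm_le hBψ hY) hd2
    linarith

/-- The radial identity at δ = 0, now legitimate because ψ/|x| is square integrable. -/
theorem IsMagneticPair.integral_inner_radial (hp : IsMagneticPair B ψ g) (hd : 3 ≤ d) :
    2 * ∫ x, (‖x‖ ^ 2)⁻¹ * (inner ℂ (ψ x) (radial g x)).re
      = -(((d : ℝ) - 2) * l2norm volume (fun x => ‖x‖⁻¹ * ‖ψ x‖) ^ 2) := by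
  have hd0 : 0 < d := by omega
  have hY := (hp.hardy hd).1
  have hint : Integrable fun x : Space d => (‖x‖ ^ 2 + 0)⁻¹ * ‖ψ x‖ ^ 2 := by
    refine hY.integrable_sq.congr (ae_of_all _ fun x => ?_)
    simp [mul_pow]
  have h := hp.integral_radial hd0 le_rfl hint
  simp only [add_zero] at h
  rw [h, sq_l2norm, ← integral_const_mul]
  congr 1
  refine integral_congr_ae ?_
  filter_upwards [ae_ne_zero hd0] with x hx
  have hx' : ‖x‖ ≠ 0 := norm_ne_zero_iff.2 hx
  rw [norm_mul, norm_inv, norm_norm, norm_norm]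
  field_simp

theorem IsMagneticPair.memLp_radial (hp : IsMagneticPair B ψ g) :
    MemLp (fun x => ‖x‖⁻¹ * ‖radial g x‖) 2 volume := by
  refine (memLp_gradNorm hp.memLp_grad).of_le ?_ (ae_of_all _ fun x => ?_)
  · refine continuous_norm.aestronglyMeasurable.aemeasurable.inv.aestronglyMeasurable.mul ?_
    refine (Finset.aestronglyMeasurable_fun_sum _ fun k _ => ?_).norm
    exact (Complex.continuous_ofReal.comp
      (EuclideanSpace.proj (𝕜 := ℝ) k).continuous).aestronglyMeasurable.smul (hp.memLp_grad k).1
  · rw [norm_mul, norm_inv, norm_norm, norm_norm, Real.norm_of_nonneg (gradNorm_nonneg g x)]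
    refine (mul_le_mul_of_nonneg_left (norm_radial_le g x) (by positivity)).trans ?_
    rw [← mul_assoc]
    exact mul_le_of_le_one_left (gradNorm_nonneg g x) (inv_mul_le_one)

/-- Hardy's inequality needs only the radial part of the gradient; this stronger form compensates
the radial loss in the estimate of the shifted gradient. -/
theorem IsMagneticPair.l2norm_radial_ge (hp : IsMagneticPair B ψ g) (hd : 3 ≤ d) :
    ((d : ℝ) - 2) / 2 * l2norm volume (fun x => ‖x‖⁻¹ * ‖ψ x‖)
      ≤ l2norm volume (fun x => ‖x‖⁻¹ * ‖radial g x‖) := by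
  have hY := (hp.hardy hd).1
  have h := hp.integral_inner_radial hd
  have b : ‖∫ x, (‖x‖ ^ 2)⁻¹ * (inner ℂ (ψ x) (radial g x) : ℂ).re‖ ≤ _ :=
    norm_integral_le_l2norm_mul hY hp.memLp_radial (ae_of_all _ fun x => by
      rw [norm_mul, norm_inv, norm_pow, norm_norm, norm_mul, norm_inv, norm_norm, norm_norm,
        norm_mul, norm_inv, norm_norm, norm_norm, Real.norm_eq_abs, sq, mul_inv]
      have := (Complex.abs_re_le_norm _).trans (norm_inner_le_norm (𝕜 := ℂ) (ψ x) (radial g x))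
      calc _ ≤ ‖x‖⁻¹ * ‖x‖⁻¹ * (‖ψ x‖ * ‖radial g x‖) := by gcongr
        _ = _ := by ring)
  rcases (l2norm_nonneg (μ := volume) fun x : Space d => ‖x‖⁻¹ * ‖ψ x‖).eq_or_lt with h0 | h0
  · rw [← h0, mul_zero]
    exact l2norm_nonneg _
  · refine le_of_mul_le_mul_left ?_ h0
    have := neg_le_of_abs_le b
    linarith

theorem re_inner_le_young (u v : Spinor N) {l : ℝ} (hl : 0 < l) (s : ℝ) :
    2 * s * (inner ℂ u v : ℂ).re ≤ l * ‖u‖ ^ 2 + l⁻¹ * (s ^ 2 * ‖v‖ ^ 2) := by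
  have h : |s * (inner ℂ u v : ℂ).re| ≤ |s| * (‖u‖ * ‖v‖) := by
    rw [abs_mul]
    exact mul_le_mul_of_nonneg_left ((Complex.abs_re_le_norm _).trans (norm_inner_le_norm _ _))
      (abs_nonneg s)
  have h' := le_of_abs_le h
  have e : l * ‖u‖ ^ 2 + l⁻¹ * (s ^ 2 * ‖v‖ ^ 2) - 2 * (|s| * (‖u‖ * ‖v‖))
      = l⁻¹ * (l * ‖u‖ - |s| * ‖v‖) ^ 2 := by
    rw [← sq_abs s]
    field_simp
    ring
  have : 0 ≤ l⁻¹ * (l * ‖u‖ - |s| * ‖v‖) ^ 2 := by positivity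
  linarith

theorem sum_coord_sq (x : Space d) : ∑ j, x j ^ 2 = ‖x‖ ^ 2 := by
  rw [EuclideanSpace.norm_sq_eq]
  simp only [Real.norm_eq_abs, sq_abs]

theorem inner_radial (g : Fin d → Space d → Spinor N) (x : Space d) (u : Spinor N) :
    inner ℂ u (radial g x) = ∑ j, (x j : ℂ) * inner ℂ u (g j x) := by
  simp only [radial, inner_sum, inner_smul_right]

/-- The length of the angular part of a gradient. -/
theorem sum_norm_sq_tangential (g : Fin d → Space d → Spinor N) {x : Space d} (hx : x ≠ 0) :
    ∑ j, ‖g j x - (((‖x‖ ^ 2)⁻¹ * x j : ℝ) : ℂ) • radial g x‖ ^ 2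
      = gradNorm g x ^ 2 - (‖x‖ ^ 2)⁻¹ * ‖radial g x‖ ^ 2 := by
  have hx' : ‖x‖ ≠ 0 := norm_ne_zero_iff.2 hx
  have e : ∀ j, ‖g j x - (((‖x‖ ^ 2)⁻¹ * x j : ℝ) : ℂ) • radial g x‖ ^ 2
      = ‖g j x‖ ^ 2 - 2 * ((‖x‖ ^ 2)⁻¹ * (x j * (inner ℂ (radial g x) (g j x) : ℂ).re))
        + ((‖x‖ ^ 2)⁻¹) ^ 2 * ‖radial g x‖ ^ 2 * x j ^ 2 := by
    intro j
    rw [norm_sub_sq (𝕜 := ℂ), inner_smul_right, norm_smul, Complex.norm_real, mul_pow,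
      Real.norm_eq_abs, sq_abs, RCLike.re_eq_complex_re, Complex.re_ofReal_mul,
      ← inner_conj_symm (g j x), Complex.conj_re]
    ring
  have hr : ∑ j, x j * (inner ℂ (radial g x) (g j x) : ℂ).re = ‖radial g x‖ ^ 2 := by
    have h := congrArg Complex.re (inner_radial g x (radial g x))
    rw [inner_self_eq_norm_sq_to_K, Complex.re_sum] at h
    simp only [Complex.re_ofReal_mul] at h
    rw [← h]
    norm_cast
  simp only [e]
  rw [Finset.sum_add_distrib, Finset.sum_sub_distrib, ← Finset.mul_sum, ← Finset.mul_sum,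
    ← Finset.mul_sum, hr, sum_coord_sq, sq_gradNorm]
  field_simp
  ring

/-- By c(x)² = |x|², the family α_j c(x)v - x_j v is tangential: it pairs to zero with anything
radial. -/
theorem IsDiracMatrices.sum_smul_alpha_clifford (hαβ : IsDiracMatrices α β) (x : Space d)
    (v : Spinor N) :
    ∑ j, (x j : ℂ) • (toEuclideanLin (α j) (toEuclideanLin (clifford α x) v) - (x j : ℂ) • v) = 0 := by
  simp only [smul_sub, Finset.sum_sub_distrib]
  rw [← clifford_toEuclideanLin, ← toEuclideanLin_mul_apply, hαβ.clifford_sq, map_smul,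
    LinearMap.smul_apply, toEuclideanLin_one_apply, ← sum_coord_sq, sub_eq_zero]
  simp only [smul_smul, ← Finset.sum_smul]
  congr 1
  push_cast
  exact Finset.sum_congr rfl fun j _ => by ring

theorem IsDiracMatrices.norm_alpha_apply (hαβ : IsDiracMatrices α β) (j : Fin d) (v : Spinor N) :
    ‖toEuclideanLin (α j) v‖ = ‖v‖ := by
  rw [← clifford_single (α := α) j, hαβ.norm_clifford_apply]
  simp

theorem IsDiracMatrices.sum_norm_sq_alpha_clifford (hαβ : IsDiracMatrices α β) (x : Space d)
    (v : Spinor N) :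
    ∑ j, ‖toEuclideanLin (α j) (toEuclideanLin (clifford α x) v) - (x j : ℂ) • v‖ ^ 2
      = ((d : ℝ) - 1) * (‖x‖ ^ 2 * ‖v‖ ^ 2) := by
  have e : ∀ j, ‖toEuclideanLin (α j) (toEuclideanLin (clifford α x) v) - (x j : ℂ) • v‖ ^ 2
      = ‖x‖ ^ 2 * ‖v‖ ^ 2 - 2 * (inner ℂ ((x j : ℂ) •
          toEuclideanLin (α j) (toEuclideanLin (clifford α x) v)) v : ℂ).re
        + x j ^ 2 * ‖v‖ ^ 2 := by
    intro j
    rw [norm_sub_sq (𝕜 := ℂ), hαβ.norm_alpha_apply, hαβ.norm_clifford_apply, norm_smul,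
      Complex.norm_real, mul_pow, mul_pow, Real.norm_eq_abs, sq_abs, RCLike.re_eq_complex_re,
      inner_smul_right, inner_smul_left, Complex.conj_ofReal]
  simp only [e]
  rw [Finset.sum_add_distrib, Finset.sum_sub_distrib, ← Finset.mul_sum, ← Finset.mul_sum,
    ← Complex.re_sum,
    ← sum_inner, ← clifford_toEuclideanLin, ← toEuclideanLin_mul_apply, hαβ.clifford_sq, map_smul,
    LinearMap.smul_apply, toEuclideanLin_one_apply, inner_smul_left, Complex.conj_ofReal,
    inner_self_eq_norm_sq_to_K, ← Finset.sum_mul, sum_coord_sq, Finset.sum_const, Finset.card_univ,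
    Fintype.card_fin, nsmul_eq_mul]
  have : ((((‖x‖ ^ 2 : ℝ) : ℂ)) * ((RCLike.ofReal ‖v‖ : ℂ)) ^ 2).re = ‖x‖ ^ 2 * ‖v‖ ^ 2 := by
    rw [Complex.re_ofReal_mul, ← RCLike.ofReal_pow]
    rfl
  rw [this]
  ring

/-- The cross term ∑⟨g_j, α_j c(x)ψ⟩ splits into a radial part ⟨x·g, ψ⟩, kept exactly for later
integration by parts, and a pairing of two tangential families, to which Young's inequality with
weight `l` applies. -/
theorem IsDiracMatrices.norm_sq_shiftedGrad_le (hαβ : IsDiracMatrices α β)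
    {x : Space d} (hx : x ≠ 0) {l : ℝ} (hl : 0 < l) :
    ‖shiftedGrad α g ψ x‖ ^ 2 ≤ ‖diracGrad α g x‖ ^ 2
      + (1 + l⁻¹ * ((d : ℝ) - 1)) * ‖‖x‖⁻¹ * ‖ψ x‖‖ ^ 2
      + 2 * ((‖x‖ ^ 2)⁻¹ * (inner ℂ (ψ x) (radial g x) : ℂ).re)
      + l * (gradNorm g x ^ 2 - ‖‖x‖⁻¹ * ‖radial g x‖‖ ^ 2) := by
  have hx' : ‖x‖ ≠ 0 := norm_ne_zero_iff.2 hx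
  set s := (‖x‖ ^ 2)⁻¹ with hs
  set c := toEuclideanLin (clifford α x) (ψ x) with hc
  have h₁ : ‖shiftedGrad α g ψ x‖ ^ 2 = ‖diracGrad α g x‖ ^ 2 + s * ‖ψ x‖ ^ 2
      + 2 * s * (∑ j, inner ℂ (g j x) (toEuclideanLin (α j) c) : ℂ).re := by
    rw [shiftedGrad, ← hc, ← hs, norm_add_sq (𝕜 := ℂ), norm_smul, hc, hαβ.norm_clifford_apply, ← hc,
      norm_mul, norm_neg, Complex.norm_I, one_mul, Complex.norm_real, RCLike.re_eq_complex_re,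
      inner_smul_right, diracGrad, inner_smul_left, map_neg, Complex.conj_I, sum_inner]
    simp only [(hαβ.alpha_hermitian _).inner_toEuclideanLin]
    rw [show -Complex.I * (s : ℂ) * (- -Complex.I * ∑ j, inner ℂ (g j x) (toEuclideanLin (α j) c))
        = (s : ℂ) * ∑ j, inner ℂ (g j x) (toEuclideanLin (α j) c) by
      linear_combination (-(s : ℂ) * ∑ j, inner ℂ (g j x) (toEuclideanLin (α j) c))
        * Complex.I_mul_I, Complex.re_ofReal_mul, Real.norm_of_nonneg (by positivity)]
    rw [hs]
    field_simp
    ring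
  have h₂ : ∑ j, inner ℂ (g j x) (toEuclideanLin (α j) c)
      = inner ℂ (radial g x) (ψ x) + ∑ j, inner ℂ (g j x - ((s * x j : ℝ) : ℂ) • radial g x)
        (toEuclideanLin (α j) c - (x j : ℂ) • ψ x) := by
    have hz := congrArg (fun v => inner ℂ (radial g x) v) (hαβ.sum_smul_alpha_clifford x (ψ x))
    simp only [inner_zero_right, inner_sum, inner_smul_right, ← hc] at hz
    have hr : inner ℂ (radial g x) (ψ x) = ∑ j, inner ℂ (g j x) ((x j : ℂ) • ψ x) := by
      simp only [radial, sum_inner, inner_smul_left, inner_smul_right, Complex.conj_ofReal]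
    simp only [inner_sub_left (𝕜 := ℂ) (g _ x), inner_smul_left, Complex.conj_ofReal,
      Finset.sum_sub_distrib]
    have hz' : ∑ j, ((s * x j : ℝ) : ℂ) * inner ℂ (radial g x)
        (toEuclideanLin (α j) c - (x j : ℂ) • ψ x) = 0 := by
      rw [← mul_zero (s : ℂ), ← hz, Finset.mul_sum]
      refine Finset.sum_congr rfl fun j _ => ?_
      push_cast
      ring
    rw [hz', hr, sub_zero, ← Finset.sum_add_distrib]
    refine Finset.sum_congr rfl fun j _ => ?_
    rw [inner_sub_right]
    ring
  -- The squared lengths of the two tangential families are known in closed form: |g|² minus its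
  -- radial part, and (d - 1)|x|²|ψ|².
  have h₃ : 2 * s * (∑ j, inner ℂ (g j x - ((s * x j : ℝ) : ℂ) • radial g x)
        (toEuclideanLin (α j) c - (x j : ℂ) • ψ x) : ℂ).re
      ≤ l * (gradNorm g x ^ 2 - s * ‖radial g x‖ ^ 2)
        + l⁻¹ * (s ^ 2 * (((d : ℝ) - 1) * (‖x‖ ^ 2 * ‖ψ x‖ ^ 2))) := by
    rw [← sum_norm_sq_tangential g hx, ← hαβ.sum_norm_sq_alpha_clifford x (ψ x), ← hc, ← hs,
      Complex.re_sum, Finset.mul_sum, Finset.mul_sum, Finset.mul_sum, Finset.mul_sum,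
      ← Finset.sum_add_distrib]
    exact Finset.sum_le_sum fun j _ => re_inner_le_young _ _ hl s
  have h₄ : ∀ t : ℝ, ‖‖x‖⁻¹ * ‖t‖‖ ^ 2 = s * t ^ 2 := fun t => by
    rw [norm_mul, norm_inv, norm_norm, norm_norm, mul_pow, inv_pow, Real.norm_eq_abs, sq_abs]
  have h₅ := h₄ ‖ψ x‖
  have h₆ := h₄ ‖radial g x‖
  rw [norm_norm] at h₅ h₆
  have h₇ : s ^ 2 * (((d : ℝ) - 1) * (‖x‖ ^ 2 * ‖ψ x‖ ^ 2)) = ((d : ℝ) - 1) * (s * ‖ψ x‖ ^ 2) := by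
    rw [hs]
    field_simp
  rw [h₇] at h₃
  rw [h₁, h₂, Complex.add_re, h₅, h₆, ← inner_conj_symm (radial g x), Complex.conj_re]
  linarith

/-- Integrating the pointwise bound turns the radial cross term into -(d - 2)Y², so the coefficient
1 becomes 3 - d; the radial Hardy bound then controls the negative term. -/
theorem IsMagneticPair.l2norm_shiftedGrad_sq_le (hp : IsMagneticPair B ψ g) (hd : 3 ≤ d)
    (hαβ : IsDiracMatrices α β) {l : ℝ} (hl : 0 < l) :
    l2norm volume (shiftedGrad α g ψ) ^ 2 ≤ l2norm volume (diracGrad α g) ^ 2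
      + (3 - (d : ℝ) + l⁻¹ * ((d : ℝ) - 1)) * l2norm volume (fun x => ‖x‖⁻¹ * ‖ψ x‖) ^ 2
      + l * (l2norm volume (gradNorm g) ^ 2
        - (((d : ℝ) - 2) / 2 * l2norm volume (fun x => ‖x‖⁻¹ * ‖ψ x‖)) ^ 2) := by
  have hd0 : 0 < d := by omega
  have hd2 : (0 : ℝ) ≤ ((d : ℝ) - 2) / 2 := by
    have : (3 : ℝ) ≤ d := by exact_mod_cast hd
    linarith
  have two : (2 : ℕ) ≠ 0 := two_ne_zero
  have hY := (hp.hardy hd).1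
  have hD := memLp_diracGrad (α := α) hp.memLp_grad
  have hG := memLp_gradNorm hp.memLp_grad
  have i₁ := hD.integrable_norm_pow two
  have i₂ := (hY.integrable_norm_pow two).const_mul (1 + l⁻¹ * ((d : ℝ) - 1))
  have i₃ : Integrable fun x => 2 * ((‖x‖ ^ 2)⁻¹ * (inner ℂ (ψ x) (radial g x) : ℂ).re) := by
    refine Integrable.const_mul (integrable_of_norm_le_mul hY hp.memLp_radial ?_
      (ae_of_all _ fun x => ?_)) 2
    · refine AEStronglyMeasurable.mul ?_ (Complex.continuous_re.comp_aestronglyMeasurable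
        (hp.memLp.1.inner ?_))
      · exact (continuous_norm.pow 2).aestronglyMeasurable.aemeasurable.inv.aestronglyMeasurable
      · refine Finset.aestronglyMeasurable_fun_sum _ fun k _ => ?_
        exact (Complex.continuous_ofReal.comp
          (EuclideanSpace.proj (𝕜 := ℝ) k).continuous).aestronglyMeasurable.smul (hp.memLp_grad k).1
    · rw [norm_mul, norm_inv, norm_pow, norm_norm, norm_mul, norm_inv, norm_norm, norm_norm,
        norm_mul, norm_inv, norm_norm, norm_norm, Real.norm_eq_abs, sq, mul_inv]
      have := (Complex.abs_re_le_norm _).trans (norm_inner_le_norm (𝕜 := ℂ) (ψ x) (radial g x))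
      calc _ ≤ ‖x‖⁻¹ * ‖x‖⁻¹ * (‖ψ x‖ * ‖radial g x‖) := by gcongr
        _ = _ := by ring
  have i₄' := hG.integrable_norm_pow two
  simp only [Real.norm_of_nonneg (gradNorm_nonneg g _)] at i₄'
  have i₅' := hp.memLp_radial.integrable_norm_pow two
  have i₄ := (i₄'.sub' i₅').const_mul l
  have key := integral_mono_ae ((hp.memLp_shiftedGrad hd hαβ).integrable_norm_pow two)
    (((i₁.fun_add i₂).fun_add i₃).fun_add i₄) (by
      filter_upwards [ae_ne_zero hd0] with x hx
      exact hαβ.norm_sq_shiftedGrad_le hx hl)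
  rw [integral_add ((i₁.fun_add i₂).fun_add i₃) i₄, integral_add (i₁.fun_add i₂) i₃,
    integral_add i₁ i₂, integral_const_mul, integral_const_mul, integral_const_mul,
    integral_sub i₄' i₅', hp.integral_inner_radial hd, ← sq_l2norm, ← sq_l2norm, ← sq_l2norm,
    ← sq_l2norm] at key
  have hGG : ∫ x, gradNorm g x ^ 2 = l2norm volume (gradNorm g) ^ 2 := by
    rw [sq_l2norm]
    simp only [Real.norm_eq_abs, sq_abs]
  rw [hGG] at key
  have hr := pow_le_pow_left₀ (mul_nonneg hd2 (l2norm_nonneg _)) (hp.l2norm_radial_ge hd) 2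
  have := mul_le_mul_of_nonneg_left hr hl.le
  linarith

end Zeeman

end MagneticDirac

namespace MagneticDirac

open Filter Topology
open Matrix (toEuclideanLin)

/-! ### The numerical inequalities -/

section Arithmetic

/-- With n = d - 2 this is the even-dimensional bound on the factor of b. A term-by-term estimate is
not made: the hypothesis is an ellipse in (L, Y), and the linear form L + nY/2 is bounded on it by
Cauchy-Schwarz. -/
theorem add_half_mul_lt {n G T Y L l : ℝ} (hn : 1 ≤ n) (hTG : T < G) (hT : 0 ≤ T)
    (hl : l = ((n + 1) / n) ^ 2)
    (hL : L ^ 2 ≤ T ^ 2 + (1 - n + l⁻¹ * (n + 1)) * Y ^ 2 + l * (G ^ 2 - (n / 2 * Y) ^ 2)) :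
    L + n / 2 * Y < (2 + 1 / n) * G := by
  have hn0 : 0 < n := by linarith
  have hG : 0 < G := hT.trans_lt hTG
  -- For the chosen l = ((n+1)/n)² the total coefficient of Y² is 1/(n+1) - (n+1)²/4 = -p, and p > 0
  -- because n ≥ 1.
  set p := ((n + 1) ^ 3 - 4) / (4 * (n + 1)) with hp
  have hq : 0 < (n + 1) ^ 3 - 4 := by nlinarith [pow_pos hn0 3, sq_nonneg (n - 1)]
  have hp0 : 0 < p := by positivity
  have h₁ : L ^ 2 + p * Y ^ 2 < (1 + l) * G ^ 2 := by
    have e : (1 - n + l⁻¹ * (n + 1)) - l * (n / 2) ^ 2 = -p := by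
      rw [hl, hp]
      field_simp
      ring
    have : T ^ 2 < G ^ 2 := by nlinarith
    have e' : (1 - n + l⁻¹ * (n + 1)) * Y ^ 2 + l * (G ^ 2 - (n / 2 * Y) ^ 2)
        = -p * Y ^ 2 + l * G ^ 2 := by
      rw [← e]
      ring
    linarith
  have h₂ : p * (L + n / 2 * Y) ^ 2 ≤ (p + n ^ 2 / 4) * (L ^ 2 + p * Y ^ 2) := by
    have e : (p + n ^ 2 / 4) * (L ^ 2 + p * Y ^ 2) - p * (L + n / 2 * Y) ^ 2
        = (n / 2 * L - p * Y) ^ 2 := by ring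
    nlinarith [sq_nonneg (n / 2 * L - p * Y)]
  -- The margin is (4n² + 5n - 6)/(4n), positive for n ≥ 1.
  have h₃ : (p + n ^ 2 / 4) * (1 + l) ≤ p * (2 + 1 / n) ^ 2 := by
    rw [← sub_nonneg]
    have e : p * (2 + 1 / n) ^ 2 - (p + n ^ 2 / 4) * (1 + l)
        = (4 * n ^ 2 + 5 * n - 6) / (4 * n) := by
      rw [hl, hp]
      field_simp
      ring
    rw [e]
    apply div_nonneg _ (by positivity)
    nlinarith
  have h₄ : p * (L + n / 2 * Y) ^ 2 < p * ((2 + 1 / n) * G) ^ 2 := by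
    have a := mul_lt_mul_of_pos_left h₁ (by positivity : 0 < p + n ^ 2 / 4)
    have b := mul_le_mul_of_nonneg_right h₃ (sq_nonneg G)
    nlinarith
  exact lt_of_pow_lt_pow_left₀ 2 (by positivity) (lt_of_mul_lt_mul_left h₄ hp0.le)

theorem remainder_le {i μ ε₁ ε₂ ε₃ M T b v w s : ℝ} (hi : 0 ≤ i) (hε₃ : 0 ≤ ε₃) (hM : 0 ≤ M)
    (hT : 0 ≤ T) (hb0 : 0 ≤ b) (hv0 : 0 ≤ v) (hTM : T ≤ M) (hw : w ≤ 2 * i * ε₃ * M)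
    (hb : b ≤ ε₁ * M) (hv : v ≤ ε₂ * M) (hs : s ≤ μ * M ^ 2) :
    w * T + w * b + T * v + s + w * v
      ≤ (2 * i * ε₃ + 2 * (i * ε₃ * ε₁) + ε₂ + μ + 2 * i * ε₂ * ε₃) * M ^ 2 := by
  have r₁ : w * T ≤ 2 * i * ε₃ * M * M := mul_le_mul hw hTM hT (by positivity)
  have r₂ : w * b ≤ 2 * i * ε₃ * M * (ε₁ * M) := mul_le_mul hw hb hb0 (by positivity)
  have r₃ : T * v ≤ M * (ε₂ * M) := mul_le_mul hTM hv hv0 hM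
  have r₅ : w * v ≤ 2 * i * ε₃ * M * (ε₂ * M) := mul_le_mul hw hv hv0 (by positivity)
  linarith only [r₁, r₂, r₃, r₅, hs]

/-- The kinetic energy is strictly smaller than that of the gradient. -/
theorem lt_of_virial {i μ ε₁ ε₂ ε₃ G T b v w s K : ℝ} (hi : 0 ≤ i)
    (hμ : 0 ≤ μ) (hε₁ : 0 ≤ ε₁) (hε₂ : 0 ≤ ε₂) (hε₃ : 0 ≤ ε₃)
    (hsmall : (2 + i) * ε₁ + 2 * i * ε₂ * ε₃ + μ + (4 + 4 * i) * ε₃ + (2 + 2 * i) * ε₂ ≤ 1)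
    (hprod : i * ε₃ * ε₁ ≤ i * ε₃ * (1 / 2))
    (h0 : ε₃ = 0 → w = 0 ∧ v = 0 ∧ s = 0) (hG : 0 < G) (hT : 0 ≤ T) (hb0 : 0 ≤ b) (hv0 : 0 ≤ v)
    (hw : w ≤ 2 * i * ε₃ * G) (hb : b ≤ ε₁ * G) (hv : v ≤ ε₂ * G) (hs : s ≤ μ * G ^ 2)
    (hvir : T ^ 2 ≤ K + w * T + w * b + T * v + s + w * v) (hK : K ≤ T * b) : T < G := by
  by_contra! hTG
  have hT0 : 0 < T := hG.trans_le hTG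
  have bG : ∀ c, 0 ≤ c → c * G ≤ c * T := fun c hc => mul_le_mul_of_nonneg_left hTG hc
  have hbT := hb.trans (bG _ hε₁)
  have hR := remainder_le hi hε₃ hT hT hb0 hv0 le_rfl (hw.trans (bG _ (by positivity))) hbT
    (hv.trans (bG _ hε₂)) (hs.trans (mul_le_mul_of_nonneg_left (pow_le_pow_left₀ hG.le hTG 2) hμ))
  have hK' : K ≤ T * (ε₁ * T) := hK.trans (mul_le_mul_of_nonneg_left hbT hT)
  have h₁ : T ^ 2 * 1 ≤ T ^ 2 * (ε₁ + (2 * i * ε₃ + 2 * (i * ε₃ * ε₁) + ε₂ + μ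
      + 2 * i * ε₂ * ε₃)) := by linarith only [hvir, hR, hK']
  have h₂ := le_of_mul_le_mul_left h₁ (by positivity)
  have p₁ : 0 ≤ i * ε₁ := by positivity
  have p₂ : 0 ≤ i * ε₂ := by positivity
  have p₃ : 0 ≤ i * ε₃ := by positivity
  -- The assumption G ≤ T saturates the smallness condition, which leaves slack in both ε₁ and ε₃,
  -- so both vanish. Then nothing on the right of the virial estimate survives and T = 0.
  have h₃ : ε₃ = 0 := by linarith only [h₂, hsmall, hprod, p₁, p₂, p₃, hε₁, hε₂, hε₃]
  have h₄ : ε₁ = 0 := by linarith only [h₂, hsmall, hprod, p₁, p₂, p₃, hε₁, hε₂, hε₃]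
  obtain ⟨hw', hv', hs'⟩ := h0 h₃
  rw [hw', hv', hs'] at hvir
  rw [h₄] at hK'
  have := pow_pos hT0 2
  linarith only [hvir, hK', this]

/-- The smallness condition is incompatible with the virial estimates. -/
theorem virial_contradiction {n μ ε₁ ε₂ ε₃ G T Y b v w s L K S : ℝ} (hn : 1 ≤ n) (hμ : 0 ≤ μ)
    (hε₁ : 0 ≤ ε₁) (hε₂ : 0 ≤ ε₂) (hε₃ : 0 ≤ ε₃)
    (hsmall : (4 * n + 2) / n * ε₁ + 4 / n * ε₂ * ε₃ + 2 * μ + (8 * n + 8) / n * ε₃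
      + (4 * n + 4) / n * ε₂ ≤ 2)
    (h0 : ε₃ = 0 → v = 0 ∧ s = 0) (hG : 0 < G) (hT : 0 ≤ T) (hb0 : 0 ≤ b) (hv0 : 0 ≤ v)
    (hw0 : 0 ≤ w) (hL0 : 0 ≤ L) (hY : n * Y ≤ 2 * G) (hw : w ≤ ε₃ * Y) (hb : b ≤ ε₁ * G)
    (hv : v ≤ ε₂ * G) (hs : s ≤ μ * G ^ 2)
    (hvir : T ^ 2 ≤ K + w * T + w * b + T * v + s + w * v) (hK : K ≤ T * b)
    (hlich : T ^ 2 = G ^ 2 + S) (hQ : K - S ≤ b * L) (hL : T < G → L < (2 + 1 / n) * G) :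
    False := by
  have hn0 : 0 < n := by linarith only [hn]
  obtain ⟨i, hi⟩ : ∃ i, i = 1 / n := ⟨_, rfl⟩
  have hi0 : 0 < i := by rw [hi]; positivity
  have hsm : (2 + i) * ε₁ + 2 * i * ε₂ * ε₃ + μ + (4 + 4 * i) * ε₃ + (2 + 2 * i) * ε₂ ≤ 1 := by
    have e : (4 * n + 2) / n * ε₁ + 4 / n * ε₂ * ε₃ + 2 * μ + (8 * n + 8) / n * ε₃
      + (4 * n + 4) / n * ε₂ = 2 * ((2 + i) * ε₁ + 2 * i * ε₂ * ε₃ + μ + (4 + 4 * i) * ε₃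
        + (2 + 2 * i) * ε₂) := by
      rw [hi]
      field_simp
      ring
    linarith only [e, hsmall]
  have hY' : Y ≤ 2 * i * G := by
    rw [hi, show 2 * (1 / n) * G = 2 * G / n by ring, le_div_iff₀ hn0, mul_comm]
    exact hY
  have hw' : w ≤ 2 * i * ε₃ * G := by
    have := mul_le_mul_of_nonneg_left hY' hε₃
    linarith only [this, hw]
  rw [← hi] at hL
  have p₁ : 0 ≤ i * ε₁ := by positivity
  have p₂ : 0 ≤ i * ε₂ := by positivity
  have p₃ : 0 ≤ i * ε₃ := by positivity
  have p₂₃ : 0 ≤ i * ε₂ * ε₃ := by positivity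
  have hε₁h : ε₁ ≤ 1 / 2 := by linarith only [hsm, p₁, p₂, p₃, p₂₃, hμ, hε₁, hε₂, hε₃]
  have hprod : i * ε₃ * ε₁ ≤ i * ε₃ * (1 / 2) := mul_le_mul_of_nonneg_left hε₁h p₃
  have h0' : ε₃ = 0 → w = 0 ∧ v = 0 ∧ s = 0 := fun h => by
    rw [h, mul_zero, zero_mul] at hw'
    exact ⟨le_antisymm hw' hw0, h0 h⟩
  have hTG := lt_of_virial hi0.le hμ hε₁ hε₂ hε₃ hsm hprod h0' hG hT hb0 hv0 hw' hb hv hs hvir hK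
  have hR := remainder_le hi0.le hε₃ hG.le hT hb0 hv0 hTG.le hw' hb hv hs
  have hL' := hL hTG
  -- Now G² = T² - S ≤ (K - S) + R with K - S ≤ bL, and the coefficient (2 + i)ε₁ is exactly the one
  -- in the smallness condition.
  have hbL : b * L ≤ ε₁ * G * L := mul_le_mul_of_nonneg_right hb hL0
  have hbL' : ε₁ * G * L ≤ ε₁ * G * ((2 + i) * G) :=
    mul_le_mul_of_nonneg_left hL'.le (by positivity)
  have h₁ : G ^ 2 * 1 ≤ G ^ 2 * ((2 + i) * ε₁ + (2 * i * ε₃ + 2 * (i * ε₃ * ε₁) + ε₂ + μ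
      + 2 * i * ε₂ * ε₃)) := by linarith only [hvir, hR, hlich, hQ, hbL, hbL']
  have h₂ := le_of_mul_le_mul_left h₁ (by positivity)
  -- Equality in the smallness condition is allowed, so the borderline must be excluded: slack in ε₃
  -- forces it to vanish, the electric terms disappear, and the strict bound on L decides when ε₁ >
  -- 0.
  have h₃ : ε₃ = 0 := by linarith only [h₂, hsm, hprod, p₂, p₃, hε₂, hε₃]
  obtain ⟨hw'', hv', hs'⟩ := h0' h₃
  rw [hw'', hv', hs'] at hvir
  have hG2 := pow_pos hG 2
  rcases hε₁.eq_or_lt with h | h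
  · rw [← h] at hbL
    linarith only [hvir, hlich, hQ, hbL, hG2]
  · have h₅ : ε₁ * G * L < ε₁ * G * ((2 + i) * G) := mul_lt_mul_of_pos_left hL' (by positivity)
    have h₄ : (2 + i) * ε₁ ≤ 1 := by linarith only [hsm, p₂, p₃, p₂₃, hμ, hε₂, hε₃]
    have h₆ := mul_le_mul_of_nonneg_right h₄ (sq_nonneg G)
    linarith only [hvir, hlich, hQ, hbL, h₅, h₆]

end Arithmetic

/-! ### Invariance under constant unitary conjugation -/

section Conjugation

variable {d N : ℕ} {V : Space d → Matrix (Fin N) (Fin N) ℂ} {P : Matrix (Fin N) (Fin N) ℂ}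

theorem norm_unitary_conj (hP : P ∈ Matrix.unitaryGroup (Fin N) ℂ) (M : Matrix (Fin N) (Fin N) ℂ) :
    ‖P * M * Pᴴ‖ = ‖M‖ := by
  rw [← Matrix.star_eq_conjTranspose, CStarRing.norm_mul_mem_unitary _ (Unitary.star_mem hP),
    CStarRing.norm_mem_unitary_mul _ hP]

theorem norm_fderiv_unitary_conj_le (hP : P ∈ Matrix.unitaryGroup (Fin N) ℂ) {x : Space d}
    (hV : DifferentiableAt ℝ V x) :
    ‖fderiv ℝ (fun x => P * V x * Pᴴ) x‖ ≤ ‖fderiv ℝ V x‖ := by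
  have h : HasFDerivAt (fun x => P * V x * Pᴴ) _ x := (hV.hasFDerivAt.const_mul P).mul_const' Pᴴ
  rw [h.fderiv]
  refine ContinuousLinearMap.opNorm_le_bound _ (norm_nonneg _) fun v => ?_
  change ‖P * fderiv ℝ V x v * Pᴴ‖ ≤ _
  rw [norm_unitary_conj hP]
  exact (fderiv ℝ V x).le_opNorm v

theorem contDiffOn_unitary_conj (hV : ContDiffOn ℝ ∞ V {0}ᶜ) :
    ContDiffOn ℝ ∞ (fun x => P * V x * Pᴴ) {0}ᶜ :=
  (contDiffOn_const.mul hV).mul contDiffOn_const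

end Conjugation

/-! ### Norm bounds for the eigenfunction and its gradient -/

section Bounds

variable {d N : ℕ} {α : Fin d → Matrix (Fin N) (Fin N) ℂ} {β : Matrix (Fin N) (Fin N) ℂ} {m : ℝ}
  {A : Space d → Space d} {B : Space d → Matrix (Fin d) (Fin d) ℝ}

theorem magGradSq_eq_ofReal (hαβ : IsDiracMatrices α β) (hA : IsAdmissibleMagnetic α β m A B)
    (ψ : H1 d N) :
    magGradSq A ψ = ENNReal.ofReal (l2norm volume (gradNorm fun j => magPartial A j ψ) ^ 2) := by
  rw [← lintegral_enorm_sq_eq (memLp_gradNorm fun j => hA.memLp_magPartial hαβ j ψ), magGradSq]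
  refine lintegral_congr fun x => ?_
  rw [Real.enorm_of_nonneg (gradNorm_nonneg _ x), ← ENNReal.ofReal_pow (gradNorm_nonneg _ x),
    sq_gradNorm, ENNReal.ofReal_sum_of_nonneg fun _ _ => sq_nonneg _]
  refine Finset.sum_congr rfl fun j _ => ?_
  rw [ENNReal.ofReal_pow (norm_nonneg _), ofReal_norm]

theorem IsMagBounded.l2norm_le {w : Space d → ℝ} {ε : ℝ} (hw : IsMagBounded N A w ε) (hε : 0 ≤ ε)
    (hαβ : IsDiracMatrices α β) (hA : IsAdmissibleMagnetic α β m A B) (ψ : H1 d N) :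
    l2norm volume (fun x => w x • (ψ : L2 d N) x)
      ≤ ε * l2norm volume (gradNorm fun j => magPartial A j ψ) := by
  refine l2norm_le_of_lintegral_le (hw.memLp hαβ hA ψ) (mul_nonneg hε (l2norm_nonneg _)) ?_
  rw [mul_pow, ENNReal.ofReal_mul (sq_nonneg ε), ← magGradSq_eq_ofReal hαβ hA]
  refine le_trans (le_of_eq (lintegral_congr fun x => ?_)) (hw.2 ψ)
  rw [enorm_smul, mul_pow]

theorem l2norm_coe_ne_zero {ψ : L2 d N} (hψ : ψ ≠ 0) : l2norm volume (ψ : Space d → Spinor N) ≠ 0 := by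
  intro h
  refine hψ (norm_eq_zero.1 ?_)
  rw [Lp.norm_def, eLpNorm_eq_ofReal_l2norm (Lp.memLp ψ), h]
  simp

/-- By Hardy's inequality a vanishing magnetic gradient forces ψ/|x| = 0. Positivity of G is what
allows division by G² at the end. -/
theorem IsMagneticPair.l2norm_gradNorm_pos {ψ : Space d → Spinor N}
    {g : Fin d → Space d → Spinor N} (hp : IsMagneticPair B ψ g) (hd : 3 ≤ d)
    (hψ : l2norm volume ψ ≠ 0) : 0 < l2norm volume (gradNorm g) := by
  refine (l2norm_nonneg _).lt_of_ne fun h => hψ ?_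
  obtain ⟨hY, hle⟩ := hp.hardy hd
  rw [← h, mul_zero] at hle
  have hd3 : (3 : ℝ) ≤ d := by exact_mod_cast hd
  have hY0 : l2norm volume (fun x => ‖x‖⁻¹ * ‖ψ x‖) = 0 :=
    le_antisymm (nonpos_of_mul_nonpos_right hle (by linarith)) (l2norm_nonneg _)
  have hz := eLpNorm_eq_ofReal_l2norm hY
  rw [hY0, ENNReal.ofReal_zero, eLpNorm_eq_zero_iff hY.1 two_ne_zero] at hz
  have h0 : ∫ x, ‖ψ x‖ ^ 2 = 0 := by
    refine (integral_eq_zero_of_ae ?_)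
    filter_upwards [hz, ae_ne_zero (d := d) (by omega)] with x hx hx0
    have := mul_eq_zero.1 hx |>.resolve_left (inv_ne_zero (norm_ne_zero_iff.2 hx0))
    rw [this]
    simp
  rw [l2norm, h0, Real.sqrt_zero]

end Bounds

/-! ### Absence of eigenvalues -/

section Main

variable {d N : ℕ} {α : Fin d → Matrix (Fin N) (Fin N) ℂ} {β : Matrix (Fin N) (Fin N) ℂ} {m : ℝ}
  {A : Space d → Space d} {B : Space d → Matrix (Fin d) (Fin d) ℝ}
  {V : Space d → Matrix (Fin N) (Fin N) ℂ}

theorem pointSpectrum_diracOp_eq_empty (hd : 3 ≤ d) (hαβ : IsDiracMatrices α β) (hm : 0 ≤ m)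
    (hA : IsAdmissibleMagnetic α β m A B) (hVh : ∀ᵐ x, (V x).IsHermitian)
    (hVsmooth : ContDiffOn ℝ ∞ V {0}ᶜ)
    {ε₁ ε₂ ε₃ ε₄ : ℝ} (hε₁ : 0 ≤ ε₁) (hε₂ : 0 ≤ ε₂) (hε₃ : 0 ≤ ε₃)
    (hsmall : (4 * (d : ℝ) - 6) / ((d : ℝ) - 2) * ε₁ + 4 / ((d : ℝ) - 2) * ε₂ * ε₃
      + 2 * m * ε₄ ^ 2 + (8 * (d : ℝ) - 8) / ((d : ℝ) - 2) * ε₃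
      + (4 * (d : ℝ) - 4) / ((d : ℝ) - 2) * ε₂ ≤ 2)
    (hB : IsMagBounded N A (fun x => ‖x‖ * ‖B x‖) ε₁)
    (hGradV : IsMagBounded N A (fun x => ‖x‖ * ‖fderiv ℝ V x‖) ε₂)
    (hSupV : ∀ x : Space d, ‖x‖ * ‖V x‖ ≤ ε₃)
    (hMass : m ≠ 0 → ∀ ψ : H1 d N,
      ∫⁻ x, ‖x‖ₑ * ‖fderiv ℝ V x‖ₑ * ‖(ψ : L2 d N) x‖ₑ ^ 2
        ≤ ENNReal.ofReal (ε₄ ^ 2) * magGradSq A ψ) :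
    pointSpectrum (diracOp α β m A V) = ∅ := by
  rw [Set.eq_empty_iff_forall_notMem]
  rintro z ⟨φ, hφ, hz⟩
  have hd0 : 0 < d := by omega
  set ψ : H1 d N := ⟨φ, φ.2.1⟩ with hψdef
  set g : Fin d → Space d → Spinor N := fun j => magPartial A j ψ with hg
  have hp : IsMagneticPair B (ψ : L2 d N) g := isMagneticPair_magPartial hαβ hA hB ψ
  have heq : ∀ᵐ x, diracGrad α g x + (m : ℂ) • toEuclideanLin β ((ψ : L2 d N) x)
      + toEuclideanLin (V x) ((ψ : L2 d N) x) = z • (ψ : L2 d N) x := by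
    have h := diracOp_apply α β m A V φ
    rw [hz] at h
    filter_upwards [h, Lp.coeFn_smul z (φ : L2 d N)] with x h₁ h₂
    rw [h₂] at h₁
    exact h₁.symm
  have hψ : l2norm volume (ψ : L2 d N) ≠ 0 := l2norm_coe_ne_zero hφ
  have hBm := hA.locL2_field.aestronglyMeasurable
  have hBs := IsMagneticField.skew hA
  have hBψ := hB.memLp hαβ hA ψ
  have hV'ψ := hGradV.memLp hαβ hA ψ
  obtain ⟨hVψ, hVle⟩ := hp.memLp_electric hd hVsmooth hSupV
  have hY := hp.hardy hd
  have hG := hp.l2norm_gradNorm_pos hd hψ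
  have hvir := hp.virial_estimate hd hαβ hm hBm hBψ hVsmooth hVh hVψ hV'ψ heq hψ
  have hlich := hp.integral_inner_diracGrad_self hd hαβ hBm hBψ
  have hd3 : (3 : ℝ) ≤ d := by exact_mod_cast hd
  have hK := (Complex.re_le_norm _).trans (norm_integral_le_l2norm_mul
    (memLp_diracGrad (α := α) hp.memLp_grad) hBψ (G := ℂ)
    (f := fun x => inner ℂ (diracGrad α g x)
      (toEuclideanLin (clifford α (toEuclideanLin (B x) x)) ((ψ : L2 d N) x)))
    (ae_of_all _ fun x => (norm_inner_le_norm _ _).trans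
      (mul_le_mul_of_nonneg_left (norm_clifford_field_le hαβ _ _ _) (norm_nonneg _))))
  have hs : m * (∫ x, ‖x‖ * ‖fderiv ℝ V x‖ * ‖(ψ : L2 d N) x‖ ^ 2)
      ≤ m * ε₄ ^ 2 * l2norm volume (gradNorm g) ^ 2 := by
    rcases eq_or_ne m 0 with h | h
    · simp [h]
    · rw [mul_assoc]
      refine mul_le_mul_of_nonneg_left ?_ hm
      have hi : Integrable fun x => ‖x‖ * ‖fderiv ℝ V x‖ * ‖(ψ : L2 d N) x‖ ^ 2 := by
        refine (integrable_norm_mul_norm hV'ψ hp.memLp).congr (ae_of_all _ fun x => ?_)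
        simp only [norm_smul, norm_mul, norm_norm]
        ring
      rw [← ENNReal.ofReal_le_ofReal_iff (by positivity),
        ofReal_integral_eq_lintegral_ofReal hi (ae_of_all _ fun x => by positivity),
        ENNReal.ofReal_mul (sq_nonneg ε₄), ← magGradSq_eq_ofReal hαβ hA]
      refine le_trans (le_of_eq (lintegral_congr fun x => ?_)) (hMass h ψ)
      rw [ENNReal.ofReal_mul (by positivity), ENNReal.ofReal_mul (norm_nonneg x),
        ENNReal.ofReal_pow (norm_nonneg _), ofReal_norm, ofReal_norm, ofReal_norm]
  -- When ε₃ = 0 the potential vanishes off the origin and so does its gradient there; this feeds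
  -- the borderline case of the arithmetic, where no smallness is left.
  have h0 : ε₃ = 0 → l2norm volume (fun x => (‖x‖ * ‖fderiv ℝ V x‖) • (ψ : L2 d N) x) = 0
      ∧ m * (∫ x, ‖x‖ * ‖fderiv ℝ V x‖ * ‖(ψ : L2 d N) x‖ ^ 2) = 0 := by
    intro h
    have hV0 : ∀ x, x ≠ 0 → fderiv ℝ V x = 0 := by
      intro x hx
      have : V =ᶠ[𝓝 x] fun _ => 0 := by
        filter_upwards [isOpen_compl_singleton.mem_nhds (show x ∈ ({0}ᶜ : Set (Space d)) from hx)]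
          with y hy
        have := hSupV y
        rw [h] at this
        exact norm_le_zero_iff.1 (nonpos_of_mul_nonpos_right this (norm_pos_iff.2 hy))
      rw [this.fderiv_eq, fderiv_fun_const]
      rfl
    constructor
    · rw [l2norm, integral_eq_zero_of_ae, Real.sqrt_zero]
      filter_upwards [ae_ne_zero hd0] with x hx
      simp [hV0 x hx]
    · rw [integral_eq_zero_of_ae, mul_zero]
      filter_upwards [ae_ne_zero hd0] with x hx
      simp [hV0 x hx]
  -- The smallness condition rewritten in n = d - 2; for instance 4d - 6 = 4n + 2.
  have hsmall' : (4 * ((d : ℝ) - 2) + 2) / ((d : ℝ) - 2) * ε₁ + 4 / ((d : ℝ) - 2) * ε₂ * ε₃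
      + 2 * (m * ε₄ ^ 2) + (8 * ((d : ℝ) - 2) + 8) / ((d : ℝ) - 2) * ε₃
      + (4 * ((d : ℝ) - 2) + 4) / ((d : ℝ) - 2) * ε₂ ≤ 2 := by
    refine le_trans (le_of_eq ?_) hsmall
    ring
  have hY0 := l2norm_nonneg (μ := volume) fun x => ‖x‖⁻¹ * ‖(ψ : L2 d N) x‖
  have hD0 := l2norm_nonneg (μ := volume) (diracGrad α g)
  rcases Nat.even_or_odd d with heven | hodd
  · refine virial_contradiction (L := l2norm volume (shiftedGrad α g (ψ : L2 d N))
        + ((d : ℝ) - 2) / 2 * l2norm volume (fun x => ‖x‖⁻¹ * ‖(ψ : L2 d N) x‖))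
      (by linarith) (by positivity) hε₁ hε₂ hε₃ hsmall' h0 hG hD0
      (l2norm_nonneg _) (l2norm_nonneg _) (l2norm_nonneg _)
      (add_nonneg (l2norm_nonneg _) (mul_nonneg (by linarith) hY0)) hY.2 hVle
      (hB.l2norm_le hε₁ hαβ hA ψ) (hGradV.l2norm_le hε₂ hαβ hA ψ) hs hvir hK hlich
      (hp.re_clifford_sub_zeeman_le_of_even hd heven hαβ hBm hBs hBψ) fun hTG => ?_
    have hl : 0 < ((((d : ℝ) - 2) + 1) / ((d : ℝ) - 2)) ^ 2 := by
      have : 0 < (d : ℝ) - 2 := by linarith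
      positivity
    refine add_half_mul_lt (by linarith) hTG hD0 rfl ((hp.l2norm_shiftedGrad_sq_le hd hαβ hl).trans_eq ?_)
    ring
  · refine virial_contradiction (L := l2norm volume (diracGrad α g)
        + ((d : ℝ) - 1) / 2 * l2norm volume (fun x => ‖x‖⁻¹ * ‖(ψ : L2 d N) x‖))
      (by linarith) (by positivity) hε₁ hε₂ hε₃ hsmall' h0 hG hD0
      (l2norm_nonneg _) (l2norm_nonneg _) (l2norm_nonneg _)
      (add_nonneg hD0 (mul_nonneg (by linarith) hY0)) hY.2 hVle
      (hB.l2norm_le hε₁ hαβ hA ψ) (hGradV.l2norm_le hε₂ hαβ hA ψ) hs hvir hK hlich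
      (hp.re_clifford_sub_zeeman_le_of_odd hd hodd hαβ hBs hBψ) fun hTG => ?_
    have hd2 : 0 < (d : ℝ) - 2 := by linarith
    -- In odd dimension T < G and Hardy's inequality already give L < G + (1 + 1/n)G.
    have h₁ : ((d : ℝ) - 1) / 2 * l2norm volume (fun x => ‖x‖⁻¹ * ‖(ψ : L2 d N) x‖)
        ≤ ((d : ℝ) - 1) / 2 * (2 * l2norm volume (gradNorm g) / ((d : ℝ) - 2)) := by
      refine mul_le_mul_of_nonneg_left ?_ (by linarith)
      rw [le_div_iff₀ hd2, mul_comm]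
      exact hY.2
    have e : ((d : ℝ) - 1) / 2 * (2 * l2norm volume (gradNorm g) / ((d : ℝ) - 2))
        = (1 + 1 / ((d : ℝ) - 2)) * l2norm volume (gradNorm g) := by
      field_simp
      ring
    rw [e] at h₁
    linarith

end Main

end MagneticDirac

open MagneticDirac in
theorem corollary1p4 (d N : ℕ) (hd : 3 ≤ d) (hN : N = 2 ^ ((d + 1) / 2))
    (α : Fin d → Matrix (Fin N) (Fin N) ℂ) (β : Matrix (Fin N) (Fin N) ℂ)
    (hαβ : IsDiracMatrices α β) (m : ℝ) (hm : 0 ≤ m)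
    (A : Space d → Space d) (B : Space d → Matrix (Fin d) (Fin d) ℝ)
    (hA : IsAdmissibleMagnetic α β m A B)
    (V : Space d → Matrix (Fin N) (Fin N) ℂ) (hV : IsAdmissibleElectric α β m A V)
    (hVsmooth : ContDiffOn ℝ ∞ V {0}ᶜ)
    (hVbdd : ∀ r : ℝ, 0 < r → ∃ C : ℝ, ∀ x : Space d, r ≤ ‖x‖ → ‖V x‖ ≤ C)
    (ε₁ ε₂ ε₃ ε₄ : ℝ) (hε₁ : 0 ≤ ε₁) (hε₂ : 0 ≤ ε₂) (hε₃ : 0 ≤ ε₃) (hε₄ : 0 ≤ ε₄)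
    (hsmall : (4 * (d : ℝ) - 6) / ((d : ℝ) - 2) * ε₁ + 4 / ((d : ℝ) - 2) * ε₂ * ε₃
      + 2 * m * ε₄ ^ 2 + (8 * (d : ℝ) - 8) / ((d : ℝ) - 2) * ε₃
      + (4 * (d : ℝ) - 4) / ((d : ℝ) - 2) * ε₂ ≤ 2)
    (hB : ∀ ψ : H1 d N, ∫⁻ x, ‖x‖ₑ ^ 2 * ‖B x‖ₑ ^ 2 * ‖(ψ : L2 d N) x‖ₑ ^ 2
      ≤ ENNReal.ofReal (ε₁ ^ 2) * magGradSq A ψ)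
    (hGradV : ∀ ψ : H1 d N, ∫⁻ x, ‖x‖ₑ ^ 2 * ‖fderiv ℝ V x‖ₑ ^ 2 * ‖(ψ : L2 d N) x‖ₑ ^ 2
      ≤ ENNReal.ofReal (ε₂ ^ 2) * magGradSq A ψ)
    (hSupV : ∀ x : Space d, ‖x‖ * ‖V x‖ ≤ ε₃)
    (hMass : m ≠ 0 → ∀ ψ : H1 d N,
      ∫⁻ x, ‖x‖ₑ * ‖fderiv ℝ V x‖ₑ * ‖(ψ : L2 d N) x‖ₑ ^ 2
        ≤ ENNReal.ofReal (ε₄ ^ 2) * magGradSq A ψ)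
    (P : Matrix (Fin N) (Fin N) ℂ) (hP : P ∈ Matrix.unitaryGroup (Fin N) ℂ) :
    pointSpectrum (diracOp α β m A (fun x => P * V x * Pᴴ)) = ∅ := by
  have hd0 : 0 < d := by omega
  have hW := contDiffOn_unitary_conj (P := P) hVsmooth
  -- Conjugation by a constant unitary does not increase the gradient norm, so all integral
  -- hypotheses carry over to the conjugated potential.
  have hle : ∀ᵐ x, ‖fderiv ℝ (fun x => P * V x * Pᴴ) x‖ₑ ≤ ‖fderiv ℝ V x‖ₑ := by
    filter_upwards [ae_ne_zero hd0] with x hx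
    rw [← ofReal_norm, ← ofReal_norm]
    exact ENNReal.ofReal_le_ofReal
      (norm_fderiv_unitary_conj_le hP (differentiableAt_of_contDiffOn_compl hVsmooth hx))
  refine pointSpectrum_diracOp_eq_empty hd hαβ hm hA ?_ hW hε₁ hε₂ hε₃ hsmall
    ⟨continuous_norm.aestronglyMeasurable.mul hA.locL2_field.aestronglyMeasurable.norm,
      fun ψ => ?_⟩
    ⟨continuous_norm.aestronglyMeasurable.mul (aestronglyMeasurable_fderiv hd0 hW).norm,
      fun ψ => ?_⟩ (fun x => ?_) fun h ψ => ?_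
  · filter_upwards [hV.hermitian] with x hx
    exact Matrix.isHermitian_mul_mul_conjTranspose P hx
  · refine le_trans (le_of_eq (lintegral_congr fun x => ?_)) (hB ψ)
    rw [enorm_mul, enorm_norm, enorm_norm, mul_pow]
  · refine le_trans (lintegral_mono_ae ?_) (hGradV ψ)
    filter_upwards [hle] with x hx
    rw [enorm_mul, enorm_norm, enorm_norm, mul_pow]
    gcongr
  · rw [norm_unitary_conj hP]
    exact hSupV x
  · refine le_trans (lintegral_mono_ae ?_) (hMass h ψ)
    filter_upwards [hle] with x hx
    gcongr
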